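/- **Model.** Let $\lambda_v>0$, $0<\gamma\le 1$, $\lambda_r>0$, $0<d<\lambda_r^{-1}/2$ and $\rho^{\mathrm{RSU}}>0$. Vehicles on the line form a Poisson point process of intensity $\lambda_v$; each is independently V2V+V2I capable with probability $\gamma$ and otherwise a legacy vehicle. Road side units (RSUs) are at the points $k\lambda_r^{-1}$, $k\in\mathbb Z$, each with capacity $\rho^{\mathrm{RSU}}$. Two capable vehicles are linked if they are within distance $d$ and no vehicle lies between them; a cluster is a connected component of the graph of links (possibly one vehicle). In the V2V+V2I network a capable vehicle is connected to every RSU that is within distance $d$ of some vehicle of its cluster; in the V2I network it is connected to the RSU within distance $d$ of itself, if any. In each network the RSU capacities are shared among the connected vehicles by the max-min fair allocation (an RSU may split its capacity arbitrarily among the vehicles connected to it, and the rate of a vehicle is the total it receives). $R_v$ and $R_v^*$ denote the rates of a typical capable vehicle in the V2V+V2I and in the V2I network, and $\pi_v$ and $\pi_v^*$ the probabilities that it is connected to at least one RSU. Here the law of a typical vehicle (or cluster) is the average over the capable vehicles (or clusters, located by their first vehicle) in one period $[0,\lambda_r^{-1})$ of the road, i.e. the expected number of them with a given property divided by their expected number.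 $N$ and $M$ are the number of vehicles of a typical cluster and the number of RSUs to which it is connected, $F^c_{M\mid N}(m\mid n)=P(M>m\mid N=n)$, and $\varphi=1-\gamma(1-e^{-\lambda_v d})$. **Theorem.** The max-min fair allocation almost surely exists and is unique in both networks, and $R_v$, $R_v^*$ are square integrable random variables. (a) For every $r\ge 0$, $$F_{R_v}(r)\ \ge\ 1-\varphi^2\sum_{n=1}^{\infty} n\,(1-\varphi)^{n-1}\,F^c_{M\mid N}\!\left(\left\lfloor \frac{rn}{\rho^{\mathrm{RSU}}}\right\rfloor \,\Big|\, n\right),$$ and $P(R_v=0)=1-\pi_v$. (b) For $0<r<\rho^{\mathrm{RSU}}$, $$F_{R_v^*}(r)=1-\frac{2d}{\lambda_r^{-1}}\; Q\!\left(\left\lceil\frac{\rho^{\mathrm{RSU}}}{r}\right\rceil-1,\ 2\gamma\lambda_v d\right),\qquad Q(a,x)=\frac{1}{\Gamma(a)}\int_x^\infty t^{a-1}e^{-t}\,dt ,$$ $F_{R_v^*}(r)=1$ for $r\ge\rho^{\mathrm{RSU}}$, and $P(R_v^*=0)=1-\pi_v^*$. (c) $R_v\le^{\mathrm{icx}}R_v^*$,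 i.e. $\mathbb E[f(R_v)]\le\mathbb E[f(R_v^*)]$ for every increasing convex $f:\mathbb R\to\mathbb R$ for which the expectations are defined; and $\operatorname{Var}(R_v^*)\ge\operatorname{Var}(R_v)$. -/

import Mathlib

open MeasureTheory ProbabilityTheory Set
open scoped NNReal ENNReal

noncomputable section

namespace V2V

/-! ### Poisson point processes -/

/-- `V` is a (simple) Poisson point process with intensity measure `Λ`, given as a random set of
points: the number of points in a measurable set of finite intensity is Poisson distributed, and the
numbers of points in finitely many disjoint measurable sets are independent. -/
structure IsPoissonPP {Ω E : Type*} [MeasurableSpace Ω] [MeasurableSpace E]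
    (P : Measure Ω) (V : Ω → Set E) (Λ : Measure E) : Prop where
  measurable_count : ∀ B : Set E, MeasurableSet B → Measurable fun ω => (V ω ∩ B).encard
  law_count : ∀ B : Set E, MeasurableSet B → Λ B ≠ ∞ → ∀ n : ℕ,
    P {ω | (V ω ∩ B).encard = n} = poissonMeasure (Λ B).toNNReal {n}
  indep_count : ∀ (n : ℕ) (B : Fin n → Set E), (∀ i, MeasurableSet (B i)) →
    Pairwise (fun i j => Disjoint (B i) (B j)) → iIndepFun (fun i ω => (V ω ∩ B i).encard) P

/-- Intensity of the vehicles on the road, where a vehicle is a position together with a mark saying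
whether it is V2V+V2I capable (`true`) or a legacy vehicle (`false`): positions have intensity `lam`
per unit length and every vehicle is independently capable with probability `γ`. -/
def vehicleIntensity (lam γ : ℝ) : Measure (ℝ × Bool) :=
  (ENNReal.ofReal lam • (volume : Measure ℝ)).prod
    (ENNReal.ofReal γ • Measure.dirac true + ENNReal.ofReal (1 - γ) • Measure.dirac false)

/-! ### Links and clusters.  A configuration `c : Set (ℝ × Bool)` is a set of marked vehicles. -/

/-- Positions of the V2V+V2I capable vehicles. -/
def capable (c : Set (ℝ × Bool)) : Set ℝ := {x | (x, true) ∈ c}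

/-- A direct V2V link of two capable vehicles: they are within distance `d`, and no other vehicle
lies strictly between them. -/
def Linked (d : ℝ) (c : Set (ℝ × Bool)) (x y : ℝ) : Prop :=
  x ∈ capable c ∧ y ∈ capable c ∧ |x - y| ≤ d ∧ ∀ z b, (z, b) ∈ c → z ∉ Ioo (min x y) (max x y)

/-- The V2V relay cluster of the capable vehicle at `x`: all the vehicles that it can reach by a
chain of direct V2V links (including itself). -/
def cluster (d : ℝ) (c : Set (ℝ × Bool)) (x : ℝ) : Set ℝ :=
  {y | Relation.ReflTransGen (Linked d c) x y}

/-- RSUs are at the positions `k * s`, `k : ℤ`.  In the V2I network, the capable vehicle at `x`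
is connected to the RSU `k` when it is within range `d` of it. -/
def v2iReach (d s : ℝ) (c : Set (ℝ × Bool)) (x : ℝ) (k : ℤ) : Prop :=
  x ∈ capable c ∧ |x - k * s| ≤ d

/-- In the V2V+V2I network, the capable vehicle at `x` is connected to the RSU `k` when some
vehicle of its cluster is within range `d` of it. -/
def v2vReach (d s : ℝ) (c : Set (ℝ × Bool)) (x : ℝ) (k : ℤ) : Prop :=
  x ∈ capable c ∧ ∃ y ∈ cluster d c x, |y - k * s| ≤ d

/-- Number `N` of vehicles in the cluster of the capable vehicle at `x`. -/
def clusterSize (d : ℝ) (c : Set (ℝ × Bool)) (x : ℝ) : ℕ∞ := (cluster d c x).encard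

/-- Number `M` of RSUs to which the cluster of the capable vehicle at `x` is connected. -/
def clusterRSUs (d s : ℝ) (c : Set (ℝ × Bool)) (x : ℝ) : ℕ∞ := {k | v2vReach d s c x k}.encard

/-- Positions of the capable vehicles that are the first vehicle of their cluster. -/
def clusterHeads (d : ℝ) (c : Set (ℝ × Bool)) : Set ℝ :=
  {x | x ∈ capable c ∧ ∀ y ∈ cluster d c x, x ≤ y}

/-! ### Max-min fair sharing -/

/-- The rates `x` of the users `ι` are feasible when every station `k : κ` can split a capacity of
at most `ρ` among the users that are connected to it, so that user `i` receives the total `x i`. -/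
def IsFeasible {ι κ : Type*} (reach : ι → κ → Prop) (ρ : ℝ≥0) (x : ι → ℝ≥0) : Prop :=
  ∃ y : ι → κ → ℝ≥0, (∀ i k, y i k ≠ 0 → reach i k) ∧
    (∀ k, ∑' i, (y i k : ℝ≥0∞) ≤ ρ) ∧ ∀ i, ∑' k, (y i k : ℝ≥0∞) = x i

/-- A feasible allocation is max-min fair when the rate of a user can be increased only by
decreasing the rate of a user whose rate is not larger. -/
def IsMaxMinFair {ι κ : Type*} (reach : ι → κ → Prop) (ρ : ℝ≥0) (x : ι → ℝ≥0) : Prop :=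
  IsFeasible reach ρ x ∧
    ∀ z, IsFeasible reach ρ z → ∀ i, x i < z i → ∃ j, x j ≤ x i ∧ z j < x j

open Classical in
/-- The max-min fair allocation (`0` if there is none). -/
def maxMinRate {ι κ : Type*} (reach : ι → κ → Prop) (ρ : ℝ≥0) : ι → ℝ≥0 :=
  if h : ∃ x, IsMaxMinFair reach ρ x then h.choose else 0

/-! ### Typical points -/

section Typical

variable {Ω : Type*} [MeasurableSpace Ω]

/-- The probability measure that picks a scenario `ω` and a typical point `x` of the random set
`S ω`.  The vehicles are stationary and the RSUs have period `s`, so expected sums over the points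
`x ∈ S ω` of one period of the road are normalised by the expected number of these points. -/
def typical (P : Measure Ω) (s : ℝ) (S : Ω → Set ℝ) : Measure (Ω × ℝ) :=
  let C : Measure (Ω × ℝ) :=
    P.bind fun ω => Measure.sum fun x : ↥(S ω ∩ Ico 0 s) => Measure.dirac (ω, (x : ℝ))
  (C univ)⁻¹ • C

/-- Law of the scenario as seen from a typical capable vehicle. -/
def typicalVehicle (P : Measure Ω) (s : ℝ) (V : Ω → Set (ℝ × Bool)) : Measure (Ω × ℝ) :=
  typical P s fun ω => capable (V ω)

/-- Law of the scenario as seen from (the first vehicle of) a typical cluster. -/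
def typicalCluster (P : Measure Ω) (d s : ℝ) (V : Ω → Set (ℝ × Bool)) : Measure (Ω × ℝ) :=
  typical P s fun ω => clusterHeads d (V ω)

/-- `P(M > m ∣ N = n)` for a typical cluster. -/
def condTailM (P : Measure Ω) (d s : ℝ) (V : Ω → Set (ℝ × Bool)) (m n : ℕ) : ℝ :=
  (typicalCluster P d s V).real
      {p | clusterSize d (V p.1) p.2 = n ∧ (m : ℕ∞) < clusterRSUs d s (V p.1) p.2} /
    (typicalCluster P d s V).real {p | clusterSize d (V p.1) p.2 = n}

/-- Shared rate `R_v` of a vehicle in the V2V+V2I network. -/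
def rateV2V (d s : ℝ) (ρ : ℝ≥0) (V : Ω → Set (ℝ × Bool)) (p : Ω × ℝ) : ℝ :=
  maxMinRate (v2vReach d s (V p.1)) ρ p.2

/-- Shared rate `R_v*` of a vehicle in the V2I network. -/
def rateV2I (d s : ℝ) (ρ : ℝ≥0) (V : Ω → Set (ℝ × Bool)) (p : Ω × ℝ) : ℝ :=
  maxMinRate (v2iReach d s (V p.1)) ρ p.2

/-- Coverage probability `π_v` of a typical vehicle in the V2V+V2I network. -/
def coverageV2V (P : Measure Ω) (d s : ℝ) (V : Ω → Set (ℝ × Bool)) : ℝ :=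
  (typicalVehicle P s V).real {p | ∃ k, v2vReach d s (V p.1) p.2 k}

/-- Coverage probability `π_v*` of a typical vehicle in the V2I network. -/
def coverageV2I (P : Measure Ω) (d s : ℝ) (V : Ω → Set (ℝ × Bool)) : ℝ :=
  (typicalVehicle P s V).real {p | ∃ k, v2iReach d s (V p.1) p.2 k}

/-- Increasing convex order `X ≤ Y` of real random variables on a common probability space. -/
def IcxLE {Ω' : Type*} [MeasurableSpace Ω'] (μ : Measure Ω') (X Y : Ω' → ℝ) : Prop :=
  ∀ f : ℝ → ℝ, Monotone f → ConvexOn ℝ univ f →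
    Integrable (fun p => f (X p)) μ → Integrable (fun p => f (Y p)) μ →
      ∫ p, f (X p) ∂μ ≤ ∫ p, f (Y p) ∂μ

end Typical

/-- Parameter `φ` of the geometric distribution of the number of vehicles of a typical cluster. -/
def phi (lam γ d : ℝ) : ℝ := 1 - γ * (1 - Real.exp (-(lam * d)))

/-- Regularized upper incomplete gamma function `Q(a, x) = Γ(a, x) / Γ(a)`, for `a > 0`. -/
def regGammaQ (a x : ℝ) : ℝ := (∫ t in Ioi x, t ^ (a - 1) * Real.exp (-t)) / Real.Gamma a

end V2V

end

open MeasureTheory ProbabilityTheory Set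
open scoped NNReal ENNReal

noncomputable section

namespace V2V

/-! ### Max-min fair sharing in networks that split into finite blocks -/

section Network

variable {ι κ β : Type*}

/-! Write `s` for the distance between RSUs. Segments of road of length `s` are empty independently
with a fixed positive probability, so almost surely there are empty segments arbitrarily far on both
sides (`IsPoissonPP.ae_good`). Since `d < s / 2`, neither a link nor a radio range bridges an empty
segment, so both networks split into finite blocks (`IsBlockNetwork`).

On a finite block, minimise the sum of squared rates over the splits that use up every reached
station. At a minimum each station serves only the worst-off users that reach it, since otherwise a
small transfer lowers the cost. Such a balanced split is max-min fair
(`IsBlockNetwork.isMaxMinFair`), and max-min fairness determines the rates block by block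
(`IsBlockNetwork.isMaxMinFair_unique`). The rates are measurable because `IsBalanced.rate_le_iff`
describes `x i ≤ t` by the existence of a finite group of users subject to countably many
conditions.

Stationarity under shifts by `s` turns the expected sum over one period into the expected sum over
the block that starts at the origin (`IsPoissonLaw.periodSum_eq`). Comparisons of averages thus
reduce to deterministic statements about one finite block.

Part (c): a balanced split minimises every convex cost among the splits that use up the reached
stations (`IsBlockNetwork.sum_convex_le`). The V2I allocation is such a split for the V2V+V2I
network, because a station reached by a cluster is in range of one of its vehicles. For `t` and `-t`
this gives equal means, and for the truncated square ordered second moments, hence ordered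
variances.

Part (a): all vehicles of a cluster reach the same RSUs and so have the same rate, whence `N * rate
≤ ρ * M`. A rate above `r` therefore forces `M > ⌊r N / ρ⌋`. Counting the vehicles of a block
through the first vehicles of their clusters converts vehicle averages into size-biased cluster
averages. The size is geometric: by the Mecke formula (`IsPoissonLaw.mecke`) a chain of `n` further
vehicles has probability `(1 - φ) ^ n` (`measure_fwd`), and matching each vehicle with its successor
isolates the first vehicles.

Part (b): a vehicle reaches at most one RSU and shares it equally with the vehicles in its range.
The expected number of vehicles with rate above `r` is then `∑ n * P(n)` over the `n < ⌈ρ / r⌉` for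
a Poisson variable, which `n * P(n) = x * P(n - 1)` turns into `x * Q`. -/

theorem exists_balanced_fintype [Fintype ι] [Fintype κ] (reach : ι → κ → Prop) (ρ : ℝ) (hρ : 0 ≤ ρ) :
    ∃ y : ι → κ → ℝ, (∀ i k, 0 ≤ y i k) ∧ (∀ i k, y i k ≠ 0 → reach i k) ∧
      (∀ i k, reach i k → ∑ j, y j k = ρ) ∧
      ∀ i j k, y i k ≠ 0 → reach j k → ∑ l, y i l ≤ ∑ l, y j l := by
  classical
  -- The capacities of the reached stations are imposed as equalities, so that only the distribution
  -- among users is optimised; the set is compact, and sharing equally shows that it is nonempty.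
  let S : Set (ι → κ → ℝ) := {y | (∀ i k, 0 ≤ y i k ∧ y i k ≤ ρ) ∧ (∀ i k, ¬ reach i k → y i k = 0) ∧
    ∀ i k, reach i k → ∑ j, y j k = ρ}
  have hScl : IsClosed S := by
    simp only [S, ofPred_and, ofPred_forall]
    refine IsClosed.inter ?_ (IsClosed.inter ?_ ?_)
    · exact isClosed_iInter fun i => isClosed_iInter fun k =>
        (isClosed_le (by fun_prop) (by fun_prop)).inter (isClosed_le (by fun_prop) (by fun_prop))
    · exact isClosed_iInter fun i => isClosed_iInter fun k => isClosed_iInter fun _ =>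
        isClosed_eq (by fun_prop) (by fun_prop)
    · exact isClosed_iInter fun i => isClosed_iInter fun k => isClosed_iInter fun _ =>
        isClosed_eq (by fun_prop) (by fun_prop)
  have hScp : IsCompact S := by
    refine (isCompact_univ_pi (s := fun _ : ι => Set.pi univ fun _ : κ => Icc 0 ρ)
      fun _ => isCompact_univ_pi fun _ => isCompact_Icc).of_isClosed_subset hScl ?_
    intro y hy i _ k _
    exact hy.1 i k
  have hSne : S.Nonempty := by
    refine ⟨fun i k => if reach i k then ρ / (Finset.univ.filter fun j => reach j k).card else 0,
      ?_, ?_, ?_⟩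
    · intro i k
      dsimp only
      split_ifs with h
      · have hc : 1 ≤ (Finset.univ.filter fun j => reach j k).card :=
          Finset.card_pos.2 ⟨i, by simp [h]⟩
        have hc' : (1 : ℝ) ≤ (Finset.univ.filter fun j => reach j k).card := by exact_mod_cast hc
        exact ⟨by positivity, div_le_self hρ hc'⟩
      · exact ⟨le_rfl, hρ⟩
    · intro i k h
      simp [h]
    · intro i k h
      have hc : 0 < (Finset.univ.filter fun j => reach j k).card :=
        Finset.card_pos.2 ⟨i, by simp [h]⟩
      have hc' : ((Finset.univ.filter fun j => reach j k).card : ℝ) ≠ 0 := by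
        exact_mod_cast hc.ne'
      rw [← Finset.sum_filter, Finset.sum_const, nsmul_eq_mul]
      field_simp
  obtain ⟨y, hyS, hmin⟩ := hScp.exists_isMinOn hSne
    (f := fun y => ∑ i, (∑ k, y i k) ^ 2) (by fun_prop)
  obtain ⟨hy1, hy2, hy3⟩ := hyS
  refine ⟨y, fun i k => (hy1 i k).1, fun i k h => by_contra fun h' => h (hy2 i k h'), hy3, ?_⟩
  intro i j k hik hjk
  by_contra! hlt
  have hreach : reach i k := by_contra fun h' => hik (hy2 i k h')
  have hij : i ≠ j := by rintro rfl; exact lt_irrefl _ hlt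
  have hpos : 0 < y i k := lt_of_le_of_ne (hy1 i k).1 (Ne.symm hik)
  set D := ∑ l, y i l - ∑ l, y j l with hD
  have hDpos : 0 < D := sub_pos.2 hlt
  -- Moving `ε` at station `k` from `i` to the worse-off `j` changes the sum of squares by `2 ε² - 2
  -- ε D`, which is negative for `0 < ε < D`. The bound `ε ≤ y i k` keeps the split nonnegative.
  set ε := min (y i k) (D / 2) with hε
  have hεpos : 0 < ε := lt_min hpos (by linarith)
  have hε1 : ε ≤ y i k := min_le_left _ _
  have hε2 : ε < D := lt_of_le_of_lt (min_le_right _ _) (by linarith)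
  let u : ι → ℝ := fun a => (if a = j then ε else 0) - (if a = i then ε else 0)
  let y' : ι → κ → ℝ := fun a b => y a b + if b = k then u a else 0
  have hrow : ∀ a, ∑ b, y' a b = ∑ b, y a b + u a := by
    intro a; simp [y', Finset.sum_add_distrib]
  have hcol : ∀ b, ∑ a, y' a b = ∑ a, y a b := by
    intro b
    by_cases hb : b = k <;> simp [y', u, hb, Finset.sum_add_distrib]
  have hS' : y' ∈ S := by
    refine ⟨fun a b => ?_, fun a b hab => ?_, fun a b hab => ?_⟩
    · by_cases hb : b = k
      · subst hb
        have hsum := hy3 i b hreach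
        have hle : y i b + y j b ≤ ρ := by
          rw [← hsum, ← Finset.sum_pair (f := fun a => y a b) hij]
          exact Finset.sum_le_sum_of_subset_of_nonneg (Finset.subset_univ _)
            fun a _ _ => (hy1 a b).1
        have h1 := (hy1 a b)
        by_cases haj : a = j
        · subst haj
          simp [y', u, hij.symm]
          constructor <;> linarith
        · by_cases hai : a = i
          · subst hai
            simp [y', u, hij]
            constructor <;> linarith
          · simp [y', u, haj, hai, h1]
      · simpa [y', hb] using hy1 a b
    · have h0 := hy2 a b hab
      by_cases hb : b = k
      · subst hb
        have haj : a ≠ j := by rintro rfl; exact hab hjk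
        have hai : a ≠ i := by rintro rfl; exact hab hreach
        simp [y', u, haj, hai, h0]
      · simp [y', hb, h0]
    · rw [hcol]; exact hy3 a b hab
  have h := hmin hS'
  simp only [mem_ofPred_eq, hrow] at h
  have hexp : ∑ a, (∑ b, y a b + u a) ^ 2 =
      ∑ a, (∑ b, y a b) ^ 2 + 2 * ∑ a, (∑ b, y a b) * u a + ∑ a, u a * u a := by
    rw [Finset.mul_sum, ← Finset.sum_add_distrib, ← Finset.sum_add_distrib]
    exact Finset.sum_congr rfl fun a _ => by ring
  have h1 : ∑ a, (∑ b, y a b) * u a = ε * (∑ l, y j l) - ε * ∑ l, y i l := by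
    simp [u, mul_sub, Finset.sum_sub_distrib, mul_comm]
  have h2 : ∑ a, u a * u a = 2 * ε ^ 2 := by
    simp only [u, mul_sub, Finset.sum_sub_distrib, mul_ite, mul_zero, Finset.sum_ite_eq',
      Finset.mem_univ, if_true, hij, hij.symm, if_false]
    ring
  rw [hexp, h1, h2] at h
  nlinarith

/-- A split `y` of the capacities with rates `x` is balanced when every reached station is fully
used and serves only the users of lowest rate among those that reach it. -/
structure IsBalanced (reach : ι → κ → Prop) (ρ : ℝ≥0) (y : ι → κ → ℝ≥0) (x : ι → ℝ≥0) : Prop where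
  supp : ∀ i k, y i k ≠ 0 → reach i k
  full : ∀ i k, reach i k → ∑' j, (y j k : ℝ≥0∞) = ρ
  fair : ∀ i j k, y i k ≠ 0 → reach j k → x i ≤ x j
  rate : ∀ i, ∑' k, (y i k : ℝ≥0∞) = x i

/-- The network splits into finite blocks of users and stations, up to users without station. -/
structure IsBlockNetwork (reach : ι → κ → Prop) (bi : ι → β) (bk : κ → β) : Prop where
  compat : ∀ i k, reach i k → bi i = bk k
  finite_users : ∀ b, {i | bi i = b ∧ ∃ k, reach i k}.Finite
  finite_stations : ∀ b, {k | bk k = b}.Finite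

namespace IsBlockNetwork

variable {reach : ι → κ → Prop} {bi : ι → β} {bk : κ → β}

/-- No user reaches a station of another block, so balanced splits of the finite blocks can be
glued. Users without station receive nothing and may be infinitely many in a block. -/
theorem exists_balanced (h : IsBlockNetwork reach bi bk) (ρ : ℝ≥0) :
    ∃ y x, IsBalanced reach ρ y x := by
  classical
  have := fun b => (h.finite_users b).fintype
  have := fun b => (h.finite_stations b).fintype
  have key := fun b => exists_balanced_fintype
    (fun (i : {i | bi i = b ∧ ∃ k, reach i k}) (k : {k | bk k = b}) => reach i k) (ρ : ℝ) ρ.2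
  choose Y hY0 hYs hYf hYm using key
  let y : ι → κ → ℝ≥0 := fun i k =>
    if hr : reach i k then (Y (bk k) ⟨i, h.compat i k hr, k, hr⟩ ⟨k, rfl⟩).toNNReal else 0
  have hyY : ∀ b (i : {i | bi i = b ∧ ∃ k, reach i k}) (k : {k | bk k = b}),
      (y i k : ℝ≥0∞) = ENNReal.ofReal (Y b i k) := by
    rintro b ⟨i, hi⟩ ⟨k, rfl⟩
    by_cases hr : reach i k
    · simp [y, hr, ENNReal.ofReal]
    · have : Y (bk k) ⟨i, hi⟩ ⟨k, rfl⟩ = 0 := by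
        by_contra h'
        exact hr (hYs _ _ _ h')
      simp [y, hr, this]
  have hsupp : ∀ i k, y i k ≠ 0 → reach i k := by
    intro i k hik
    by_contra hr
    exact hik (by simp [y, hr])
  have hrate : ∀ b (i : {i | bi i = b ∧ ∃ k, reach i k}),
      ∑' k, (y i k : ℝ≥0∞) = ENNReal.ofReal (∑ k, Y b i k) := by
    intro b i
    rw [← tsum_subtype_eq_of_support_subset (s := {k | bk k = b}), tsum_fintype,
      ENNReal.ofReal_sum_of_nonneg fun k _ => hY0 _ _ _]
    · exact Finset.sum_congr rfl fun k _ => hyY b i k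
    · intro k hk
      have := hsupp i k (by simpa using hk)
      rw [mem_ofPred_eq, ← h.compat _ _ this]
      exact i.2.1
  have hfin : ∀ i, ∑' k, (y i k : ℝ≥0∞) ≠ ∞ := by
    intro i
    by_cases hi : ∃ k, reach i k
    · rw [hrate (bi i) ⟨i, rfl, hi⟩]
      exact ENNReal.ofReal_ne_top
    · have : ∀ k, y i k = 0 := fun k => by_contra fun hk => hi ⟨k, hsupp i k hk⟩
      simp [this]
  refine ⟨y, fun i => (∑' k, (y i k : ℝ≥0∞)).toNNReal, hsupp, ?_, ?_, ?_⟩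
  · intro i k hr
    have hsub : (Function.support fun j => (y j k : ℝ≥0∞)) ⊆ {i | bi i = bk k ∧ ∃ k, reach i k} := by
      intro j hj
      have := hsupp j k (by simpa using hj)
      exact ⟨h.compat _ _ this, k, this⟩
    rw [← tsum_subtype_eq_of_support_subset hsub, tsum_fintype]
    have := hYf (bk k) ⟨i, h.compat i k hr, k, hr⟩ ⟨k, rfl⟩ hr
    rw [← ENNReal.ofReal_coe_nnreal, ← this, ENNReal.ofReal_sum_of_nonneg fun k _ => hY0 _ _ _]
    exact Finset.sum_congr rfl fun j _ => hyY (bk k) j ⟨k, rfl⟩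
  · intro i j k hik hjk
    have hik' := hsupp i k hik
    have hne : Y (bk k) ⟨i, h.compat i k hik', k, hik'⟩ ⟨k, rfl⟩ ≠ 0 := by
      intro h0
      apply hik
      simp [y, hik', h0]
    have := hYm (bk k) ⟨i, h.compat i k hik', k, hik'⟩ ⟨j, h.compat j k hjk, k, hjk⟩ ⟨k, rfl⟩ hne hjk
    have e1 := hrate (bk k) ⟨i, h.compat i k hik', k, hik'⟩
    have e2 := hrate (bk k) ⟨j, h.compat j k hjk, k, hjk⟩
    dsimp only at e1 e2 ⊢
    rw [e1, e2]
    exact ENNReal.toNNReal_mono ENNReal.ofReal_ne_top (ENNReal.ofReal_le_ofReal this)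
  · intro i
    exact (ENNReal.coe_toNNReal (hfin i)).symm

end IsBlockNetwork

end Network

/-! ### Properties of balanced splits; existence and uniqueness of max-min fair rates -/

section Network

variable {ι κ β : Type*}

namespace IsBalanced

variable {reach : ι → κ → Prop} {ρ : ℝ≥0} {y : ι → κ → ℝ≥0} {x : ι → ℝ≥0}

theorem isFeasible (hb : IsBalanced reach ρ y x) : IsFeasible reach ρ x := by
  refine ⟨y, hb.supp, fun k => ?_, hb.rate⟩
  by_cases h : ∃ i, reach i k
  · obtain ⟨i, hi⟩ := h
    exact (hb.full i k hi).le
  · have : ∀ i, y i k = 0 := fun i => by_contra fun hi => h ⟨i, hb.supp i k hi⟩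
    simp [this]

/-- The users that share a station with user `j` but are not better off use it up. -/
theorem sum_eq_of_mem (hb : IsBalanced reach ρ y x) {j : ι} {k : κ} (hj : reach j k) (L : Finset ι)
    (hL : ∀ a, reach a k → x a ≤ x j → a ∈ L) : ∑ a ∈ L, (y a k : ℝ≥0∞) = ρ := by
  rw [← hb.full j k hj, tsum_eq_sum]
  intro a ha
  by_contra h
  have h' : y a k ≠ 0 := by simpa using h
  exact ha (hL a (hb.supp a k h') (hb.fair a j k h' hj))

theorem rate_eq_zero (hb : IsBalanced reach ρ y x) {i : ι} (hi : ∀ k, ¬ reach i k) : x i = 0 := by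
  have : ∀ k, y i k = 0 := fun k => by_contra fun h => hi k (hb.supp i k h)
  have h := hb.rate i
  simpa [this] using h.symm

theorem exists_of_rate_ne_zero (hb : IsBalanced reach ρ y x) {i : ι} (hi : x i ≠ 0) :
    ∃ k, y i k ≠ 0 := by
  by_contra! h
  have h' := hb.rate i
  simp [h] at h'
  exact hi h'.symm

/-- A station that serves one of the two users is reached by the other, so fairness gives both
inequalities. Applied to the vehicles of one cluster and to the vehicles in range of one RSU. -/
theorem rate_eq_of_reach (hb : IsBalanced reach ρ y x) {i j : ι}
    (h : ∀ k, reach i k ↔ reach j k) : x i = x j := by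
  have key : ∀ i j : ι, (∀ k, reach i k ↔ reach j k) → x i ≤ x j := by
    intro i j h
    by_cases hi : x i = 0
    · simp [hi]
    · obtain ⟨k, hk⟩ := hb.exists_of_rate_ne_zero hi
      exact hb.fair i j k hk ((h k).1 (hb.supp i k hk))
  exact le_antisymm (key i j h) (key j i fun k => (h k).symm)

/-- The users reaching a station of positive capacity have a positive rate. -/
theorem rate_pos (hb : IsBalanced reach ρ y x) (hρ : 0 < ρ) {i : ι} {k : κ} (hi : reach i k) :
    0 < x i := by
  have h : ∃ j, y j k ≠ 0 := by
    by_contra! h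
    have h' := hb.full i k hi
    simp [h] at h'
    exact hρ.ne h'
  obtain ⟨j, hj⟩ := h
  refine lt_of_lt_of_le ?_ (hb.fair j i k hj hi)
  have h1 : (y j k : ℝ≥0∞) ≤ x j := by
    rw [← hb.rate j]; exact ENNReal.le_tsum k
  exact lt_of_lt_of_le (pos_iff_ne_zero.2 hj) (by exact_mod_cast h1)

/-- The total rate of finitely many users is bounded by the capacity of the stations they reach. -/
theorem sum_rate_le (hb : IsBalanced reach ρ y x) (A : Finset ι) (K : Set κ)
    (hK : ∀ i ∈ A, ∀ k, reach i k → k ∈ K) : ∑ i ∈ A, (x i : ℝ≥0∞) ≤ ρ * (K.encard : ℝ≥0∞) := by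
  classical
  have h1 : ∑ i ∈ A, (x i : ℝ≥0∞) = ∑' k, ∑ i ∈ A, (y i k : ℝ≥0∞) := by
    rw [Summable.tsum_finsetSum fun _ _ => ENNReal.summable]
    exact Finset.sum_congr rfl fun i _ => (hb.rate i).symm
  have h2 : ∀ k, ∑ i ∈ A, (y i k : ℝ≥0∞) ≤ K.indicator (fun _ => (ρ : ℝ≥0∞)) k := by
    intro k
    by_cases hk : k ∈ K
    · rw [indicator_of_mem hk]
      obtain ⟨_, hcap, _⟩ := hb.isFeasible
      by_cases hr : ∃ i, reach i k
      · obtain ⟨i, hi⟩ := hr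
        rw [← hb.full i k hi]
        exact ENNReal.sum_le_tsum A
      · have : ∀ i, y i k = 0 := fun i => by_contra fun hi => hr ⟨i, hb.supp i k hi⟩
        simp [this]
    · rw [indicator_of_notMem hk]
      refine le_of_eq (Finset.sum_eq_zero fun i hi => ?_)
      have : y i k = 0 := by_contra fun h => hk (hK i hi k (hb.supp i k h))
      simp [this]
  rw [h1]
  refine (ENNReal.tsum_le_tsum h2).trans (le_of_eq ?_)
  rw [← tsum_subtype, ENNReal.tsum_const, mul_comm]
  rfl

/-- A user's rate is at most `t` iff it belongs to a finite group of users whose average rate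
is forced to be at most `t`, even after any part of the group has been removed. -/
theorem rate_le_iff (hb : IsBalanced reach ρ y x) {i : ι}
    {U : Set ι} (hU : U.Finite) (hUi : i ∈ U)
    (hUc : ∀ a ∈ U, ∀ k, reach a k → ∀ b, reach b k → b ∈ U) {W : Set ι} (hW : U ⊆ W) (t : ℝ≥0) :
    x i ≤ t ↔ ∃ A : Finset ι, (A : Set ι) ⊆ W ∧ i ∈ A ∧ ∀ B ⊆ A,
      (ρ : ℝ≥0∞) * ({k | (∃ a ∈ A, reach a k) ∧ ∀ b ∈ B, ¬ reach b k}.encard : ℝ≥0∞) ≤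
        t * ((A.card - B.card : ℕ) : ℝ≥0∞) := by
  classical
  constructor
  · intro hi
    -- Take for `A` all members of `U` with rate at most `t`. A station reached by `A` but not by
    -- `B` spends its capacity on users no better off than its user in `A`; these lie in `U`, hence
    -- in `A \ B`. Their total rate is at most `t` times their number.
    let A := hU.toFinset.filter fun a => x a ≤ t
    refine ⟨A, fun a ha => by simp [A] at ha; exact hW ha.1, by simp [A, hUi, hi], fun B hB => ?_⟩
    set K := {k | (∃ a ∈ A, reach a k) ∧ ∀ b ∈ B, ¬ reach b k} with hK
    have hcap : ∀ k ∈ K, (ρ : ℝ≥0∞) = ∑ a ∈ A \ B, (y a k : ℝ≥0∞) := by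
      rintro k ⟨⟨a, haA, hak⟩, hBk⟩
      refine (hb.sum_eq_of_mem hak (A \ B) fun b hbk hle => ?_).symm
      have ha : a ∈ U ∧ x a ≤ t := by simpa [A] using haA
      rw [Finset.mem_sdiff]
      refine ⟨?_, fun hb' => hBk b hb' hbk⟩
      simp only [A, Finset.mem_filter, Finite.mem_toFinset]
      exact ⟨hUc a ha.1 k hak b hbk, hle.trans ha.2⟩
    calc (ρ : ℝ≥0∞) * (K.encard : ℝ≥0∞) = ∑' k : K, (ρ : ℝ≥0∞) := by
          rw [ENNReal.tsum_const, mul_comm]; rfl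
      _ = ∑' k : K, ∑ a ∈ A \ B, (y a k : ℝ≥0∞) := tsum_congr fun k => hcap k k.2
      _ ≤ ∑' k, ∑ a ∈ A \ B, (y a k : ℝ≥0∞) :=
          ENNReal.tsum_comp_le_tsum_of_injective Subtype.val_injective _
      _ = ∑ a ∈ A \ B, (x a : ℝ≥0∞) := by
          rw [Summable.tsum_finsetSum fun _ _ => ENNReal.summable]
          exact Finset.sum_congr rfl fun i _ => hb.rate i
      _ ≤ ∑ a ∈ A \ B, (t : ℝ≥0∞) := by
          refine Finset.sum_le_sum fun a ha => ?_
          have : x a ≤ t := by simp [A] at ha; exact ha.1.2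
          exact_mod_cast this
      _ = t * ((A.card - B.card : ℕ) : ℝ≥0∞) := by
          rw [Finset.sum_const, nsmul_eq_mul, Finset.card_sdiff_of_subset hB, mul_comm]
  · rintro ⟨A, -, hiA, hA⟩
    by_contra! hlt
    -- Conversely, remove from `A` the members with rate at most `t`. If `i` remains, the rest have
    -- a total above `t` times their number, yet they are served only by stations that no member of
    -- `B` reaches, contradicting the bound for this `B`.
    let B := A.filter fun a => x a ≤ t
    have hBA : B ⊆ A := Finset.filter_subset _ _
    have h := hA B hBA
    have hdiff : ∀ a ∈ A \ B, t < x a := by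
      intro a ha
      simp only [B, Finset.mem_sdiff, Finset.mem_filter, not_and, not_le] at ha
      exact ha.2 ha.1
    have h1 : ∑ a ∈ A \ B, (x a : ℝ≥0∞) ≤
        ρ * ({k | (∃ a ∈ A, reach a k) ∧ ∀ b ∈ B, ¬ reach b k}.encard : ℝ≥0∞) := by
      have h1' : ∑ i ∈ A \ B, (x i : ℝ≥0∞) = ∑' k, ∑ i ∈ A \ B, (y i k : ℝ≥0∞) := by
        rw [Summable.tsum_finsetSum fun _ _ => ENNReal.summable]
        exact Finset.sum_congr rfl fun i _ => (hb.rate i).symm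
      set K := {k | (∃ a ∈ A, reach a k) ∧ ∀ b ∈ B, ¬ reach b k} with hK
      have h2 : ∀ k, ∑ i ∈ A \ B, (y i k : ℝ≥0∞) ≤ K.indicator (fun _ => (ρ : ℝ≥0∞)) k := by
        intro k
        by_cases hk : k ∈ K
        · rw [indicator_of_mem hk]
          obtain ⟨⟨a, haA, hak⟩, _⟩ := hk
          rw [← hb.full a k hak]
          exact ENNReal.sum_le_tsum _
        · rw [indicator_of_notMem hk]
          refine le_of_eq (Finset.sum_eq_zero fun a ha => ?_)
          by_contra hne
          have hne' : y a k ≠ 0 := by simpa using hne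
          refine hk ⟨⟨a, (Finset.mem_sdiff.1 ha).1, hb.supp a k hne'⟩, fun b hbB hbk => ?_⟩
          have hbt : x b ≤ t := (Finset.mem_filter.1 hbB).2
          exact absurd ((hb.fair a b k hne' hbk).trans hbt) (not_le.2 (hdiff a ha))
      rw [h1']
      refine (ENNReal.tsum_le_tsum h2).trans (le_of_eq ?_)
      rw [← tsum_subtype, ENNReal.tsum_const, mul_comm]
      rfl
    have h2 : (∑ a ∈ A \ B, t : ℝ≥0) < ∑ a ∈ A \ B, x a := by
      refine Finset.sum_lt_sum_of_nonempty ⟨i, ?_⟩ hdiff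
      simp [B, hiA, hlt]
    have h3 : ((∑ a ∈ A \ B, x a : ℝ≥0) : ℝ≥0∞) ≤ ((∑ a ∈ A \ B, t : ℝ≥0) : ℝ≥0∞) := by
      push_cast
      refine (h1.trans h).trans (le_of_eq ?_)
      rw [Finset.sum_const, nsmul_eq_mul, Finset.card_sdiff_of_subset hBA, mul_comm]
    exact absurd h2 (not_lt.2 (by exact_mod_cast h3))

end IsBalanced

namespace IsBlockNetwork

variable {reach : ι → κ → Prop} {bi : ι → β} {bk : κ → β}

/-- Let `L` be the users of the block of `i` with rate at most `x i`. Every station reached by `L`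
already spends its whole capacity on `L`, so no feasible allocation gives `L` a larger total. Hence
raising `i` must lower some member of `L`. -/
theorem isMaxMinFair (h : IsBlockNetwork reach bi bk) {ρ : ℝ≥0} {y : ι → κ → ℝ≥0} {x : ι → ℝ≥0}
    (hb : IsBalanced reach ρ y x) : IsMaxMinFair reach ρ x := by
  classical
  refine ⟨hb.isFeasible, ?_⟩
  rintro z ⟨w, hws, hwc, hwr⟩ i hlt
  by_contra! H
  have hLfin : {j | bi j = bi i ∧ (∃ k, reach j k) ∧ x j ≤ x i}.Finite :=
    (h.finite_users (bi i)).subset fun j hj => ⟨hj.1, hj.2.1⟩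
  set L := hLfin.toFinset with hL
  have hmem : ∀ j, j ∈ L ↔ bi j = bi i ∧ (∃ k, reach j k) ∧ x j ≤ x i := by simp [L]
  have hi : ∃ k, reach i k := by
    by_contra! hno
    have h0 : ∀ k, w i k = 0 := fun k => by_contra fun hk => hno k (hws i k hk)
    have := hwr i
    simp only [h0, ENNReal.coe_zero, tsum_zero] at this
    have hz : z i = 0 := by exact_mod_cast this.symm
    simp [hz] at hlt
  have hiL : i ∈ L := (hmem i).2 ⟨rfl, hi, le_rfl⟩
  have h1 : (∑ j ∈ L, x j : ℝ≥0) < ∑ j ∈ L, z j :=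
    Finset.sum_lt_sum (fun j hj => H j ((hmem j).1 hj).2.2) ⟨i, hiL, hlt⟩
  have h2 : ∑ j ∈ L, (z j : ℝ≥0∞) ≤ ∑ j ∈ L, (x j : ℝ≥0∞) := by
    calc ∑ j ∈ L, (z j : ℝ≥0∞) = ∑' k, ∑ j ∈ L, (w j k : ℝ≥0∞) := by
          rw [Summable.tsum_finsetSum fun _ _ => ENNReal.summable]
          exact Finset.sum_congr rfl fun i _ => (hwr i).symm
      _ ≤ ∑' k, ∑ j ∈ L, (y j k : ℝ≥0∞) := by
          refine ENNReal.tsum_le_tsum fun k => ?_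
          by_cases hk : ∃ j ∈ L, reach j k
          · obtain ⟨j, hj, hjk⟩ := hk
            have hj' := (hmem j).1 hj
            rw [hb.sum_eq_of_mem hjk L fun a ha hle => (hmem a).2
              ⟨(h.compat a k ha).trans ((h.compat j k hjk).symm.trans hj'.1), ⟨k, ha⟩,
                hle.trans hj'.2.2⟩]
            exact (ENNReal.sum_le_tsum L).trans (hwc k)
          · push Not at hk
            refine le_of_eq_of_le (Finset.sum_eq_zero fun j hj => ?_) zero_le
            have : w j k = 0 := by_contra fun hne => hk j hj (hws j k hne)
            simp [this]
      _ = ∑ j ∈ L, (x j : ℝ≥0∞) := by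
          rw [Summable.tsum_finsetSum fun _ _ => ENNReal.summable]
          exact Finset.sum_congr rfl fun i _ => hb.rate i
  exact absurd h1 (not_lt.2 (by exact_mod_cast h2))

-- Makes fairness a property of a single block: the competitor may be changed on one block and kept
-- elsewhere, so the user that is harmed lies in that block.
open Classical in
theorem isFeasible_piecewise (h : IsBlockNetwork reach bi bk) {ρ : ℝ≥0} {x x' : ι → ℝ≥0}
    (hx : IsFeasible reach ρ x) (hx' : IsFeasible reach ρ x') (b : β) :
    IsFeasible reach ρ fun i => if bi i = b then x' i else x i := by
  obtain ⟨y, hys, hyc, hyr⟩ := hx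
  obtain ⟨y', hys', hyc', hyr'⟩ := hx'
  refine ⟨fun i k => if bi i = b then y' i k else y i k, fun i k hne => ?_, fun k => ?_,
    fun i => ?_⟩
  · dsimp only at hne
    split_ifs at hne
    · exact hys' i k hne
    · exact hys i k hne
  · by_cases hk : bk k = b
    · refine (ENNReal.tsum_le_tsum fun i => ?_).trans (hyc' k)
      dsimp only
      split_ifs with hi
      · exact le_rfl
      · have : y i k = 0 := by_contra fun hne => hi ((h.compat i k (hys i k hne)).trans hk)
        simp [this]
    · refine (ENNReal.tsum_le_tsum fun i => ?_).trans (hyc k)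
      dsimp only
      split_ifs with hi
      · have : y' i k = 0 := by_contra fun hne => hk ((h.compat i k (hys' i k hne)).symm.trans hi)
        simp [this]
      · exact le_rfl
  · dsimp only
    split_ifs
    · exact hyr' i
    · exact hyr i

theorem isMaxMinFair_unique (h : IsBlockNetwork reach bi bk) {ρ : ℝ≥0} {x x' : ι → ℝ≥0}
    (hx : IsMaxMinFair reach ρ x) (hx' : IsMaxMinFair reach ρ x') : x = x' := by
  classical
  by_contra hne
  obtain ⟨i₀, hi₀⟩ := Function.ne_iff.1 hne
  have hunr : ∀ {x : ι → ℝ≥0}, IsFeasible reach ρ x → ∀ i, (∀ k, ¬ reach i k) → x i = 0 := by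
    rintro x ⟨y, hys, _, hyr⟩ i hi
    have h0 : ∀ k, y i k = 0 := fun k => by_contra fun hk => hi k (hys i k hk)
    have := hyr i
    simp only [h0, ENNReal.coe_zero, tsum_zero] at this
    exact_mod_cast this.symm
  have hfin : {i | bi i = bi i₀ ∧ x i ≠ x' i}.Finite := by
    refine (h.finite_users (bi i₀)).subset fun i hi => ⟨hi.1, ?_⟩
    by_contra! hno
    exact hi.2 (by rw [hunr hx.1 i hno, hunr hx'.1 i hno])
  -- Among the finitely many users of the block where the two allocations differ, choose one with
  -- the smallest `min (x i) (x' i)`. Fairness of the allocation that gives `i` less yields another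
  -- disagreement in the block with a strictly smaller minimum.
  obtain ⟨i, hi, hmin⟩ := hfin.exists_minimalFor (fun i => min (x i) (x' i)) _ ⟨i₀, rfl, hi₀⟩
  have key : ∀ {u v : ι → ℝ≥0}, IsMaxMinFair reach ρ u → IsMaxMinFair reach ρ v → u i < v i →
      ∃ j, bi j = bi i ∧ u j ≤ u i ∧ v j < u j := by
    intro u v hu hv hlt
    obtain ⟨j, hj1, hj2⟩ := hu.2 _ (h.isFeasible_piecewise hu.1 hv.1 (bi i)) i (by simpa using hlt)
    by_cases hji : bi j = bi i
    · exact ⟨j, hji, hj1, by simpa [hji] using hj2⟩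
    · simp [hji] at hj2
  rcases lt_or_gt_of_ne hi.2 with hlt | hlt
  · obtain ⟨j, hj1, hj2, hj3⟩ := key hx hx' hlt
    have := hmin (j := j) ⟨hj1.trans hi.1, hj3.ne'⟩
      (by dsimp only; rw [min_eq_right hj3.le, min_eq_left hlt.le]; exact hj3.le.trans hj2)
    dsimp only at this
    rw [min_eq_right hj3.le, min_eq_left hlt.le] at this
    exact absurd (lt_of_lt_of_le hj3 hj2) (not_lt.2 this)
  · obtain ⟨j, hj1, hj2, hj3⟩ := key hx' hx hlt
    have := hmin (j := j) ⟨hj1.trans hi.1, hj3.ne⟩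
      (by dsimp only; rw [min_eq_left hj3.le, min_eq_right hlt.le]; exact hj3.le.trans hj2)
    dsimp only at this
    rw [min_eq_left hj3.le, min_eq_right hlt.le] at this
    exact absurd (lt_of_lt_of_le hj3 hj2) (not_lt.2 this)

theorem existsUnique_isMaxMinFair (h : IsBlockNetwork reach bi bk) (ρ : ℝ≥0) :
    ∃! x, IsMaxMinFair reach ρ x := by
  obtain ⟨y, x, hb⟩ := h.exists_balanced ρ
  exact ⟨x, h.isMaxMinFair hb, fun x' hx' => h.isMaxMinFair_unique hx' (h.isMaxMinFair hb)⟩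

theorem exists_balanced_maxMinRate (h : IsBlockNetwork reach bi bk) (ρ : ℝ≥0) :
    ∃ y, IsBalanced reach ρ y (maxMinRate reach ρ) := by
  obtain ⟨y, x, hb⟩ := h.exists_balanced ρ
  have hex : ∃ x, IsMaxMinFair reach ρ x := ⟨x, h.isMaxMinFair hb⟩
  have : maxMinRate reach ρ = x := by
    rw [maxMinRate, dif_pos hex]
    exact h.isMaxMinFair_unique hex.choose_spec (h.isMaxMinFair hb)
  exact ⟨y, this ▸ hb⟩

end IsBlockNetwork

/-! ### Convex costs of balanced splits -/

/-- The right derivative is a subgradient at every point of the line. Its monotonicity makes the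
users of lowest rate those of lowest marginal cost. -/
theorem _root_.ConvexOn.exists_monotone_subgradient {f : ℝ → ℝ} (hf : ConvexOn ℝ univ f) :
    ∃ h : ℝ → ℝ, Monotone h ∧ ∀ a b, f a + h a * (b - a) ≤ f b := by
  refine ⟨fun x => derivWithin f (Ioi x) x, ?_, ?_⟩
  · have := hf.monotoneOn_rightDeriv
    rw [interior_univ] at this
    exact monotoneOn_univ.1 this
  · intro a b
    have ha : a ∈ interior (univ : Set ℝ) := by simp
    rcases lt_trichotomy a b with hab | rfl | hab
    · have h := hf.rightDeriv_le_slope_of_mem_interior ha (mem_univ b) hab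
      rw [slope_def_field, le_div_iff₀ (sub_pos.2 hab)] at h
      linarith
    · simp
    · have h := (hf.slope_le_leftDeriv_of_mem_interior (mem_univ b) ha hab).trans
        (hf.leftDeriv_le_rightDeriv_of_mem_interior ha)
      rw [slope_def_field, div_le_iff₀ (sub_pos.2 hab)] at h
      linarith

/-- Among all allocations that use up the reached stations, the balanced one has the smallest
total convex cost on each block. -/
theorem IsBlockNetwork.sum_convex_le {reach : ι → κ → Prop} {bi : ι → β} {bk : κ → β}
    (h : IsBlockNetwork reach bi bk) {ρ : ℝ≥0} {y y' : ι → κ → ℝ≥0} {x x' : ι → ℝ≥0}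
    (hb : IsBalanced reach ρ y x) (hsupp : ∀ i k, y' i k ≠ 0 → reach i k)
    (hfull : ∀ i k, reach i k → ∑' j, (y' j k : ℝ≥0∞) = ρ)
    (hrate : ∀ i, ∑' k, (y' i k : ℝ≥0∞) = x' i) {f : ℝ → ℝ} (hf : ConvexOn ℝ univ f) (b : β)
    (I : Finset ι) (hI : ∀ i ∈ I, bi i = b) (hI' : ∀ i, bi i = b → (∃ k, reach i k) → i ∈ I) :
    ∑ i ∈ I, f (x i) ≤ ∑ i ∈ I, f (x' i) := by
  classical
  obtain ⟨g, hg, hfg⟩ := hf.exists_monotone_subgradient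
  set K := (h.finite_stations b).toFinset with hK
  have row : ∀ {y : ι → κ → ℝ≥0} {x : ι → ℝ≥0}, (∀ i k, y i k ≠ 0 → reach i k) →
      (∀ i, ∑' k, (y i k : ℝ≥0∞) = x i) → ∀ i ∈ I, (x i : ℝ) = ∑ k ∈ K, (y i k : ℝ) := by
    intro y x hs hr i hi
    have e := hr i
    rw [tsum_eq_sum (s := K)] at e
    · exact_mod_cast e.symm
    · intro k hk
      by_contra hne
      refine hk ?_
      rw [hK, Finite.mem_toFinset]
      exact (h.compat i k (hs i k (by simpa using hne))).symm.trans (hI i hi)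
  have col : ∀ {y : ι → κ → ℝ≥0}, (∀ i k, y i k ≠ 0 → reach i k) →
      (∀ i k, reach i k → ∑' j, (y j k : ℝ≥0∞) = ρ) → ∀ k ∈ K, (∃ i, reach i k) →
      ∑ i ∈ I, (y i k : ℝ) = ρ := by
    rintro y hs hc k hk ⟨i, hi⟩
    have e := hc i k hi
    rw [tsum_eq_sum (s := I)] at e
    · exact_mod_cast e
    · intro a ha
      by_contra hne
      have har := hs a k (by simpa using hne)
      refine ha (hI' a ?_ ⟨k, har⟩)
      rw [hK, Finite.mem_toFinset] at hk
      exact (h.compat a k har).trans hk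
  -- A balanced split spends the capacity of `k` on the users of lowest rate, where the marginal
  -- cost `g (x i)` is smallest. Any other split of the same capacity has at least this weighted
  -- total; summing over stations and using the tangent inequality for `f` finishes the comparison.
  have hstation : ∀ k ∈ K, ∑ i ∈ I, g (x i) * (y i k : ℝ) ≤ ∑ i ∈ I, g (x i) * (y' i k : ℝ) := by
    intro k hk
    by_cases hr : ∃ i, reach i k
    · have c := col hb.supp hb.full k hk hr
      have c' := col hsupp hfull k hk hr
      by_cases hz : ∃ j ∈ I, y j k ≠ 0
      · obtain ⟨j, hj, hjk⟩ := hz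
        calc ∑ i ∈ I, g (x i) * (y i k : ℝ) = ∑ i ∈ I, g (x j) * (y i k : ℝ) := by
              refine Finset.sum_congr rfl fun i _ => ?_
              by_cases hi : y i k = 0
              · simp [hi]
              · rw [le_antisymm (hb.fair i j k hi (hb.supp j k hjk))
                  (hb.fair j i k hjk (hb.supp i k hi))]
          _ = ∑ i ∈ I, g (x j) * (y' i k : ℝ) := by
              rw [← Finset.mul_sum, ← Finset.mul_sum, c, c']
          _ ≤ ∑ i ∈ I, g (x i) * (y' i k : ℝ) := by
              refine Finset.sum_le_sum fun i _ => ?_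
              by_cases hi : y' i k = 0
              · simp [hi]
              · refine mul_le_mul_of_nonneg_right (hg ?_) (NNReal.coe_nonneg _)
                exact_mod_cast hb.fair j i k hjk (hsupp i k hi)
      · push Not at hz
        have hρ : (ρ : ℝ) = 0 := by
          rw [← c]; exact Finset.sum_eq_zero fun i hi => by simp [hz i hi]
        rw [hρ, Finset.sum_eq_zero_iff_of_nonneg fun _ _ => NNReal.coe_nonneg _] at c c'
        exact Finset.sum_le_sum fun i hi => by rw [c i hi, c' i hi]
    · have h1 : ∀ i, y i k = 0 := fun i => by_contra fun hne => hr ⟨i, hb.supp i k hne⟩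
      have h2 : ∀ i, y' i k = 0 := fun i => by_contra fun hne => hr ⟨i, hsupp i k hne⟩
      simp [h1, h2]
  have hsum : ∑ i ∈ I, g (x i) * (x i : ℝ) ≤ ∑ i ∈ I, g (x i) * (x' i : ℝ) := by
    have e : ∀ {y : ι → κ → ℝ≥0} {z : ι → ℝ≥0}, (∀ i ∈ I, (z i : ℝ) = ∑ k ∈ K, (y i k : ℝ)) →
        ∑ i ∈ I, g (x i) * (z i : ℝ) = ∑ k ∈ K, ∑ i ∈ I, g (x i) * (y i k : ℝ) := by
      intro y z hz
      rw [Finset.sum_comm]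
      exact Finset.sum_congr rfl fun i hi => by rw [hz i hi, Finset.mul_sum]
    rw [e (row hb.supp hb.rate), e (row hsupp hrate)]
    exact Finset.sum_le_sum hstation
  have := Finset.sum_le_sum fun i (_ : i ∈ I) => hfg (x i) (x' i)
  simp only [mul_sub, Finset.sum_add_distrib, Finset.sum_sub_distrib] at this
  linarith

end Network

/-! ### The measurable space of locally finite configurations with empty road segments -/

/-- The `k`-th road segment between two RSUs. -/
def cell (s : ℝ) (k : ℤ) : Set ℝ := Ico (k * s) ((k + 1) * s)

/-- Vehicles whose position is in the `k`-th segment. -/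
def cellE (s : ℝ) (k : ℤ) : Set (ℝ × Bool) := Prod.fst ⁻¹' cell s k

/-- The configuration has no vehicle in the `k`-th segment. -/
def EmptyCell (s : ℝ) (c : Set (ℝ × Bool)) (k : ℤ) : Prop := c ∩ cellE s k = ∅

/-- Every segment has finitely many vehicles, and there are empty segments arbitrarily far on both
sides. -/
structure Good (s : ℝ) (c : Set (ℝ × Bool)) : Prop where
  finite : ∀ k, (c ∩ cellE s k).Finite
  right : ∀ k : ℤ, ∃ j, k ≤ j ∧ EmptyCell s c j
  left : ∀ k : ℤ, ∃ j, j ≤ k ∧ EmptyCell s c j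

theorem Good.mono {s : ℝ} {c c' : Set (ℝ × Bool)} (h : Good s c) (hc : c' ⊆ c) : Good s c' where
  finite k := (h.finite k).subset (inter_subset_inter_left _ hc)
  right k := (h.right k).imp fun _ (hj : _ ∧ _) =>
    ⟨hj.1, subset_empty_iff.1 ((inter_subset_inter_left _ hc).trans_eq hj.2)⟩
  left k := (h.left k).imp fun _ (hj : _ ∧ _) =>
    ⟨hj.1, subset_empty_iff.1 ((inter_subset_inter_left _ hc).trans_eq hj.2)⟩

theorem good_empty (s : ℝ) : Good s ∅ where
  finite k := by simp
  right k := ⟨k, le_rfl, by simp [EmptyCell]⟩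
  left k := ⟨k, le_rfl, by simp [EmptyCell]⟩

/-- A set of marked positions inside two consecutive road segments. -/
def Local (s : ℝ) (B : Set (ℝ × Bool)) : Prop := ∃ k, B ⊆ cellE s k ∪ cellE s (k + 1)

theorem Local.mono {s : ℝ} {B B' : Set (ℝ × Bool)} (h : Local s B) (hB : B' ⊆ B) : Local s B' :=
  h.imp fun _ hk => hB.trans hk

theorem local_of_subset_cellE {s : ℝ} {B : Set (ℝ × Bool)} {k : ℤ} (h : B ⊆ cellE s k) :
    Local s B := ⟨k, h.trans subset_union_left⟩

theorem Good.finite_inter {s : ℝ} {c B : Set (ℝ × Bool)} (h : Good s c) (hB : Local s B) :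
    (c ∩ B).Finite := by
  obtain ⟨k, hk⟩ := hB
  refine ((h.finite k).union (h.finite (k + 1))).subset ?_
  rw [← inter_union_distrib_left]
  exact inter_subset_inter_right _ hk

/-- Configurations with the properties of `Good`. -/
structure Conf (s : ℝ) where
  val : Set (ℝ × Bool)
  property : Good s val

/-- Measurable sets of marked positions inside two consecutive road segments. -/
def LocalSet (s : ℝ) : Type := {B : Set (ℝ × Bool) // MeasurableSet B ∧ Local s B}

namespace Conf

variable {s : ℝ}

/-- The number of vehicles in `B`. -/
def num (B : Set (ℝ × Bool)) (c : Conf s) : ℕ := (c.1 ∩ B).ncard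

/-- Only counts in local sets generate the σ-algebra, so all counts are finite. Two consecutive
segments are allowed in order to include the range of an RSU and the gap between linked vehicles,
both of which may straddle a segment boundary. -/
instance : MeasurableSpace (Conf s) :=
  ⨆ B : LocalSet s, MeasurableSpace.comap (num B.1) ⊤

theorem measurable_num {B : Set (ℝ × Bool)} (hB : MeasurableSet B) (hl : Local s B) :
    Measurable (num B : Conf s → ℕ) := by
  have : MeasurableSpace.comap (num B : Conf s → ℕ) ⊤ ≤
      ⨆ B : LocalSet s, MeasurableSpace.comap (num B.1) ⊤ :=
    le_iSup (fun B : LocalSet s => MeasurableSpace.comap (num B.1 : Conf s → ℕ) ⊤) ⟨B, hB, hl⟩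
  exact fun t _ => this _ ⟨t, trivial, rfl⟩

theorem measurable_iff {T : Type*} [MeasurableSpace T] {f : T → Conf s} :
    Measurable f ↔ ∀ B, MeasurableSet B → Local s B → Measurable fun t => num B (f t) := by
  refine ⟨fun h B hB hl => (measurable_num hB hl).comp h, fun h => ?_⟩
  rw [measurable_iff_comap_le]
  change MeasurableSpace.comap f
    (⨆ B : LocalSet s, MeasurableSpace.comap (num B.1 : Conf s → ℕ) ⊤) ≤ _
  rw [MeasurableSpace.comap_iSup]
  refine iSup_le fun B => ?_
  rw [MeasurableSpace.comap_comp, ← measurable_iff_comap_le]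
  exact h B.1 B.2.1 B.2.2

end Conf

theorem measurableSet_cell (s : ℝ) (k : ℤ) : MeasurableSet (cell s k) := measurableSet_Ico

theorem measurableSet_cellE (s : ℝ) (k : ℤ) : MeasurableSet (cellE s k) :=
  measurable_fst measurableSet_Ico

theorem mem_cell_iff {s : ℝ} (hs : 0 < s) {k : ℤ} {x : ℝ} : x ∈ cell s k ↔ ⌊x / s⌋ = k := by
  rw [Int.floor_eq_iff, le_div_iff₀ hs, div_lt_iff₀ hs]
  rfl

theorem iUnion_cellE {s : ℝ} (hs : 0 < s) : ⋃ k, cellE s k = univ :=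
  eq_univ_of_forall fun e => mem_iUnion.2 ⟨⌊e.1 / s⌋, (mem_cell_iff hs).2 rfl⟩

theorem pairwise_disjoint_cellE {s : ℝ} (hs : 0 < s) : Pairwise (Function.onFun Disjoint (cellE s)) := by
  intro j k hjk
  refine disjoint_left.2 fun e hj hk => hjk ?_
  rw [← (mem_cell_iff hs).1 hj, ← (mem_cell_iff hs).1 hk]

/-! ### Counting measures as s-finite kernels, and measurability of sums over points -/

/-- The sum of unit masses at the points of a set. -/
def diracSum {E : Type*} [MeasurableSpace E] (c : Set E) : Measure E :=
  Measure.sum fun e : c => Measure.dirac (e : E)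

theorem lintegral_diracSum {E : Type*} [MeasurableSpace E] [MeasurableSingletonClass E] (c : Set E)
    (f : E → ℝ≥0∞) : ∫⁻ e, f e ∂(diracSum c) = ∑' e : c, f e := by
  rw [diracSum, lintegral_sum_measure]
  simp

theorem diracSum_apply {E : Type*} [MeasurableSpace E] [MeasurableSingletonClass E] (c : Set E)
    {B : Set E} (hB : MeasurableSet B) : diracSum c B = ((c ∩ B).encard : ℝ≥0∞) := by
  rw [← lintegral_indicator_one hB, lintegral_diracSum, tsum_subtype, indicator_indicator,
    ← tsum_subtype]
  exact ENNReal.tsum_set_one _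

/-- Cut the parameter space by the integer part of the total mass: the pieces are finite kernels,
although the masses have no uniform bound. S-finiteness is what makes integrals against the counting
kernels measurable in the parameter. -/
theorem isSFiniteKernel_of_lt_top {T E : Type*} [MeasurableSpace T] [MeasurableSpace E]
    (κ : Kernel T E) (h : ∀ t, κ t univ < ∞) : IsSFiniteKernel κ := by
  classical
  let f : T → ℕ := fun t => ⌊(κ t univ).toNNReal⌋₊
  have hf : Measurable f :=
    Nat.measurable_floor.comp (κ.measurable_coe MeasurableSet.univ).ennreal_toNNReal
  have hm : ∀ n, MeasurableSet (f ⁻¹' {n}) := fun n => hf (measurableSet_singleton n)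
  have e : κ = Kernel.sum fun n => Kernel.piecewise (hm n) κ 0 := by
    ext t B hB
    rw [Kernel.sum_apply' _ _ hB, tsum_eq_single (f t)]
    · simp [Kernel.piecewise_apply]
    · intro n hn
      simp [Kernel.piecewise_apply, hn.symm]
  rw [e]
  have : ∀ n, IsFiniteKernel (Kernel.piecewise (hm n) κ 0) := by
    refine fun n => ⟨⟨(n + 1 : ℕ), by simp, fun t => ?_⟩⟩
    rw [Kernel.piecewise_apply]
    split_ifs with ht
    · have h1 : (κ t univ).toNNReal ≤ (n + 1 : ℕ) := by
        have ht' : ⌊(κ t univ).toNNReal⌋₊ = n := ht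
        have := Nat.lt_floor_add_one (κ t univ).toNNReal
        rw [ht'] at this
        push_cast
        exact this.le
      rw [← ENNReal.coe_toNNReal (h t).ne]
      exact_mod_cast h1
    · simp
  exact Kernel.isSFiniteKernel_sum

theorem isSFiniteKernel_of_cover {T E : Type*} [MeasurableSpace T] [MeasurableSpace E]
    (κ : Kernel T E) {A : ℤ → Set E} (hA : ∀ i, MeasurableSet (A i))
    (hd : Pairwise (Function.onFun Disjoint A)) (hu : ⋃ i, A i = univ) (h : ∀ t i, κ t (A i) < ∞) :
    IsSFiniteKernel κ := by
  have e : κ = Kernel.sum fun i => κ.restrict (hA i) := by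
    ext t B hB
    rw [Kernel.sum_apply' _ _ hB]
    simp_rw [Kernel.restrict_apply' _ _ _ hB]
    rw [← measure_iUnion (fun i j hij => (hd hij).mono inter_subset_right inter_subset_right)
      fun i => hB.inter (hA i), ← inter_iUnion, hu, inter_univ]
  have : ∀ i, IsSFiniteKernel (κ.restrict (hA i)) := by
    refine fun i => isSFiniteKernel_of_lt_top _ fun t => ?_
    rw [Kernel.restrict_apply' _ _ _ MeasurableSet.univ, univ_inter]
    exact h t i
  rw [e]
  exact Kernel.isSFiniteKernel_sum

namespace Conf

variable {s : ℝ}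

theorem encard_inter_local (c : Conf s) {B : Set (ℝ × Bool)} (hl : Local s B) :
    ((c.1 ∩ B).encard : ℝ≥0∞) = (num B c : ℝ≥0∞) := by
  rw [num, ← (c.2.finite_inter hl).cast_ncard_eq]
  simp

variable [hs : Fact (0 < s)]

/-- The counting measure of a configuration. -/
def pts : Kernel (Conf s) (ℝ × Bool) where
  toFun c := diracSum c.1
  measurable' := by
    refine Measure.measurable_of_measurable_coe _ fun B hB => ?_
    have : (fun c : Conf s => diracSum c.1 B) =
        fun c : Conf s => ∑' k : ℤ, (num (B ∩ cellE s k) c : ℝ≥0∞) := by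
      ext c
      have hB' : B = ⋃ k, B ∩ cellE s k := by rw [← inter_iUnion, iUnion_cellE hs.out, inter_univ]
      conv_lhs => rw [hB']
      rw [measure_iUnion (fun i j hij => (pairwise_disjoint_cellE hs.out hij).mono
        inter_subset_right inter_subset_right) fun k => hB.inter (measurableSet_cellE s k)]
      refine tsum_congr fun k => ?_
      rw [diracSum_apply _ (hB.inter (measurableSet_cellE s k)),
        encard_inter_local c (local_of_subset_cellE inter_subset_right)]
    rw [this]
    refine Measurable.tsum fun k => ?_
    exact measurable_from_top.comp
      (measurable_num (hB.inter (measurableSet_cellE s k))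
        (local_of_subset_cellE inter_subset_right))

theorem pts_apply (c : Conf s) : pts c = diracSum c.1 := rfl

instance : IsSFiniteKernel (pts (s := s)) := by
  refine isSFiniteKernel_of_cover _ (measurableSet_cellE s) (pairwise_disjoint_cellE hs.out)
    (iUnion_cellE hs.out) fun c k => ?_
  rw [pts_apply, diracSum_apply _ (measurableSet_cellE s k), encard_inter_local c (local_of_subset_cellE subset_rfl)]
  simp

variable {T : Type*} [MeasurableSpace T]

/-- A sum over the points of a random configuration is an integral against a kernel. The
measurability of clusters, reach relations and rates rests on this. -/
theorem measurable_tsum_pts {c : T → Conf s} (hc : Measurable c) {G : T × (ℝ × Bool) → ℝ≥0∞}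
    (hG : Measurable G) : Measurable fun t => ∑' e : (c t).1, G (t, e) := by
  have := hG.lintegral_kernel_prod_right' (κ := pts.comap c hc)
  simpa [Kernel.comap_apply, pts_apply, lintegral_diracSum] using this

end Conf

theorem tsum_capable (c : Set (ℝ × Bool)) (g : ℝ → ℝ≥0∞) :
    ∑' x : capable c, g x = ∑' e : c, if (e : ℝ × Bool).2 then g (e : ℝ × Bool).1 else 0 := by
  classical
  rw [tsum_subtype (capable c), tsum_subtype c fun e : ℝ × Bool => if e.2 then g e.1 else 0]
  have := ENNReal.tsum_prod
    (f := fun x b => c.indicator (fun e : ℝ × Bool => if e.2 then g e.1 else 0) (x, b))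
  rw [this]
  refine tsum_congr fun x => ?_
  rw [tsum_bool]
  by_cases hx : (x, true) ∈ c
  · have : x ∈ capable c := hx
    simp [indicator, hx, this]
  · have : x ∉ capable c := hx
    simp [indicator, hx, this]

namespace Conf

variable {s : ℝ} [hs : Fact (0 < s)] {T : Type*} [MeasurableSpace T]

theorem measurable_tsum_capable {c : T → Conf s} (hc : Measurable c) {G : T × ℝ → ℝ≥0∞}
    (hG : Measurable G) : Measurable fun t => ∑' x : capable (c t).1, G (t, x) := by
  have e : (fun t => ∑' x : capable (c t).1, G (t, x)) = fun t => ∑' e : (c t).1,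
      (fun p : T × (ℝ × Bool) => if p.2.2 = true then G (p.1, p.2.1) else 0) (t, e) := by
    ext t
    rw [tsum_capable (c t).1 fun x => G (t, x)]
  rw [e]
  have hm : MeasurableSet {p : T × (ℝ × Bool) | p.2.2 = true} :=
    (measurable_snd.comp measurable_snd) (measurableSet_singleton true)
  have hG' : Measurable fun p : T × (ℝ × Bool) => G (p.1, p.2.1) :=
    hG.comp (measurable_fst.prodMk (measurable_fst.comp measurable_snd))
  exact measurable_tsum_pts hc (Measurable.ite hm hG' measurable_const)

/-- Existence of a point means that the sum of the indicators is nonzero; an uncountable quantifier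
over positions thereby becomes measurable. -/
theorem measurableSet_exists_pts {c : T → Conf s} (hc : Measurable c) {R : T → ℝ × Bool → Prop}
    (hR : MeasurableSet {p : T × (ℝ × Bool) | R p.1 p.2}) :
    MeasurableSet {t | ∃ e ∈ (c t).1, R t e} := by
  classical
  have h := measurable_tsum_pts hc
    (G := {p : T × (ℝ × Bool) | R p.1 p.2}.indicator fun _ => 1) (measurable_const.indicator hR)
  have e : {t | ∃ e ∈ (c t).1, R t e} = {t | ∑' e : (c t).1,
      {p : T × (ℝ × Bool) | R p.1 p.2}.indicator (fun _ => (1 : ℝ≥0∞)) (t, e) = 0}ᶜ := by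
    ext t
    simp only [mem_ofPred_eq, ENNReal.tsum_eq_zero, indicator, mem_compl_iff, Subtype.forall,
      ite_eq_right_iff, one_ne_zero, imp_false, not_forall, not_not, exists_prop]
  rw [e]
  exact (h (measurableSet_singleton 0)).compl

theorem measurableSet_exists_capable {c : T → Conf s} (hc : Measurable c) {R : T → ℝ → Prop}
    (hR : MeasurableSet {p : T × ℝ | R p.1 p.2}) :
    MeasurableSet {t | ∃ x ∈ capable (c t).1, R t x} := by
  have : {t | ∃ x ∈ capable (c t).1, R t x} = {t | ∃ e ∈ (c t).1, e.2 = true ∧ R t e.1} := by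
    ext t
    constructor
    · rintro ⟨x, hx, h⟩; exact ⟨(x, true), hx, rfl, h⟩
    · rintro ⟨⟨x, b⟩, hx, rfl, h⟩; exact ⟨x, hx, h⟩
  rw [this]
  refine measurableSet_exists_pts hc (MeasurableSet.inter ?_ ?_)
  · exact (measurable_snd.comp measurable_snd) (measurableSet_singleton true)
  · exact (measurable_fst.prodMk (measurable_fst.comp measurable_snd)) hR

theorem measurableSet_mem_capable {c : T → Conf s} (hc : Measurable c) {x : T → ℝ}
    (hx : Measurable x) : MeasurableSet {t | x t ∈ capable (c t).1} := by
  have : {t | x t ∈ capable (c t).1} = {t | ∃ y ∈ capable (c t).1, y = x t} := by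
    ext t; simp
  rw [this]
  exact measurableSet_exists_capable hc
    (measurableSet_eq_fun measurable_snd (hx.comp measurable_fst))

end Conf

/-! ### Shifting and removing vehicles -/

namespace Conf

variable {s : ℝ}

/-- The configuration seen from the `k`-th RSU. -/
def shift (k : ℤ) (c : Conf s) : Conf s :=
  ⟨{e | (e.1 + k * s, e.2) ∈ c.1}, by
    have hcell : ∀ j (e : ℝ × Bool), e ∈ cellE s j ↔ (e.1 + k * s, e.2) ∈ cellE s (j + k) := by
      intro j e
      simp only [cellE, cell, mem_preimage, mem_Ico]
      push_cast
      constructor <;> rintro ⟨h1, h2⟩ <;> constructor <;> linarith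
    have hempty : ∀ j, EmptyCell s c.1 j → EmptyCell s {e | (e.1 + k * s, e.2) ∈ c.1} (j - k) := by
      intro j hj
      refine eq_empty_of_forall_notMem fun e he => ?_
      have : ((e.1 + k * s, e.2) : ℝ × Bool) ∈ c.1 ∩ cellE s j :=
        ⟨he.1, by simpa using (hcell _ _).1 he.2⟩
      rw [hj] at this
      exact this
    refine ⟨fun j => ?_, fun j => ?_, fun j => ?_⟩
    · refine Finite.of_finite_image (f := fun e : ℝ × Bool => (e.1 + k * s, e.2))
        ((c.2.finite (j + k)).subset ?_) ?_
      · rintro _ ⟨e, he, rfl⟩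
        exact ⟨he.1, (hcell _ _).1 he.2⟩
      · rintro ⟨a, b⟩ _ ⟨a', b'⟩ _ h
        simpa using h
    · obtain ⟨i, hi, h⟩ := c.2.right (j + k)
      exact ⟨i - k, by omega, hempty i h⟩
    · obtain ⟨i, hi, h⟩ := c.2.left (j + k)
      exact ⟨i - k, by omega, hempty i h⟩⟩

theorem mem_shift {k : ℤ} {c : Conf s} {e : ℝ × Bool} :
    e ∈ (shift k c).1 ↔ (e.1 + k * s, e.2) ∈ c.1 := Iff.rfl

theorem mem_capable_shift {k : ℤ} {c : Conf s} {x : ℝ} :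
    x ∈ capable (shift k c).1 ↔ x + k * s ∈ capable c.1 := Iff.rfl

theorem preimage_sub_local (k : ℤ) {B : Set (ℝ × Bool)} (hB : Local s B) :
    Local s ((fun e : ℝ × Bool => (e.1 - k * s, e.2)) ⁻¹' B) := by
  obtain ⟨j, hj⟩ := hB
  refine ⟨j + k, fun e he => ?_⟩
  have := hj he
  simp only [cellE, cell, mem_union, mem_preimage, mem_Ico] at this ⊢
  push_cast at this ⊢
  exact this.imp (fun h => ⟨by linarith, by linarith⟩) fun h => ⟨by linarith, by linarith⟩

theorem num_shift (k : ℤ) (B : Set (ℝ × Bool)) (c : Conf s) :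
    num B (shift k c) = num ((fun e : ℝ × Bool => (e.1 - k * s, e.2)) ⁻¹' B) c := by
  unfold num
  refine ncard_congr (fun e _ => (e.1 + k * s, e.2)) ?_ ?_ ?_
  · rintro e ⟨h1, h2⟩
    exact ⟨h1, by simpa using h2⟩
  · rintro ⟨a, b⟩ ⟨a', b'⟩ _ _ h
    simpa using h
  · rintro ⟨a, b⟩ ⟨h1, h2⟩
    exact ⟨(a - k * s, b), ⟨by simpa [mem_shift] using h1, h2⟩, by simp⟩

theorem measurable_shift (k : ℤ) : Measurable (shift k : Conf s → Conf s) := by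
  refine measurable_iff.2 fun B hB hl => ?_
  simp_rw [num_shift]
  exact measurable_num ((by fun_prop : Measurable fun e : ℝ × Bool => (e.1 - k * s, e.2)) hB)
    (preimage_sub_local k hl)

/-- Removal of the capable vehicle at `x`. -/
def remove (p : Conf s × ℝ) : Conf s := ⟨p.1.1 \ {(p.2, true)}, p.1.2.mono sdiff_subset⟩

/-- The part of the configuration to the right of `x`. -/
def after (x : ℝ) (c : Conf s) : Conf s := ⟨c.1 ∩ {e | x < e.1}, c.2.mono inter_subset_left⟩

theorem measurable_remove [Fact (0 < s)] : Measurable (remove : Conf s × ℝ → Conf s) := by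
  refine measurable_iff.2 fun B hB hl => ?_
  have h : Measurable fun p : Conf s × ℝ => (num B (remove p) : ℝ≥0∞) := by
    have e : (fun p : Conf s × ℝ => (num B (remove p) : ℝ≥0∞)) = fun p => ∑' e : p.1.1,
        {q : (Conf s × ℝ) × (ℝ × Bool) | q.2 ∈ B ∧ q.2 ≠ (q.1.2, true)}.indicator
          (fun _ => (1 : ℝ≥0∞)) (p, e) := by
      ext p
      rw [← encard_inter_local _ hl, ← ENNReal.tsum_set_one,
        tsum_subtype ((remove p).1 ∩ B) fun _ => (1 : ℝ≥0∞), tsum_subtype p.1.1 (fun e => {q : (Conf s × ℝ) × (ℝ × Bool) | q.2 ∈ B ∧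
          q.2 ≠ (q.1.2, true)}.indicator (fun _ => (1 : ℝ≥0∞)) (p, e))]
      refine tsum_congr fun e => ?_
      by_cases h1 : e ∈ p.1.1 <;> by_cases h2 : e ∈ B <;> by_cases h3 : e = (p.2, true) <;>
        simp [indicator, remove, h1, h2, h3]
    rw [e]
    refine measurable_tsum_pts measurable_fst (measurable_const.indicator ?_)
    refine MeasurableSet.inter (measurable_snd hB) (measurableSet_eq_fun measurable_snd ?_).compl
    fun_prop
  refine measurable_to_countable' fun n => ?_
  have := h (measurableSet_singleton (n : ℝ≥0∞))
  convert this using 1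
  ext p
  simp

theorem num_after (x : ℝ) (B : Set (ℝ × Bool)) (c : Conf s) :
    num B (after x c) = num (B ∩ {e | x < e.1}) c := by
  unfold num after
  congr 1
  ext e
  simp only [mem_inter_iff]
  tauto

theorem measurable_after (x : ℝ) : Measurable (after x : Conf s → Conf s) := by
  refine measurable_iff.2 fun B hB hl => ?_
  simp_rw [num_after]
  exact measurable_num (hB.inter (measurable_fst measurableSet_Ioi)) (hl.mono inter_subset_left)

end Conf

/-! ### Laws of configurations are determined by joint counts in disjoint sets -/

namespace Conf

variable {s : ℝ}

theorem num_eq_sum {ι : Type*} [Fintype ι] (c : Conf s) {B : Set (ℝ × Bool)} (hB : Local s B)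
    {D : ι → Set (ℝ × Bool)} (hd : Pairwise (Function.onFun Disjoint D)) (hD : ⋃ i, D i = B) :
    num B c = ∑ i, num (D i) c := by
  classical
  have hfin : ∀ i, (c.1 ∩ D i).Finite := fun i =>
    (c.2.finite_inter hB).subset (inter_subset_inter_right _ (hD ▸ subset_iUnion D i))
  have h1 : (c.2.finite_inter hB).toFinset = Finset.univ.biUnion fun i => (hfin i).toFinset := by
    ext e
    simp [← hD]
  unfold num
  rw [ncard_eq_toFinset_card _ (c.2.finite_inter hB), h1, Finset.card_biUnion]
  · exact Finset.sum_congr rfl fun i _ => (ncard_eq_toFinset_card _ (hfin i)).symm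
  · intro i _ j _ hij
    refine Finset.disjoint_left.2 fun e hi hj => ?_
    simp only [Finite.mem_toFinset] at hi hj
    exact disjoint_left.1 (hd hij) hi.2 hj.2

/-- Finitely many local sets are unions of finitely many disjoint ones. -/
theorem exists_atoms {n : ℕ} {B : Fin n → Set (ℝ × Bool)} (hBm : ∀ o, MeasurableSet (B o))
    (hBl : ∀ o, Local s (B o)) :
    ∃ (ι : Type) (_ : Fintype ι) (D : ι → Set (ℝ × Bool)) (J : Fin n → Finset ι),
      (∀ i, MeasurableSet (D i)) ∧ (∀ i, Local s (D i)) ∧ Pairwise (Function.onFun Disjoint D) ∧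
      (∀ i o, D i ⊆ B o ∨ Disjoint (D i) (B o)) ∧ (∀ o, B o ⊆ ⋃ i, D i) ∧
      ∀ o (c : Conf s), num (B o) c = ∑ i ∈ J o, num (D i) c := by
  classical
  -- An atom consists of the points with a prescribed pattern of membership in the sets `B o`. The
  -- empty pattern is excluded because its atom need not be local.
  let ι := {J : Set (Fin n) // J.Nonempty}
  let D : ι → Set (ℝ × Bool) := fun J => {x | ∀ o, x ∈ B o ↔ o ∈ J.1}
  have hDB : ∀ (J : ι) o, o ∈ J.1 → D J ⊆ B o := fun J o ho x hx => (hx o).2 ho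
  have hDd : ∀ (J : ι) o, o ∉ J.1 → Disjoint (D J) (B o) := fun J o ho =>
    disjoint_left.2 fun x hx hxo => ho ((hx o).1 hxo)
  have hdisj : Pairwise (Function.onFun Disjoint D) := by
    intro J J' hne
    refine disjoint_left.2 fun x hx hx' => hne (Subtype.ext (Set.ext fun o => ?_))
    exact (hx o).symm.trans (hx' o)
  have hcov : ∀ o, ∀ x ∈ B o, ∃ J : ι, o ∈ J.1 ∧ x ∈ D J := fun o x hx =>
    ⟨⟨{p | x ∈ B p}, o, hx⟩, hx, fun p => Iff.rfl⟩
  refine ⟨ι, inferInstance, D, fun o => Finset.univ.filter fun J => o ∈ J.1, fun J => ?_,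
    fun J => ?_, hdisj, fun J o => ?_, fun o x hx => ?_, fun o c => ?_⟩
  · simp only [D, ofPred_forall]
    refine MeasurableSet.iInter fun o => ?_
    by_cases ho : o ∈ J.1
    · have : {x | x ∈ B o ↔ o ∈ J.1} = B o := by ext; simp [ho]
      rw [this]
      exact hBm o
    · have : {x | x ∈ B o ↔ o ∈ J.1} = (B o)ᶜ := by ext; simp [ho]
      rw [this]
      exact (hBm o).compl
  · obtain ⟨o, ho⟩ := J.2
    exact (hBl o).mono (hDB J o ho)
  · by_cases hJ : o ∈ J.1
    · exact Or.inl (hDB J o hJ)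
    · exact Or.inr (hDd J o hJ)
  · obtain ⟨J, -, hJ⟩ := hcov o x hx
    exact mem_iUnion.2 ⟨J, hJ⟩
  · rw [num_eq_sum c (hBl o) (D := fun J : {J : ι // o ∈ J.1} => D J.1)
      (fun J J' hne => hdisj fun e => hne (Subtype.ext e))]
    · exact (Finset.sum_subtype _ (by simp) fun J => num (D J) c).symm
    · ext x
      simp only [mem_iUnion]
      constructor
      · rintro ⟨J, hJ⟩
        exact hDB J.1 o J.2 hJ
      · intro hx
        obtain ⟨J, h1, h2⟩ := hcov o x hx
        exact ⟨⟨J, h1⟩, h2⟩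

/-- A finite measure on configurations is determined by the joint law of the numbers of vehicles in
disjoint local sets that are compatible with a given local set `A`. -/
theorem ext_measure {μ ν : Measure (Conf s)} [IsFiniteMeasure μ] {A : Set (ℝ × Bool)}
    (hA : MeasurableSet A) (hAl : Local s A)
    (h : ∀ (ι : Type) [Fintype ι] (D : ι → Set (ℝ × Bool)), (∀ i, MeasurableSet (D i)) →
      (∀ i, Local s (D i)) → Pairwise (Function.onFun Disjoint D) →
      (∀ i, D i ⊆ A ∨ Disjoint (D i) A) → A ⊆ ⋃ i, D i → ∀ a : ι → ℕ,
      μ {c | ∀ i, num (D i) c = a i} = ν {c | ∀ i, num (D i) c = a i}) : μ = ν := by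
  classical
  have key : ∀ (F : Finset (LocalSet s)) (R : Set (F → ℕ)),
      μ {c | (fun B : F => num B.1.1 c) ∈ R} = ν {c | (fun B : F => num B.1.1 c) ∈ R} := by
    intro F R
    let e : F ≃ Fin (Fintype.card F) := Fintype.equivFin F
    obtain ⟨ι, _, D, J, hDm, hDl, hDd, hDB, hDc, hnum⟩ := exists_atoms (s := s)
      -- Placing `A` at index `0` makes each atom either contained in `A` or disjoint from it and
      -- makes the atoms cover `A`; the original sets occupy the successor indices.
      (n := Fintype.card F + 1) (B := Fin.cons A fun o => (e.symm o).1.1)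
      (fun o => by
        refine Fin.cases ?_ (fun o => ?_) o
        · exact hA
        · exact (e.symm o).1.2.1)
      (fun o => by
        refine Fin.cases ?_ (fun o => ?_) o
        · exact hAl
        · exact (e.symm o).1.2.2)
    let Φ : Conf s → ι → ℕ := fun c i => num (D i) c
    have hΦ : Measurable Φ := measurable_pi_lambda _ fun i => measurable_num (hDm i) (hDl i)
    have hmap : μ.map Φ = ν.map Φ := by
      refine Measure.ext_of_singleton fun a => ?_
      rw [Measure.map_apply hΦ (measurableSet_singleton a),
        Measure.map_apply hΦ (measurableSet_singleton a)]
      have e : Φ ⁻¹' {a} = {c | ∀ i, num (D i) c = a i} := by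
        ext c
        simp [Φ, funext_iff]
      rw [e]
      exact h ι D hDm hDl hDd (fun i => hDB i 0) (hDc 0) a
    let R' : Set (ι → ℕ) := {a | (fun B : F => ∑ i ∈ J (e B).succ, a i) ∈ R}
    have hpre : {c | (fun B : F => num B.1.1 c) ∈ R} = Φ ⁻¹' R' := by
      ext c
      simp only [mem_ofPred_eq, mem_preimage, R', Φ]
      have : (fun B : F => num B.1.1 c) = fun B : F => ∑ i ∈ J (e B).succ, num (D i) c := by
        funext B
        rw [← hnum]
        simp
      rw [this]
    rw [hpre, ← Measure.map_apply hΦ (Set.to_countable R').measurableSet, hmap,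
      Measure.map_apply hΦ (Set.to_countable R').measurableSet]
  let m : LocalSet s → MeasurableSpace (Conf s) := fun B => MeasurableSpace.comap (num B.1) ⊤
  have hgen : (inferInstance : MeasurableSpace (Conf s)) =
      MeasurableSpace.generateFrom (piiUnionInter (fun B => {S | MeasurableSet[m B] S}) univ) := by
    rw [generateFrom_piiUnionInter_measurableSet m univ]
    simp only [mem_univ, iSup_pos]
    rfl
  refine ext_of_generate_finite _ hgen
    (isPiSystem_piiUnionInter _ (fun B => @MeasurableSpace.isPiSystem_measurableSet _ (m B)) univ)
    ?_ ?_
  · rintro S ⟨F, -, f, hf, rfl⟩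
    have hf' : ∀ B : LocalSet s, ∃ T : Set ℕ, B ∈ F → num B.1 ⁻¹' T = f B := by
      intro B
      by_cases hB : B ∈ F
      · obtain ⟨T, -, hT⟩ := MeasurableSpace.measurableSet_comap.1 (hf B hB)
        exact ⟨T, fun _ => hT⟩
      · exact ⟨∅, fun h => absurd h hB⟩
    choose T hT using hf'
    have : (⋂ B ∈ F, f B) = {c | (fun B : F => num B.1.1 c) ∈ {a : F → ℕ | ∀ B : F, a B ∈ T B.1}} := by
      ext c
      simp only [mem_iInter, mem_ofPred_eq, Subtype.forall]
      refine forall₂_congr fun B hB => ?_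
      rw [← hT B hB]
      rfl
    rw [this]
    exact key F _
  · have := key ∅ univ
    simpa using this

end Conf

/-! ### Poisson laws on configurations -/

theorem vehicleIntensity_prod (lam γ : ℝ) (A : Set ℝ) (M : Set Bool) :
    vehicleIntensity lam γ (A ×ˢ M) = ENNReal.ofReal lam * volume A *
      (ENNReal.ofReal γ * M.indicator 1 true + ENNReal.ofReal (1 - γ) * M.indicator 1 false) := by
  rw [vehicleIntensity, Measure.prod_prod]
  simp

theorem vehicleIntensity_capable (lam γ : ℝ) (A : Set ℝ) :
    vehicleIntensity lam γ (A ×ˢ {true}) = ENNReal.ofReal lam * ENNReal.ofReal γ * volume A := by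
  rw [vehicleIntensity_prod]
  simp
  ring

theorem vehicleIntensity_all (lam : ℝ) {γ : ℝ} (h0 : 0 ≤ γ) (h1 : γ ≤ 1) (A : Set ℝ) :
    vehicleIntensity lam γ (Prod.fst ⁻¹' A) = ENNReal.ofReal lam * volume A := by
  have : (Prod.fst ⁻¹' A : Set (ℝ × Bool)) = A ×ˢ univ := by ext; simp
  rw [this, vehicleIntensity_prod]
  simp [← ENNReal.ofReal_add h0 (sub_nonneg.2 h1)]

theorem vehicleIntensity_cellE_lt_top (s lam γ : ℝ) (k : ℤ) :
    vehicleIntensity lam γ (cellE s k) < ∞ := by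
  have : cellE s k = cell s k ×ˢ (univ : Set Bool) := by ext; simp [cellE]
  rw [this, vehicleIntensity_prod]
  simp only [cell, Real.volume_Ico]
  refine ENNReal.mul_lt_top (ENNReal.mul_lt_top ?_ ?_) ?_ <;> simp

theorem vehicleIntensity_lt_top {s : ℝ} (lam γ : ℝ) {B : Set (ℝ × Bool)} (hB : Local s B) :
    vehicleIntensity lam γ B < ∞ := by
  obtain ⟨k, hk⟩ := hB
  exact (measure_mono hk).trans_lt ((measure_union_le _ _).trans_lt (ENNReal.add_lt_top.2
    ⟨vehicleIntensity_cellE_lt_top s lam γ k, vehicleIntensity_cellE_lt_top s lam γ (k + 1)⟩))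

theorem vehicleIntensity_preimage_sub (lam γ a : ℝ) {B : Set (ℝ × Bool)} (hB : MeasurableSet B) :
    vehicleIntensity lam γ ((fun e : ℝ × Bool => (e.1 - a, e.2)) ⁻¹' B) =
      vehicleIntensity lam γ B := by
  have h1 : MeasurePreserving (fun x : ℝ => x - a) (ENNReal.ofReal lam • (volume : Measure ℝ))
      (ENNReal.ofReal lam • (volume : Measure ℝ)) :=
    (measurePreserving_sub_right volume a).smul_measure _
  exact (h1.prod (MeasurePreserving.id _)).measure_preimage hB.nullMeasurableSet

/-- The numbers of vehicles in disjoint local sets are independent and Poisson distributed. -/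
structure IsPoissonLaw {s : ℝ} (lam γ : ℝ) (μ : Measure (Conf s)) : Prop where
  isProbabilityMeasure : IsProbabilityMeasure μ
  prob_num : ∀ (ι : Type) [Fintype ι] (D : ι → Set (ℝ × Bool)), (∀ i, MeasurableSet (D i)) →
    (∀ i, Local s (D i)) → Pairwise (Function.onFun Disjoint D) → ∀ a : ι → ℕ,
    μ {c | ∀ i, Conf.num (D i) c = a i} =
      ∏ i, poissonMeasure (vehicleIntensity lam γ (D i)).toNNReal {a i}

/-- The identity behind the Mecke formula, and again behind the incomplete gamma function in the V2I
law. -/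
theorem poissonMeasure_singleton_succ (r : ℝ≥0) (n : ℕ) :
    ((n + 1 : ℕ) : ℝ≥0∞) * poissonMeasure r {n + 1} = r * poissonMeasure r {n} := by
  rw [poissonMeasure_singleton, poissonMeasure_singleton, ← ENNReal.ofReal_natCast,
    ← ENNReal.ofReal_coe_nnreal, ← ENNReal.ofReal_mul (by positivity),
    ← ENNReal.ofReal_mul (by positivity)]
  congr 1
  rw [Nat.factorial_succ]
  push_cast
  field_simp
  ring

namespace IsPoissonLaw

variable {s lam γ : ℝ} {μ : Measure (Conf s)}

theorem prob_num_single (h : IsPoissonLaw lam γ μ) {B : Set (ℝ × Bool)} (hB : MeasurableSet B)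
    (hl : Local s B) (n : ℕ) :
    μ {c | Conf.num B c = n} = poissonMeasure (vehicleIntensity lam γ B).toNNReal {n} := by
  have := h.prob_num Unit (fun _ => B) (fun _ => hB) (fun _ => hl)
    (fun i j hij => absurd rfl hij) (fun _ => n)
  simpa using this

theorem map_shift (h : IsPoissonLaw lam γ μ) (k : ℤ) : μ.map (Conf.shift k) = μ := by
  have := h.isProbabilityMeasure
  symm
  refine Conf.ext_measure (A := ∅) MeasurableSet.empty ⟨0, empty_subset _⟩ ?_
  intro ι _ D hDm hDl hDd _ _ a
  have hm : MeasurableSet {c : Conf s | ∀ i, Conf.num (D i) c = a i} := by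
    simp only [ofPred_forall]
    exact MeasurableSet.iInter fun i =>
      Conf.measurable_num (hDm i) (hDl i) (measurableSet_singleton (a i))
  rw [Measure.map_apply (Conf.measurable_shift k) hm]
  have e : Conf.shift k ⁻¹' {c : Conf s | ∀ i, Conf.num (D i) c = a i} =
      {c | ∀ i, Conf.num ((fun e : ℝ × Bool => (e.1 - k * s, e.2)) ⁻¹' D i) c = a i} := by
    ext c
    simp only [mem_preimage, mem_ofPred_eq, Conf.num_shift]
  rw [e, h.prob_num ι D hDm hDl hDd, h.prob_num ι _
    (fun i => (by fun_prop : Measurable fun e : ℝ × Bool => (e.1 - k * s, e.2)) (hDm i))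
    (fun i => Conf.preimage_sub_local k (hDl i)) fun i j hij => (hDd hij).preimage _]
  simp_rw [vehicleIntensity_preimage_sub lam γ _ (hDm _)]

theorem lintegral_shift (h : IsPoissonLaw lam γ μ) (k : ℤ) {f : Conf s → ℝ≥0∞} (hf : Measurable f) :
    ∫⁻ c, f (Conf.shift k c) ∂μ = ∫⁻ c, f c ∂μ := by
  conv_rhs => rw [← h.map_shift k, lintegral_map hf (Conf.measurable_shift k)]

/-- The vehicles right of `y` are independent of the absence of vehicles in a local set left
of `y`. -/
theorem measure_void_inter_after (h : IsPoissonLaw lam γ μ) {y : ℝ} {B : Set (ℝ × Bool)}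
    (hB : MeasurableSet B) (hl : Local s B) (hBy : ∀ e ∈ B, e.1 ≤ y) {S : Set (Conf s)}
    (hS : MeasurableSet S) :
    μ {c | Conf.num B c = 0 ∧ Conf.after y c ∈ S} =
      poissonMeasure (vehicleIntensity lam γ B).toNNReal {0} * μ {c | Conf.after y c ∈ S} := by
  have := h.isProbabilityMeasure
  set p := poissonMeasure (vehicleIntensity lam γ B).toNNReal {0} with hp
  have hB0 : MeasurableSet {c : Conf s | Conf.num B c = 0} :=
    Conf.measurable_num hB hl (measurableSet_singleton 0)
  -- Independence from the whole future is an equality of two measures, tested on counts right of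
  -- `y`. There `B` enters as an additional disjoint set, indexed by `none`, and the joint
  -- probability factorises.
  have key : (μ.restrict {c | Conf.num B c = 0}).map (Conf.after y) = p • μ.map (Conf.after y) := by
    refine Conf.ext_measure (A := ∅) MeasurableSet.empty ⟨0, empty_subset _⟩ ?_
    intro ι _ D hDm hDl hDd _ _ a
    have hm : MeasurableSet {c : Conf s | ∀ i, Conf.num (D i) c = a i} := by
      simp only [ofPred_forall]
      exact MeasurableSet.iInter fun i =>
        Conf.measurable_num (hDm i) (hDl i) (measurableSet_singleton (a i))
    rw [Measure.map_apply (Conf.measurable_after y) hm,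
      Measure.restrict_apply (Conf.measurable_after y hm), Measure.smul_apply,
      Measure.map_apply (Conf.measurable_after y) hm, smul_eq_mul]
    have hDm' : ∀ i, MeasurableSet (D i ∩ {e | y < e.1}) := fun i =>
      (hDm i).inter (measurable_fst measurableSet_Ioi)
    have hDl' : ∀ i, Local s (D i ∩ {e | y < e.1}) := fun i => (hDl i).mono inter_subset_left
    have hDd' : Pairwise (Function.onFun Disjoint fun i => D i ∩ {e | y < e.1}) := fun i j hij =>
      (hDd hij).mono inter_subset_left inter_subset_left
    have e1 : Conf.after y ⁻¹' {c : Conf s | ∀ i, Conf.num (D i) c = a i} =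
        {c | ∀ i, Conf.num (D i ∩ {e | y < e.1}) c = a i} := by
      ext c
      simp only [mem_preimage, mem_ofPred_eq, Conf.num_after]
    have e2 : {c : Conf s | ∀ i, Conf.num (D i ∩ {e | y < e.1}) c = a i} ∩
        {c | Conf.num B c = 0} = {c | ∀ o : Option ι,
          Conf.num (o.elim B fun i => D i ∩ {e | y < e.1}) c = o.elim 0 a} := by
      ext c
      simp [Option.forall, and_comm]
    rw [e1, e2, h.prob_num (Option ι), h.prob_num ι _ hDm' hDl' hDd', Fintype.prod_option]
    · rfl
    · rintro (_ | i)
      · exact hB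
      · exact hDm' i
    · rintro (_ | i)
      · exact hl
      · exact hDl' i
    · have hdis : ∀ i, Disjoint B (D i ∩ {e | y < e.1}) := fun i =>
        disjoint_left.2 fun e he he' => absurd he'.2 (not_lt.2 (hBy e he))
      rintro (_ | i) (_ | j) hij
      · exact absurd rfl hij
      · exact hdis j
      · exact (hdis i).symm
      · exact hDd' fun e => hij (congrArg some e)
  have := congrArg (fun m => m S) key
  simp only [Measure.smul_apply, smul_eq_mul] at this
  rw [Measure.map_apply (Conf.measurable_after y) hS, Measure.map_apply (Conf.measurable_after y) hS,
    Measure.restrict_apply (Conf.measurable_after y hS)] at this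
  rw [show {c | Conf.num B c = 0 ∧ Conf.after y c ∈ S} =
    Conf.after y ⁻¹' S ∩ {c | Conf.num B c = 0} by ext; simp [and_comm], this]
  rfl

end IsPoissonLaw

/-! ### The Mecke formula -/

namespace Conf

variable {s : ℝ}

theorem num_remove_of_mem {c : Conf s} {x : ℝ} {B : Set (ℝ × Bool)} (hl : Local s B)
    (hx : x ∈ capable c.1) (hB : (x, true) ∈ B) : num B (remove (c, x)) + 1 = num B c := by
  unfold num remove
  have : (c.1 \ {(x, true)}) ∩ B = (c.1 ∩ B) \ {(x, true)} := by
    ext e; simp only [mem_inter_iff, mem_sdiff]; tauto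
  rw [this]
  exact ncard_sdiff_singleton_add_one ⟨hx, hB⟩ (c.2.finite_inter hl)

theorem num_remove_of_notMem {c : Conf s} {x : ℝ} {B : Set (ℝ × Bool)}
    (hB : (x, true) ∉ B) : num B (remove (c, x)) = num B c := by
  unfold num remove
  congr 1
  ext e
  simp only [mem_inter_iff, mem_sdiff, mem_singleton_iff]
  constructor
  · tauto
  · rintro ⟨h1, h2⟩
    exact ⟨⟨h1, fun h => hB (h ▸ h2)⟩, h2⟩

theorem encard_capable_inter (c : Set (ℝ × Bool)) (A : Set ℝ) :
    (capable c ∩ A).encard = (c ∩ A ×ˢ {true}).encard := by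
  have : c ∩ A ×ˢ {true} = (fun x => (x, true)) '' (capable c ∩ A) := by
    ext ⟨x, b⟩
    simp only [capable, mem_inter_iff, mem_prod, mem_singleton_iff, mem_image, mem_ofPred_eq,
      Prod.mk.injEq]
    constructor
    · rintro ⟨h1, h2, rfl⟩; exact ⟨x, ⟨h1, h2⟩, rfl, rfl⟩
    · rintro ⟨y, ⟨h1, h2⟩, rfl, rfl⟩; exact ⟨h1, h2, rfl⟩
  rw [this, Function.Injective.encard_image]
  intro x y h
  simpa using h

open Classical in
/-- The number of capable vehicles in `A` whose removal leaves `a i` vehicles in the `i`-th of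
finitely many disjoint sets. -/
theorem tsum_capable_remove {ι : Type*} [Fintype ι] (c : Conf s) {A : Set ℝ}
    {D : ι → Set (ℝ × Bool)} (hDl : ∀ i, Local s (D i)) (hDd : Pairwise (Function.onFun Disjoint D))
    (hDA : ∀ i, D i ⊆ A ×ˢ {true} ∨ Disjoint (D i) (A ×ˢ {true})) (hA : A ×ˢ {true} ⊆ ⋃ i, D i)
    (a : ι → ℕ) :
    (∑' x : capable c.1, if (x : ℝ) ∈ A ∧ ∀ i, num (D i) (remove (c, x)) = a i then (1 : ℝ≥0∞) else 0) =
      ∑ j ∈ Finset.univ.filter fun j => D j ⊆ A ×ˢ {true},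
        if ∀ i, num (D i) c = (a + Pi.single j 1 : ι → ℕ) i then ((a j + 1 : ℕ) : ℝ≥0∞) else 0 := by
  have hpt : ∀ x ∈ capable c.1,
      (if x ∈ A ∧ ∀ i, num (D i) (remove (c, x)) = a i then (1 : ℝ≥0∞) else 0) =
      ∑ j ∈ Finset.univ.filter fun j => D j ⊆ A ×ˢ {true}, if (x, true) ∈ D j then
        (if ∀ i, num (D i) c = (a + Pi.single j 1 : ι → ℕ) i then (1 : ℝ≥0∞) else 0) else 0 := by
    intro x hx
    by_cases hxA : x ∈ A
    -- A vehicle in `A` lies in exactly one atom `D j`, and removing it lowers only that count. So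
    -- the counts before removal must be `a + Pi.single j 1`.
    · obtain ⟨j, hj⟩ := mem_iUnion.1 (hA (mk_mem_prod hxA (mem_singleton true)))
      have hjA : D j ⊆ A ×ˢ {true} := (hDA j).resolve_right fun hdis =>
        disjoint_left.1 hdis hj (mk_mem_prod hxA (mem_singleton true))
      have huniq : ∀ i, i ≠ j → (x, true) ∉ D i := fun i hij hi =>
        disjoint_left.1 (hDd hij) hi hj
      rw [Finset.sum_eq_single_of_mem j (by simp [hjA]) fun i _ hij => if_neg (huniq i hij), if_pos hj]
      simp only [hxA, true_and]
      congr 1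
      refine propext (forall_congr' fun i => ?_)
      by_cases hij : i = j
      · subst hij
        rw [← num_remove_of_mem (hDl i) hx hj]
        simp
      · rw [num_remove_of_notMem (huniq i hij)]
        simp [hij]
    · rw [if_neg (fun h => hxA h.1)]
      refine (Finset.sum_eq_zero fun j hj => if_neg fun hxj => hxA ?_).symm
      exact ((Finset.mem_filter.1 hj).2 hxj).1
  rw [tsum_congr fun x : capable c.1 => hpt x x.2, Summable.tsum_finsetSum fun _ _ => ENNReal.summable]
  refine Finset.sum_congr rfl fun j hj => ?_
  have hjA := (Finset.mem_filter.1 hj).2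
  by_cases hc : ∀ i, num (D i) c = (a + Pi.single j 1 : ι → ℕ) i
  · simp only [hc, implies_true, if_true]
    have hset : {x | (x, true) ∈ D j} ×ˢ {true} = D j := by
      ext ⟨x, b⟩
      constructor
      · rintro ⟨h1, h2⟩
        obtain rfl : b = true := h2
        exact h1
      · intro h
        have h2 : b = true := (hjA h).2
        subst h2
        exact ⟨h, rfl⟩
    have h1 : (∑' x : capable c.1, if ((x : ℝ), true) ∈ D j then (1 : ℝ≥0∞) else 0) =
        ((capable c.1 ∩ {x | (x, true) ∈ D j}).encard : ℝ≥0∞) := by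
      rw [← ENNReal.tsum_set_one, tsum_subtype (capable c.1 ∩ {x | (x, true) ∈ D j}) fun _ => (1 : ℝ≥0∞),
        tsum_subtype (capable c.1) fun x : ℝ => if (x, true) ∈ D j then (1 : ℝ≥0∞) else 0]
      refine tsum_congr fun x => ?_
      by_cases h1 : x ∈ capable c.1 <;> by_cases h2 : (x, true) ∈ D j <;> simp [indicator, h1, h2]
    rw [h1, encard_capable_inter, hset, encard_inter_local c (hDl j), hc j]
    simp
  · simp only [if_neg hc]
    simp

variable [hs : Fact (0 < s)]

/-- The counting measure of the capable vehicles. -/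
def capPts : Kernel (Conf s) ℝ where
  toFun c := diracSum (capable c.1)
  measurable' := by
    refine Measure.measurable_of_measurable_coe _ fun B hB => ?_
    have : (fun c : Conf s => diracSum (capable c.1) B) = fun c : Conf s =>
        ∑' x : capable c.1, (fun p : Conf s × ℝ => B.indicator (fun _ => (1 : ℝ≥0∞)) p.2) (c, x) := by
      ext c
      rw [← lintegral_indicator_one hB, lintegral_diracSum]
      rfl
    rw [this]
    exact measurable_tsum_capable measurable_id ((measurable_const.indicator hB).comp measurable_snd)

theorem capPts_apply (c : Conf s) : capPts c = diracSum (capable c.1) := rfl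

theorem iUnion_cell : ⋃ k, cell s k = univ :=
  eq_univ_of_forall fun x => mem_iUnion.2 ⟨⌊x / s⌋, (mem_cell_iff hs.out).2 rfl⟩

theorem pairwise_disjoint_cell : Pairwise (Function.onFun Disjoint (cell s)) := by
  intro j k hjk
  refine disjoint_left.2 fun e hj hk => hjk ?_
  rw [← (mem_cell_iff hs.out).1 hj, ← (mem_cell_iff hs.out).1 hk]

instance : IsSFiniteKernel (capPts (s := s)) := by
  refine isSFiniteKernel_of_cover _ (measurableSet_cell s) pairwise_disjoint_cell
    iUnion_cell fun c k => ?_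
  rw [capPts_apply, diracSum_apply _ (measurableSet_cell s k), encard_capable_inter,
    encard_inter_local c (local_of_subset_cellE (k := k) fun e he => he.1)]
  simp

theorem lintegral_capPts (c : Conf s) (f : ℝ → ℝ≥0∞) :
    ∫⁻ x, f x ∂(capPts c) = ∑' x : capable c.1, f x := lintegral_diracSum _ _

end Conf

namespace IsPoissonLaw

variable {s lam γ : ℝ} {μ : Measure (Conf s)} [hs : Fact (0 < s)]

/-- On counts of atoms compatible with `A`, removing one vehicle from `D j` gives `(a j + 1) *
P(counts = a + e_j)`, where `e_j` is the unit vector at `j`. For Poisson counts this equals the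
intensity of `D j` times `P(counts = a)`, and the `D j` inside `A` add up to the intensity of `A ×ˢ
{true}`. -/
theorem mecke_rectangle (h : IsPoissonLaw lam γ μ) {A : Set ℝ} (hA : MeasurableSet A) {k : ℤ}
    (hAk : A ⊆ cell s k) :
    (((μ ⊗ₘ Conf.capPts).map fun p => (Conf.remove p, p.2)).restrict (univ ×ˢ A)).map Prod.fst =
      (ENNReal.ofReal lam * ENNReal.ofReal γ * volume A) • μ := by
  classical
  have := h.isProbabilityMeasure
  have hR : Measurable fun p : Conf s × ℝ => (Conf.remove p, p.2) :=
    Conf.measurable_remove.prodMk measurable_snd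
  have hfin : ENNReal.ofReal lam * ENNReal.ofReal γ * volume A < ∞ := by
    refine ENNReal.mul_lt_top (by simp [ENNReal.mul_lt_top]) ?_
    refine (measure_mono hAk).trans_lt ?_
    simp [cell]
  have : IsFiniteMeasure ((ENNReal.ofReal lam * ENNReal.ofReal γ * volume A) • μ) :=
    Measure.smul_finite _ hfin.ne
  have hAl : Local s (A ×ˢ {true}) := local_of_subset_cellE (k := k) fun e he => hAk he.1
  symm
  refine Conf.ext_measure (hA.prod (measurableSet_singleton true)) hAl ?_
  intro ι _ D hDm hDl hDd hDA hDc a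
  have hm : ∀ b : ι → ℕ, MeasurableSet {c : Conf s | ∀ i, Conf.num (D i) c = b i} := fun b => by
    simp only [ofPred_forall]
    exact MeasurableSet.iInter fun i =>
      Conf.measurable_num (hDm i) (hDl i) (measurableSet_singleton (b i))
  have hset : MeasurableSet {p : Conf s × ℝ | p.2 ∈ A ∧ ∀ i, Conf.num (D i) (Conf.remove p) = a i} :=
    (measurable_snd hA).inter (Conf.measurable_remove (hm a))
  rw [Measure.map_apply measurable_fst (hm a),
    Measure.restrict_apply (measurable_fst (hm a)), Measure.map_apply hR
      ((measurable_fst (hm a)).inter (MeasurableSet.univ.prod hA))]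
  have e1 : (fun p : Conf s × ℝ => (Conf.remove p, p.2)) ⁻¹'
      (Prod.fst ⁻¹' {c : Conf s | ∀ i, Conf.num (D i) c = a i} ∩ univ ×ˢ A) =
      {p : Conf s × ℝ | p.2 ∈ A ∧ ∀ i, Conf.num (D i) (Conf.remove p) = a i} := by
    ext p; simp [and_comm]
  rw [e1, ← lintegral_indicator_one hset, Measure.lintegral_compProd (measurable_one.indicator hset)]
  have e2 : ∀ c : Conf s, ∫⁻ x, {p : Conf s × ℝ | p.2 ∈ A ∧
      ∀ i, Conf.num (D i) (Conf.remove p) = a i}.indicator 1 (c, x) ∂(Conf.capPts c) =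
      ∑ j ∈ Finset.univ.filter fun j => D j ⊆ A ×ˢ {true},
        {c : Conf s | ∀ i, Conf.num (D i) c = (a + Pi.single j 1 : ι → ℕ) i}.indicator
          (fun _ => ((a j + 1 : ℕ) : ℝ≥0∞)) c := by
    intro c
    rw [Conf.lintegral_capPts]
    simp only [indicator_apply, mem_ofPred_eq, Pi.one_apply]
    convert Conf.tsum_capable_remove c hDl hDd hDA hDc a
  simp_rw [e2]
  rw [lintegral_finsetSum _ fun j _ => measurable_const.indicator (hm _)]
  have e3 : ∀ j, ∫⁻ c, {c : Conf s | ∀ i, Conf.num (D i) c = (a + Pi.single j 1 : ι → ℕ) i}.indicator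
      (fun _ => ((a j + 1 : ℕ) : ℝ≥0∞)) c ∂μ =
      vehicleIntensity lam γ (D j) * ∏ i, poissonMeasure (vehicleIntensity lam γ (D i)).toNNReal {a i} := by
    intro j
    rw [lintegral_indicator_const (hm _), h.prob_num ι D hDm hDl hDd,
      ← Finset.mul_prod_erase _ _ (Finset.mem_univ j), ← mul_assoc,
      ← Finset.mul_prod_erase _ (fun i => poissonMeasure (vehicleIntensity lam γ (D i)).toNNReal {a i})
        (Finset.mem_univ j), ← mul_assoc]
    congr 1
    · simp only [Pi.add_apply, Pi.single_eq_same]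
      rw [poissonMeasure_singleton_succ, ENNReal.coe_toNNReal (vehicleIntensity_lt_top lam γ (hDl j)).ne]
    · refine Finset.prod_congr rfl fun i hi => ?_
      simp [Finset.ne_of_mem_erase hi]
  rw [Finset.sum_congr rfl fun j _ => e3 j, ← Finset.sum_mul, Measure.smul_apply, smul_eq_mul,
    h.prob_num ι D hDm hDl hDd]
  congr 1
  rw [← vehicleIntensity_capable, ← measure_biUnion_finset (fun i _ j _ hij => hDd hij) fun i _ => hDm i]
  congr 1
  ext e
  simp only [Finset.mem_filter, Finset.mem_univ, true_and, mem_iUnion, exists_prop]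
  constructor
  · intro he
    obtain ⟨j, hj⟩ := mem_iUnion.1 (hDc he)
    exact ⟨j, (hDA j).resolve_right fun hdis => disjoint_left.1 hdis hj he, hj⟩
  · rintro ⟨j, hj, he⟩
    exact hj he

/-- **Mecke formula** for the capable vehicles. -/
theorem mecke (h : IsPoissonLaw lam γ μ) {H : Conf s × ℝ → ℝ≥0∞} (hH : Measurable H) :
    ∫⁻ c, ∑' x : capable c.1, H (Conf.remove (c, x), x) ∂μ =
      ENNReal.ofReal lam * ENNReal.ofReal γ * ∫⁻ x, ∫⁻ c, H (c, x) ∂μ := by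
  have := h.isProbabilityMeasure
  have hR : Measurable fun p : Conf s × ℝ => (Conf.remove p, p.2) :=
    Conf.measurable_remove.prodMk measurable_snd
  set m := (μ ⊗ₘ Conf.capPts).map fun p => (Conf.remove p, p.2) with hm
  set b := ENNReal.ofReal lam * ENNReal.ofReal γ with hb
  have hbt : b ≠ ∞ := by simp [hb, ENNReal.mul_eq_top]
  have hsf : SigmaFinite (b • (volume : Measure ℝ)) := by
    rw [← ENNReal.coe_toNNReal hbt]
    exact inferInstanceAs (SigmaFinite (b.toNNReal • (volume : Measure ℝ)))
  -- The removed configuration and the position have product law. It suffices to test rectangles,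
  -- which are cut along the segments to stay local and of finite intensity.
  have hprod : μ.prod (b • (volume : Measure ℝ)) = m := by
    refine Measure.prod_eq fun S A hS hA => ?_
    have hcov : ∀ T : Set ℝ, T = ⋃ k, T ∩ cell s k := fun T => by
      rw [← inter_iUnion, Conf.iUnion_cell, inter_univ]
    have hdis : Pairwise (Function.onFun Disjoint fun k => A ∩ cell s k) := fun i j hij =>
      (Conf.pairwise_disjoint_cell hij).mono inter_subset_right inter_subset_right
    have hms : ∀ k, MeasurableSet (A ∩ cell s k) := fun k => hA.inter (measurableSet_cell s k)
    have e1 : S ×ˢ A = ⋃ k, S ×ˢ (A ∩ cell s k) := by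
      conv_lhs => rw [hcov A]
      rw [prod_iUnion]
    rw [e1, measure_iUnion (fun i j hij => disjoint_prod.2 (Or.inr (hdis hij)))
      fun k => hS.prod (hms k)]
    conv_rhs => rw [hcov A]
    rw [measure_iUnion hdis hms, ← ENNReal.tsum_mul_left]
    refine tsum_congr fun k => ?_
    have := congrArg (fun m => m S) (h.mecke_rectangle (hms k) (k := k) inter_subset_right)
    simp only [Measure.smul_apply, smul_eq_mul] at this
    rw [Measure.map_apply measurable_fst hS, Measure.restrict_apply (measurable_fst hS)] at this
    rw [Measure.smul_apply, smul_eq_mul, mul_comm, ← this]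
    congr 1
    ext p
    simp
  have e1 : ∫⁻ p, H p ∂m = ∫⁻ c, ∑' x : capable c.1, H (Conf.remove (c, x), x) ∂μ := by
    rw [hm, lintegral_map hH hR, Measure.lintegral_compProd (f := fun a => H (Conf.remove a, a.2)) (hH.comp hR)]
    refine lintegral_congr fun c => ?_
    rw [Conf.lintegral_capPts]
  rw [← e1, ← hprod, lintegral_prod_symm' _ hH, lintegral_smul_measure, smul_eq_mul]

end IsPoissonLaw

/-! ### Forward chains of linked vehicles -/

/-- `y` is the position of the next vehicle after `x`, it is capable and within distance `d`. -/
def Succ (d : ℝ) (c : Set (ℝ × Bool)) (x y : ℝ) : Prop :=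
  y ∈ capable c ∧ x < y ∧ y ≤ x + d ∧ ∀ e ∈ c, e.1 ∉ Ioo x y

/-- There is a chain of `n` further linked vehicles to the right of `x`. -/
def fwd (d : ℝ) : ℕ → Set (ℝ × Bool) → ℝ → Prop
  | 0, _, _ => True
  | n + 1, c, x => ∃ y, Succ d c x y ∧ fwd d n c y

theorem Succ.unique {d : ℝ} {c : Set (ℝ × Bool)} {x y y' : ℝ} (h : Succ d c x y)
    (h' : Succ d c x y') : y = y' := by
  rcases lt_trichotomy y y' with hlt | rfl | hlt
  · exact absurd ⟨h.2.1, hlt⟩ (h'.2.2.2 (y, true) h.1)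
  · rfl
  · exact absurd ⟨h'.2.1, hlt⟩ (h.2.2.2 (y', true) h'.1)

/-- A chain starting at `x` sees only vehicles strictly to the right of `x`. Hence it is unaffected
by the removal in the Mecke formula and independent of voids to the left. -/
theorem fwd_congr {d : ℝ} {n : ℕ} {c c' : Set (ℝ × Bool)} {x : ℝ}
    (h : ∀ e : ℝ × Bool, x < e.1 → (e ∈ c ↔ e ∈ c')) : fwd d n c x ↔ fwd d n c' x := by
  induction n generalizing x with
  | zero => rfl
  | succ n ih =>
    refine exists_congr fun y => ?_
    by_cases hxy : x < y
    · refine and_congr (and_congr (h (y, true) hxy) (and_congr Iff.rfl (and_congr Iff.rfl ?_)))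
        (ih fun e he => h e (hxy.trans he))
      constructor
      · exact fun H e he hm => H e ((h e hm.1).2 he) hm
      · exact fun H e he hm => H e ((h e hm.1).1 he) hm
    · exact ⟨fun H => absurd H.1.2.1 hxy, fun H => absurd H.1.2.1 hxy⟩

namespace Conf

variable {s : ℝ} [hs : Fact (0 < s)] {T : Type*} [MeasurableSpace T]

theorem measurableSet_void {c : T → Conf s} (hc : Measurable c) {x y : T → ℝ} (hx : Measurable x)
    (hy : Measurable y) : MeasurableSet {t | ∀ e ∈ (c t).1, e.1 ∉ Ioo (x t) (y t)} := by
  have : {t | ∀ e ∈ (c t).1, e.1 ∉ Ioo (x t) (y t)} =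
      {t | ∃ e ∈ (c t).1, x t < e.1 ∧ e.1 < y t}ᶜ := by
    ext t
    simp only [mem_ofPred_eq, mem_compl_iff, not_exists, not_and, mem_Ioo]
  rw [this]
  refine (measurableSet_exists_pts hc (MeasurableSet.inter ?_ ?_)).compl
  · exact measurableSet_lt (hx.comp measurable_fst) (measurable_fst.comp measurable_snd)
  · exact measurableSet_lt (measurable_fst.comp measurable_snd) (hy.comp measurable_fst)

theorem measurableSet_fwd (d : ℝ) (n : ℕ) {c : T → Conf s} (hc : Measurable c) {x : T → ℝ}
    (hx : Measurable x) : MeasurableSet {t | fwd d n (c t).1 (x t)} := by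
  induction n generalizing T with
  | zero => simp [fwd]
  | succ n ih =>
    have : {t | fwd d (n + 1) (c t).1 (x t)} = {t | ∃ y ∈ capable (c t).1, x t < y ∧
        y ≤ x t + d ∧ (∀ e ∈ (c t).1, e.1 ∉ Ioo (x t) y) ∧ fwd d n (c t).1 y} := by
      ext t
      simp only [fwd, Succ, mem_ofPred_eq, and_assoc]
    rw [this]
    refine measurableSet_exists_capable hc ?_
    refine MeasurableSet.inter ?_ (MeasurableSet.inter ?_ (MeasurableSet.inter ?_ ?_))
    · exact measurableSet_lt (hx.comp measurable_fst) measurable_snd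
    · exact measurableSet_le measurable_snd ((hx.comp measurable_fst).add_const d)
    · exact measurableSet_void (hc.comp measurable_fst) (hx.comp measurable_fst) measurable_snd
    · exact ih (hc.comp measurable_fst) measurable_snd

end Conf

theorem lintegral_exp_Ioc {lam d : ℝ} (hlam : 0 < lam) (hd : 0 < d) (x : ℝ) :
    ∫⁻ y in Ioc x (x + d), ENNReal.ofReal (Real.exp (-(lam * (y - x)))) =
      ENNReal.ofReal ((1 - Real.exp (-(lam * d))) / lam) := by
  have hcont : Continuous fun y => Real.exp (-(lam * (y - x))) := by fun_prop
  rw [← ofReal_integral_eq_lintegral_ofReal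
    ((hcont.integrableOn_Icc (a := x) (b := x + d)).mono_set Ioc_subset_Icc_self)
    (Filter.Eventually.of_forall fun y => (Real.exp_pos _).le),
    ← intervalIntegral.integral_of_le (by linarith)]
  congr 1
  rw [intervalIntegral.integral_eq_sub_of_hasDerivAt (f := fun y => -Real.exp (-(lam * (y - x))) / lam)
    (fun y _ => ?_) (hcont.intervalIntegrable _ _)]
  · simp
    ring
  · have h1 : HasDerivAt (fun y => -(lam * (y - x))) (-lam) y := by
      have := (((hasDerivAt_id' y).sub_const x).const_mul lam).fun_neg
      simpa using this
    have := (h1.exp.fun_neg).div_const lam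
    refine this.congr_deriv ?_
    field_simp

namespace IsPoissonLaw

variable {s lam γ d : ℝ} {μ : Measure (Conf s)} [hs : Fact (0 < s)]

/-- The next vehicle is capable and at `y` with density `lam * γ * exp (-(lam * (y - x)))`, and the
remaining chain depends only on what lies right of `y`. Integrating over `x < y ≤ x + d` gives a
factor `γ * (1 - exp (-(lam * d))) = 1 - φ` per step. -/
theorem measure_fwd (h : IsPoissonLaw lam γ μ) (hlam : 0 < lam) (hγ0 : 0 < γ) (hγ1 : γ ≤ 1)
    (hd : 0 < d) (hds : d < s) (n : ℕ) (x : ℝ) :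
    μ {c | fwd d n c.1 x} = ENNReal.ofReal ((1 - phi lam γ d) ^ n) := by
  have := h.isProbabilityMeasure
  have hexp : Real.exp (-(lam * d)) < 1 := by
    rw [← Real.exp_zero]
    exact Real.exp_lt_exp.2 (by nlinarith)
  have hq : 0 ≤ 1 - phi lam γ d := by
    rw [phi]
    nlinarith [mul_pos hγ0 (sub_pos.2 hexp)]
  induction n generalizing x with
  | zero => simp [fwd]
  | succ n ih =>
    set S : Set (Conf s × ℝ) := {p | p.2 ∈ Ioc x (x + d) ∧ (∀ e ∈ p.1.1, e.1 ∉ Ioo x p.2) ∧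
      fwd d n p.1.1 p.2} with hSdef
    have hS : MeasurableSet S := (measurable_snd measurableSet_Ioc).inter
      ((Conf.measurableSet_void measurable_fst measurable_const measurable_snd).inter
        (Conf.measurableSet_fwd d n measurable_fst measurable_snd))
    have hmeas : MeasurableSet {c : Conf s | fwd d (n + 1) c.1 x} :=
      Conf.measurableSet_fwd d (n + 1) measurable_id measurable_const
    have hS' : ∀ (c : Conf s), ∀ y ∈ capable c.1, (Conf.remove (c, y), y) ∈ S ↔
        Succ d c.1 x y ∧ fwd d n c.1 y := by
      intro c y hy
      have h1 : fwd d n (Conf.remove (c, y)).1 y ↔ fwd d n c.1 y := by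
        refine fwd_congr fun e he => ?_
        simp only [Conf.remove, mem_sdiff, mem_singleton_iff, and_iff_left_iff_imp]
        rintro _ rfl
        exact lt_irrefl _ he
      have h2 : (∀ e ∈ (Conf.remove (c, y)).1, e.1 ∉ Ioo x y) ↔ ∀ e ∈ c.1, e.1 ∉ Ioo x y := by
        refine ⟨fun H e he hm => H e ⟨he, ?_⟩ hm, fun H e he => H e he.1⟩
        rintro rfl
        exact lt_irrefl _ hm.2
      simp only [hSdef, mem_ofPred_eq, h1, h2, Succ, mem_Ioc]
      tauto
    -- The next vehicle is unique, so the indicator is a sum over capable vehicles with at most one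
    -- nonzero term, to which the Mecke formula applies.
    have e1 : ∀ c : Conf s, {c : Conf s | fwd d (n + 1) c.1 x}.indicator (fun _ => (1 : ℝ≥0∞)) c =
        ∑' y : capable c.1, S.indicator (fun _ => 1) (Conf.remove (c, y), (y : ℝ)) := by
      intro c
      by_cases hc : fwd d (n + 1) c.1 x
      · obtain ⟨y, hy1, hy2⟩ := hc
        rw [indicator_of_mem (show c ∈ {c : Conf s | fwd d (n + 1) c.1 x} from ⟨y, hy1, hy2⟩),
          tsum_eq_single ⟨y, hy1.1⟩, indicator_of_mem ((hS' c y hy1.1).2 ⟨hy1, hy2⟩)]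
        rintro ⟨z, hz⟩ hne
        refine indicator_of_notMem (fun hzS => hne (Subtype.ext ?_)) _
        exact ((hS' c z hz).1 hzS).1.unique hy1
      · rw [indicator_of_notMem (show c ∉ {c : Conf s | fwd d (n + 1) c.1 x} from hc)]
        symm
        rw [ENNReal.tsum_eq_zero]
        rintro ⟨z, hz⟩
        refine indicator_of_notMem (fun hzS => hc ⟨z, ?_⟩) _
        exact (hS' c z hz).1 hzS
    have e2 : ∀ y, ∫⁻ c, S.indicator (fun _ => (1 : ℝ≥0∞)) (c, y) ∂μ =
        (Ioc x (x + d)).indicator (fun y => ENNReal.ofReal (Real.exp (-(lam * (y - x)))) *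
          ENNReal.ofReal ((1 - phi lam γ d) ^ n)) y := by
      intro y
      by_cases hy : y ∈ Ioc x (x + d)
      -- As `y - x ≤ d < s`, the gap meets at most the segment of `x` and the following one.
      · have hl : Local s (Prod.fst ⁻¹' Ioo x y) := by
          refine ⟨⌊x / s⌋, fun e he => ?_⟩
          have hx : x ∈ cell s ⌊x / s⌋ := (mem_cell_iff hs.out).2 rfl
          simp only [cellE, cell, mem_union, mem_preimage, mem_Ico, mem_Ioo, mem_Ioc] at he hx hy ⊢
          push_cast
          by_cases hlt : e.1 < (⌊x / s⌋ + 1) * s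
          · exact Or.inl ⟨by linarith, hlt⟩
          · exact Or.inr ⟨by linarith, by linarith⟩
        have hB : MeasurableSet (Prod.fst ⁻¹' Ioo x y : Set (ℝ × Bool)) :=
          measurable_fst measurableSet_Ioo
        have hm : MeasurableSet {c : Conf s | fwd d n c.1 y} :=
          Conf.measurableSet_fwd d n measurable_id measurable_const
        have hind := h.measure_void_inter_after hB hl (y := y) (fun e he => he.2.le) hm
        have ha : ∀ c : Conf s, Conf.after y c ∈ {c : Conf s | fwd d n c.1 y} ↔ fwd d n c.1 y := by
          intro c
          refine fwd_congr fun e he => ?_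
          simp [Conf.after, he]
        have hv : ∀ c : Conf s, Conf.num (Prod.fst ⁻¹' Ioo x y) c = 0 ↔
            ∀ e ∈ c.1, e.1 ∉ Ioo x y := by
          intro c
          rw [Conf.num, ncard_eq_zero (c.2.finite_inter hl), eq_empty_iff_forall_notMem]
          simp only [mem_inter_iff, mem_preimage, not_and]
        simp only [ha, hv] at hind
        rw [ih y, poissonMeasure_singleton, vehicleIntensity_all lam hγ0.le hγ1, Real.volume_Ioo,
          ← ENNReal.ofReal_mul hlam.le] at hind
        rw [indicator_of_mem hy]
        have hSy : MeasurableSet {c : Conf s | (c, y) ∈ S} := measurable_prodMk_right hS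
        have e3 : ∫⁻ c, S.indicator (fun _ => (1 : ℝ≥0∞)) (c, y) ∂μ = μ {c | (c, y) ∈ S} := by
          rw [← lintegral_indicator_one hSy]
          rfl
        have e4 : {c : Conf s | (c, y) ∈ S} =
            {c | (∀ e ∈ c.1, e.1 ∉ Ioo x y) ∧ fwd d n c.1 y} := by
          ext c
          simp only [hSdef, mem_ofPred_eq, hy, true_and]
        rw [e3, e4, hind]
        congr 2
        have : 0 ≤ lam * (y - x) := mul_nonneg hlam.le (sub_nonneg.2 hy.1.le)
        change Real.exp (-((Real.toNNReal (lam * (y - x)) : ℝ≥0) : ℝ)) * _ ^ 0 / _ = _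
        rw [Real.coe_toNNReal _ this]
        simp
      · rw [indicator_of_notMem hy]
        have : ∀ c, S.indicator (fun _ => (1 : ℝ≥0∞)) (c, y) = 0 := fun c =>
          indicator_of_notMem (fun hc => hy hc.1) _
        simp [this]
    rw [← lintegral_indicator_one hmeas]
    calc ∫⁻ c, {c : Conf s | fwd d (n + 1) c.1 x}.indicator 1 c ∂μ =
        ∫⁻ c, ∑' y : capable c.1, S.indicator (fun _ => 1) (Conf.remove (c, y), (y : ℝ)) ∂μ :=
          lintegral_congr e1
      _ = _ := h.mecke (measurable_const.indicator hS)
      _ = ENNReal.ofReal lam * ENNReal.ofReal γ * (ENNReal.ofReal ((1 - Real.exp (-(lam * d))) / lam) *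
          ENNReal.ofReal ((1 - phi lam γ d) ^ n)) := by
          simp_rw [e2]
          rw [lintegral_indicator measurableSet_Ioc, lintegral_mul_const _ (by fun_prop),
            lintegral_exp_Ioc hlam hd]
      _ = _ := by
          have h1 : 0 ≤ (1 - Real.exp (-(lam * d))) / lam :=
            div_nonneg (sub_pos.2 hexp).le hlam.le
          rw [← ENNReal.ofReal_mul hlam.le, ← ENNReal.ofReal_mul h1,
            ← ENNReal.ofReal_mul (mul_nonneg hlam.le hγ0.le)]
          congr 1
          rw [pow_succ, show 1 - phi lam γ d = γ * (1 - Real.exp (-(lam * d))) by rw [phi]; ring]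
          field_simp

/-- Expected number of the vehicles of one period that start a chain of `n + 1` linked vehicles. -/
theorem lintegral_tsum_fwd (h : IsPoissonLaw lam γ μ) (hlam : 0 < lam) (hγ0 : 0 < γ) (hγ1 : γ ≤ 1)
    (hd : 0 < d) (hds : d < s) (n : ℕ) :
    ∫⁻ c, ∑' x : capable c.1, {p : Conf s × ℝ | p.2 ∈ cell s 0 ∧ fwd d n p.1.1 p.2}.indicator
      (fun _ => (1 : ℝ≥0∞)) (c, (x : ℝ)) ∂μ = ENNReal.ofReal (lam * γ * s * (1 - phi lam γ d) ^ n) := by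
  have := h.isProbabilityMeasure
  set S : Set (Conf s × ℝ) := {p | p.2 ∈ cell s 0 ∧ fwd d n p.1.1 p.2} with hSdef
  have hS : MeasurableSet S := (measurable_snd (measurableSet_cell s 0)).inter
    (Conf.measurableSet_fwd d n measurable_fst measurable_snd)
  have e1 : ∀ c : Conf s, ∑' x : capable c.1, S.indicator (fun _ => (1 : ℝ≥0∞)) (c, (x : ℝ)) =
      ∑' x : capable c.1, S.indicator (fun _ => (1 : ℝ≥0∞)) (Conf.remove (c, x), (x : ℝ)) := by
    intro c
    refine tsum_congr fun x => ?_
    have h1 : fwd d n (Conf.remove (c, x)).1 x ↔ fwd d n c.1 x := by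
      refine fwd_congr fun e he => ?_
      simp only [Conf.remove, mem_sdiff, mem_singleton_iff, and_iff_left_iff_imp]
      rintro _ rfl
      exact lt_irrefl _ he
    have h2 : (c, (x : ℝ)) ∈ S ↔ (Conf.remove (c, x), (x : ℝ)) ∈ S := and_congr Iff.rfl h1.symm
    by_cases hx : (c, (x : ℝ)) ∈ S
    · rw [indicator_of_mem hx, indicator_of_mem (h2.1 hx)]
    · rw [indicator_of_notMem hx, indicator_of_notMem (mt h2.2 hx)]
  have e2 : ∀ y, ∫⁻ c, S.indicator (fun _ => (1 : ℝ≥0∞)) (c, y) ∂μ =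
      (cell s 0).indicator (fun _ => ENNReal.ofReal ((1 - phi lam γ d) ^ n)) y := by
    intro y
    have hSy : MeasurableSet {c : Conf s | (c, y) ∈ S} := measurable_prodMk_right hS
    have e3 : ∫⁻ c, S.indicator (fun _ => (1 : ℝ≥0∞)) (c, y) ∂μ = μ {c | (c, y) ∈ S} := by
      rw [← lintegral_indicator_one hSy]
      rfl
    rw [e3]
    by_cases hy : y ∈ cell s 0
    · rw [indicator_of_mem hy, ← h.measure_fwd hlam hγ0 hγ1 hd hds n y]
      simp [hSdef, hy]
    · rw [indicator_of_notMem hy]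
      simp [hSdef, hy]
  simp_rw [e1]
  rw [h.mecke (measurable_const.indicator hS)]
  simp_rw [e2]
  rw [lintegral_indicator_const (measurableSet_cell s 0), cell, Real.volume_Ico]
  have hs0 := hs.out.le
  rw [mul_comm (ENNReal.ofReal ((1 - phi lam γ d) ^ n)), ← mul_assoc, ← ENNReal.ofReal_mul hlam.le,
    ← ENNReal.ofReal_mul (by positivity), ← ENNReal.ofReal_mul]
  · congr 1
    push_cast
    ring
  · push_cast
    nlinarith [mul_pos hlam hγ0]

end IsPoissonLaw

/-! ### Clusters -/

section Cluster

variable {d : ℝ} {c : Set (ℝ × Bool)} {x y z : ℝ}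

theorem Linked.symm (h : Linked d c x y) : Linked d c y x := by
  refine ⟨h.2.1, h.1, by rw [abs_sub_comm]; exact h.2.2.1, fun z b hz => ?_⟩
  rw [min_comm, max_comm]
  exact h.2.2.2 z b hz

theorem mem_cluster_self : x ∈ cluster d c x := Relation.ReflTransGen.refl

theorem mem_cluster_symm (h : y ∈ cluster d c x) : x ∈ cluster d c y := by
  induction h with
  | refl => exact mem_cluster_self
  | tail _ h ih => exact Relation.ReflTransGen.head h.symm ih

theorem mem_cluster_trans (h : y ∈ cluster d c x) (h' : z ∈ cluster d c y) : z ∈ cluster d c x :=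
  Relation.ReflTransGen.trans h h'

theorem cluster_eq_of_mem (h : y ∈ cluster d c x) : cluster d c y = cluster d c x :=
  Set.ext fun _ => ⟨fun h' => mem_cluster_trans h h', fun h' =>
    mem_cluster_trans (mem_cluster_symm h) h'⟩

theorem mem_capable_of_mem_cluster (hx : x ∈ capable c) (h : y ∈ cluster d c x) : y ∈ capable c := by
  induction h with
  | refl => exact hx
  | tail _ h _ => exact h.2.1

theorem Succ.linked (hx : x ∈ capable c) (h : Succ d c x y) : Linked d c x y := by
  refine ⟨hx, h.1, ?_, fun z b hz => ?_⟩
  · rw [abs_sub_comm, abs_of_pos (sub_pos.2 h.2.1)]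
    linarith [h.2.2.1]
  · rw [min_eq_left h.2.1.le, max_eq_right h.2.1.le]
    exact h.2.2.2 _ hz

theorem Linked.succ (h : Linked d c x y) (hxy : x < y) : Succ d c x y := by
  refine ⟨h.2.1, hxy, ?_, fun e he => ?_⟩
  · have := h.2.2.1
    rw [abs_sub_comm, abs_of_pos (sub_pos.2 hxy)] at this
    linarith
  · have := h.2.2.2 e.1 e.2 he
    rwa [min_eq_left hxy.le, max_eq_right hxy.le] at this

theorem Succ.mem_cluster (hx : x ∈ capable c) (h : Succ d c x y) : y ∈ cluster d c x :=
  Relation.ReflTransGen.single (h.linked hx)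

/-- Links join neighbouring vehicles, so a path of links that gets to the right of `x` cannot jump
over `x`: it has used the link from `x` to its next vehicle. -/
theorem exists_succ (hx : x ∈ capable c) (h : z ∈ cluster d c x) (hz : x < z) :
    ∃ y, Succ d c x y ∧ y ≤ z := by
  induction h with
  | refl => exact absurd hz (lt_irrefl _)
  | @tail w w' _ hl ih =>
    rcases lt_trichotomy x w with hw | rfl | hw
    · obtain ⟨y, hy, hyw⟩ := ih hw
      refine ⟨y, hy, ?_⟩
      by_contra! hlt
      exact hy.2.2.2 (w', true) hl.2.1 ⟨hz, hlt⟩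
    · exact ⟨w', hl.succ hz, le_rfl⟩
    · exact absurd ⟨hw, hz⟩ ((hl.succ (hw.trans hz)).2.2.2 (x, true) hx)

theorem exists_pred (hx : x ∈ capable c) (h : z ∈ cluster d c x) (hz : z < x) :
    ∃ y ∈ capable c, Succ d c y x ∧ z ≤ y := by
  induction h with
  | refl => exact absurd hz (lt_irrefl _)
  | @tail w w' _ hl ih =>
    rcases lt_trichotomy x w with hw | rfl | hw
    · exact absurd ⟨hz, hw⟩ ((hl.symm.succ (hz.trans hw)).2.2.2 (x, true) hx)
    · exact ⟨w', hl.2.1, hl.symm.succ hz, le_rfl⟩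
    · obtain ⟨y, hyc, hy, hyw⟩ := ih hw
      refine ⟨y, hyc, hy, ?_⟩
      by_contra! hlt
      exact hy.2.2.2 (w', true) hl.2.1 ⟨hlt, hz⟩

theorem Succ.pred_unique {x' : ℝ} (hx : x ∈ capable c) (hx' : x' ∈ capable c) (h : Succ d c x y)
    (h' : Succ d c x' y) : x = x' := by
  rcases lt_trichotomy x x' with hlt | rfl | hlt
  · exact absurd ⟨hlt, h'.2.1⟩ (h.2.2.2 (x', true) hx')
  · rfl
  · exact absurd ⟨hlt, h.2.1⟩ (h'.2.2.2 (x, true) hx)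

/-- The vehicles of the cluster from `x` onwards are `x` followed by those from its successor
onwards. The shift by one counts `x` itself. -/
theorem fwd_iff_le_encard (hx : x ∈ capable c) (n : ℕ) :
    fwd d n c x ↔ ((n + 1 : ℕ) : ℕ∞) ≤ {y ∈ cluster d c x | x ≤ y}.encard := by
  induction n generalizing x with
  | zero =>
    simp only [fwd, zero_add, Nat.cast_one, true_iff, one_le_encard_iff_nonempty]
    exact ⟨x, mem_cluster_self, le_rfl⟩
  | succ n ih =>
    have hsplit : ∀ {y}, Succ d c x y →
        {z ∈ cluster d c x | x ≤ z} = insert x {z ∈ cluster d c y | y ≤ z} := by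
      intro y hy
      have hcl := cluster_eq_of_mem (hy.mem_cluster hx)
      ext z
      simp only [mem_insert_iff, mem_ofPred_eq, hcl]
      constructor
      · rintro ⟨hz, hxz⟩
        rcases hxz.eq_or_lt with rfl | hlt
        · exact Or.inl rfl
        · refine Or.inr ⟨hz, ?_⟩
          by_contra! hzy
          exact hy.2.2.2 (z, true) (mem_capable_of_mem_cluster hx hz) ⟨hlt, hzy⟩
      · rintro (rfl | ⟨hz, hyz⟩)
        · exact ⟨mem_cluster_self, le_rfl⟩
        · exact ⟨hz, hy.2.1.le.trans hyz⟩
    have hcard : ∀ {y}, Succ d c x y → {z ∈ cluster d c x | x ≤ z}.encard =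
        {z ∈ cluster d c y | y ≤ z}.encard + 1 := by
      intro y hy
      rw [hsplit hy, encard_insert_of_notMem]
      exact fun h => absurd h.2 (not_le.2 hy.2.1)
    constructor
    · rintro ⟨y, hy, hf⟩
      rw [hcard hy]
      push_cast
      have := (ih hy.1).1 hf
      push_cast at this
      exact add_le_add_left this 1
    · intro h
      have hex : ∃ z ∈ cluster d c x, x < z := by
        by_contra! hno
        have hsub : {z ∈ cluster d c x | x ≤ z} ⊆ {x} := fun z hz => le_antisymm (hno z hz.1) hz.2
        have := h.trans (encard_le_encard hsub)
        rw [encard_singleton] at this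
        have h2 : n + 1 + 1 ≤ 1 := by exact_mod_cast this
        omega
      obtain ⟨z, hz, hxz⟩ := hex
      obtain ⟨y, hy, -⟩ := exists_succ hx hz hxz
      refine ⟨y, hy, (ih hy.1).2 ?_⟩
      rw [hcard hy] at h
      push_cast at h ⊢
      exact (ENat.add_le_add_iff_right (by simp)).1 h

/-- A cluster with first vehicle `x` has `n + 1` vehicles iff there is a chain of exactly `n`
further vehicles. -/
theorem clusterSize_eq_iff (hx : x ∈ clusterHeads d c) (n : ℕ) :
    clusterSize d c x = ((n + 1 : ℕ) : ℕ∞) ↔ fwd d n c x ∧ ¬ fwd d (n + 1) c x := by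
  have h : {y ∈ cluster d c x | x ≤ y} = cluster d c x :=
    Set.ext fun y => ⟨fun hy => hy.1, fun hy => ⟨hy, hx.2 y hy⟩⟩
  rw [fwd_iff_le_encard hx.1, fwd_iff_le_encard hx.1, h, clusterSize, not_le]
  constructor
  · intro e
    rw [e]
    exact ⟨le_rfl, by exact_mod_cast Nat.lt_succ_self _⟩
  · rintro ⟨h1, h2⟩
    refine le_antisymm ?_ h1
    have : ((n + 1 + 1 : ℕ) : ℕ∞) = ((n + 1 : ℕ) : ℕ∞) + 1 := by push_cast; rfl
    rw [this] at h2
    exact Order.le_of_lt_add_one h2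

theorem v2vReach_of_mem_cluster {s : ℝ} (hx : x ∈ capable c) (h : y ∈ cluster d c x) (k : ℤ) :
    v2vReach d s c x k ↔ v2vReach d s c y k := by
  rw [v2vReach, v2vReach, cluster_eq_of_mem h]
  simp [hx, mem_capable_of_mem_cluster hx h]

theorem v2vReach_of_v2iReach {s : ℝ} {k : ℤ} (h : v2iReach d s c x k) : v2vReach d s c x k :=
  ⟨h.1, x, mem_cluster_self, h.2⟩

/-- A cluster has at least as many vehicles as it reaches RSUs. -/
theorem clusterRSUs_le_clusterSize {s : ℝ} (hds : d < s / 2) :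
    clusterRSUs d s c x ≤ clusterSize d c x := by
  have hex : ∀ k : ℤ, ∃ y, v2vReach d s c x k → y ∈ cluster d c x ∧ |y - k * s| ≤ d := by
    intro k
    by_cases h : v2vReach d s c x k
    · obtain ⟨_, y, hy⟩ := h
      exact ⟨y, fun _ => hy⟩
    · exact ⟨0, fun h' => absurd h' h⟩
  choose f hf using hex
  -- Choose for each reached RSU a vehicle of the cluster in its range. As `2 * d < s`, ranges of
  -- distinct RSUs are disjoint, so the choice is injective.
  have hinj : InjOn f {k | v2vReach d s c x k} := by
    intro j hj k hk hjk
    have h1 := abs_le.1 (hf j hj).2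
    have h2 := abs_le.1 (hf k hk).2
    rw [hjk] at h1
    by_contra hne
    rcases lt_or_gt_of_ne hne with hlt | hlt
    · have : (j : ℝ) + 1 ≤ k := by exact_mod_cast hlt
      nlinarith [abs_nonneg (f j - j * s), (hf j hj).2]
    · have : (k : ℝ) + 1 ≤ j := by exact_mod_cast hlt
      nlinarith [abs_nonneg (f j - j * s), (hf j hj).2]
  rw [clusterRSUs, clusterSize, ← hinj.encard_image]
  refine encard_le_encard ?_
  rintro _ ⟨k, hk, rfl⟩
  exact (hf k hk).1

end Cluster

/-! ### Blocks of the road between empty segments -/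

namespace Conf

variable {s : ℝ}

theorem exists_block (c : Conf s) (a : ℤ) : ∃ b, (b ≤ a ∧ EmptyCell s c.1 b) ∧
    ∀ z, z ≤ a ∧ EmptyCell s c.1 z → z ≤ b :=
  Int.exists_greatest_of_bdd ⟨a, fun _ h => h.1⟩ (c.2.left a)

/-- The last empty segment up to the segment `a`. -/
def block (c : Conf s) (a : ℤ) : ℤ := (c.exists_block a).choose

theorem block_le (c : Conf s) (a : ℤ) : c.block a ≤ a := (c.exists_block a).choose_spec.1.1

theorem emptyCell_block (c : Conf s) (a : ℤ) : EmptyCell s c.1 (c.block a) :=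
  (c.exists_block a).choose_spec.1.2

theorem le_block {c : Conf s} {a j : ℤ} (hj : j ≤ a) (h : EmptyCell s c.1 j) : j ≤ c.block a :=
  (c.exists_block a).choose_spec.2 j ⟨hj, h⟩

theorem block_eq_iff {c : Conf s} {a b : ℤ} :
    c.block a = b ↔ b ≤ a ∧ EmptyCell s c.1 b ∧ ∀ j, b < j → j ≤ a → ¬ EmptyCell s c.1 j := by
  constructor
  · rintro rfl
    exact ⟨c.block_le a, c.emptyCell_block a, fun j h1 h2 h3 => absurd (le_block h2 h3) (not_le.2 h1)⟩
  · rintro ⟨h1, h2, h3⟩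
    refine le_antisymm ?_ (le_block h1 h2)
    by_contra! hlt
    exact h3 _ hlt (c.block_le a) (c.emptyCell_block a)

theorem block_add_one {c : Conf s} {a : ℤ} (h : ¬ EmptyCell s c.1 (a + 1)) :
    c.block (a + 1) = c.block a := by
  rw [block_eq_iff]
  refine ⟨(c.block_le a).trans (by omega), c.emptyCell_block a, fun j h1 h2 h3 => ?_⟩
  rcases h2.eq_or_lt with rfl | hlt
  · exact h h3
  · exact absurd (le_block (by omega) h3) (not_le.2 h1)

/-- The block of a vehicle. -/
def vblock (c : Conf s) (x : ℝ) : ℤ := c.block ⌊x / s⌋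

/-- The block of an RSU. -/
def rblock (c : Conf s) (k : ℤ) : ℤ := c.block (k - 1)

theorem block_mem_Ico {c : Conf s} {a b j : ℤ} (h : c.block a = b) (hbj : b < j)
    (hj : EmptyCell s c.1 j) : a ∈ Ico b j := by
  refine ⟨h ▸ c.block_le a, ?_⟩
  by_contra! hlt
  have := le_block hlt hj
  omega

theorem finite_rblock (c : Conf s) (b : ℤ) : {k | c.rblock k = b}.Finite := by
  obtain ⟨j, hbj, hj⟩ := c.2.right (b + 1)
  refine ((finite_Ico b j).image fun a => a + 1).subset ?_
  intro k hk
  exact ⟨k - 1, block_mem_Ico hk (by omega) hj, by simp⟩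

variable [hs : Fact (0 < s)] {d : ℝ}

theorem not_emptyCell {c : Conf s} {x : ℝ} {b : Bool} (hx : (x, b) ∈ c.1) :
    ¬ EmptyCell s c.1 ⌊x / s⌋ := by
  intro h
  have : (x, b) ∈ c.1 ∩ cellE s ⌊x / s⌋ := ⟨hx, (mem_cell_iff hs.out).2 rfl⟩
  rw [h] at this
  exact this

/-- Linked vehicles lie in the same or in consecutive segments, and the later segment contains a
vehicle, so it cannot start a new block. -/
theorem vblock_eq_of_linked (hds : d < s) {c : Conf s} {x y : ℝ} (h : Linked d c.1 x y) :
    c.vblock x = c.vblock y := by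
  have key : ∀ {x y}, Linked d c.1 x y → x < y → c.vblock x = c.vblock y := by
    intro x y h hxy
    have hy := (h.succ hxy).2.2.1
    have h1 : ⌊x / s⌋ ≤ ⌊y / s⌋ := Int.floor_le_floor (div_le_div_of_nonneg_right hxy.le hs.out.le)
    have h2 : ⌊y / s⌋ ≤ ⌊x / s⌋ + 1 := by
      rw [← Int.floor_add_one]
      refine Int.floor_le_floor ?_
      rw [div_add_one hs.out.ne']
      exact div_le_div_of_nonneg_right (by linarith) hs.out.le
    rcases h1.eq_or_lt with e | hlt
    · rw [vblock, vblock, e]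
    · have e : ⌊y / s⌋ = ⌊x / s⌋ + 1 := by omega
      have := not_emptyCell (b := true) h.2.1
      rw [e] at this
      rw [vblock, vblock, e, block_add_one this]
  rcases lt_trichotomy x y with hlt | rfl | hlt
  · exact key h hlt
  · rfl
  · exact (key h.symm hlt).symm

theorem vblock_eq_of_mem_cluster (hds : d < s) {c : Conf s} {x y : ℝ} (h : y ∈ cluster d c.1 x) :
    c.vblock x = c.vblock y := by
  induction h with
  | refl => rfl
  | tail _ h ih => exact ih.trans (vblock_eq_of_linked hds h)

/-- RSU `k` stands on the boundary of segments `k - 1` and `k`, and a vehicle in its range lies in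
one of them. Labelling the RSU by segment `k - 1` is consistent: a vehicle in segment `k` makes that
segment nonempty, so both segments have the same block. -/
theorem vblock_eq_rblock (hds : d < s / 2) {c : Conf s} {x : ℝ} {k : ℤ}
    (h : v2vReach d s c.1 x k) : c.vblock x = c.rblock k := by
  have hs0 := hs.out
  obtain ⟨hx, y, hy, hyk⟩ := h
  rw [vblock_eq_of_mem_cluster (by linarith) hy]
  have hyc := mem_capable_of_mem_cluster hx hy
  rw [abs_le] at hyk
  by_cases hlt : y < k * s
  · have : ⌊y / s⌋ = k - 1 := by
      rw [← mem_cell_iff hs0, cell]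
      push_cast
      exact ⟨by linarith, by linarith⟩
    rw [vblock, rblock, this]
  · have : ⌊y / s⌋ = k - 1 + 1 := by
      rw [← mem_cell_iff hs0, cell]
      push_cast
      exact ⟨by linarith, by linarith⟩
    have hne := not_emptyCell (b := true) hyc
    rw [this] at hne
    rw [vblock, rblock, this, block_add_one hne]

theorem finite_capable_block (c : Conf s) (b : ℤ) : {x ∈ capable c.1 | c.vblock x = b}.Finite := by
  obtain ⟨j, hbj, hj⟩ := c.2.right (b + 1)
  have hfin : (⋃ a ∈ Ico b j, c.1 ∩ cellE s a).Finite :=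
    (finite_Ico b j).biUnion fun a _ => c.2.finite a
  refine (hfin.image Prod.fst).subset ?_
  rintro x ⟨hx, hxb⟩
  refine ⟨(x, true), ?_, rfl⟩
  simp only [mem_iUnion, exists_prop]
  exact ⟨⌊x / s⌋, block_mem_Ico hxb (by omega) hj, hx, (mem_cell_iff hs.out).2 rfl⟩

theorem isBlockNetwork_v2v (hds : d < s / 2) (c : Conf s) :
    IsBlockNetwork (v2vReach d s c.1) c.vblock c.rblock where
  compat _ _ h := vblock_eq_rblock hds h
  finite_users b := (c.finite_capable_block b).subset fun _ ⟨h, _, hr⟩ => ⟨hr.1, h⟩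
  finite_stations b := c.finite_rblock b

theorem isBlockNetwork_v2i (hds : d < s / 2) (c : Conf s) :
    IsBlockNetwork (v2iReach d s c.1) c.vblock c.rblock where
  compat _ _ h := vblock_eq_rblock hds (v2vReach_of_v2iReach h)
  finite_users b := (c.finite_capable_block b).subset fun _ ⟨h, _, hr⟩ => ⟨hr.1, h⟩
  finite_stations b := c.finite_rblock b

theorem finite_cluster (hds : d < s) (c : Conf s) {x : ℝ} (hx : x ∈ capable c.1) :
    (cluster d c.1 x).Finite :=
  (c.finite_capable_block (c.vblock x)).subset fun _ hy =>
    ⟨mem_capable_of_mem_cluster hx hy, (vblock_eq_of_mem_cluster hds hy).symm⟩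

theorem exists_head (hds : d < s) (c : Conf s) {x : ℝ} (hx : x ∈ capable c.1) :
    ∃ h ∈ clusterHeads d c.1, h ∈ cluster d c.1 x := by
  obtain ⟨h, hh, hmin⟩ := (finite_cluster hds c hx).exists_minimalFor id _ ⟨x, mem_cluster_self⟩
  refine ⟨h, ⟨mem_capable_of_mem_cluster hx hh, fun y hy => ?_⟩, hh⟩
  rw [cluster_eq_of_mem hh] at hy
  rcases le_total h y with hle | hle
  · exact hle
  · exact hmin hy hle

theorem head_unique {c : Set (ℝ × Bool)} {x h h' : ℝ} (hh : h ∈ clusterHeads d c)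
    (hh' : h' ∈ clusterHeads d c) (hx : h ∈ cluster d c x) (hx' : h' ∈ cluster d c x) : h = h' := by
  refine le_antisymm (hh.2 h' ?_) (hh'.2 h ?_)
  · rwa [cluster_eq_of_mem hx]
  · rwa [cluster_eq_of_mem hx']

end Conf

/-! ### Measurability of clusters and of the reach relations -/

namespace Conf

section Measurability

/-- `y` can be reached from `x` by `n` direct links. -/
def linkSteps (d : ℝ) (c : Set (ℝ × Bool)) : ℕ → ℝ → ℝ → Prop
  | 0, x, y => x = y
  | n + 1, x, y => ∃ z ∈ capable c, linkSteps d c n x z ∧ Linked d c z y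

theorem mem_cluster_iff_linkSteps {d : ℝ} {c : Set (ℝ × Bool)} {x y : ℝ} :
    y ∈ cluster d c x ↔ ∃ n, linkSteps d c n x y := by
  constructor
  · intro h
    induction h with
    | refl => exact ⟨0, rfl⟩
    | tail _ h ih =>
      obtain ⟨n, hn⟩ := ih
      exact ⟨n + 1, _, h.1, hn, h⟩
  · rintro ⟨n, hn⟩
    induction n generalizing y with
    | zero => obtain rfl : x = y := hn; exact mem_cluster_self
    | succ n ih =>
      obtain ⟨z, _, hz, hl⟩ := hn
      exact (ih hz).tail hl

variable {s : ℝ} [hs : Fact (0 < s)] {d : ℝ} {T : Type*} [MeasurableSpace T]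

theorem measurableSet_linked (d : ℝ) {c : T → Conf s} (hc : Measurable c) {x y : T → ℝ}
    (hx : Measurable x) (hy : Measurable y) : MeasurableSet {t | Linked d (c t).1 (x t) (y t)} := by
  have : {t | Linked d (c t).1 (x t) (y t)} = {t | x t ∈ capable (c t).1} ∩
      ({t | y t ∈ capable (c t).1} ∩ ({t | |x t - y t| ≤ d} ∩
        {t | ∀ e ∈ (c t).1, e.1 ∉ Ioo (min (x t) (y t)) (max (x t) (y t))})) := by
    ext t
    simp only [Linked, mem_ofPred_eq, mem_inter_iff, Prod.forall]
  rw [this]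
  have habs : Measurable fun t => |x t - y t| := (hx.sub hy).abs
  exact (measurableSet_mem_capable hc hx).inter ((measurableSet_mem_capable hc hy).inter
    ((measurableSet_le habs measurable_const).inter
      (measurableSet_void hc (hx.min hy) (hx.max hy))))

/-- The cluster is the countable union over the number of links; each further link quantifies over
one capable vehicle, so the induction varies the parameter space. -/
theorem measurableSet_mem_cluster (d : ℝ) {c : T → Conf s} (hc : Measurable c) {x y : T → ℝ}
    (hx : Measurable x) (hy : Measurable y) :
    MeasurableSet {t | y t ∈ cluster d (c t).1 (x t)} := by
  have key : ∀ n, MeasurableSet {t | linkSteps d (c t).1 n (x t) (y t)} := by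
    intro n
    induction n generalizing T with
    | zero => exact measurableSet_eq_fun hx hy
    | succ n ih =>
      refine measurableSet_exists_capable hc (MeasurableSet.inter ?_ ?_)
      · exact ih (hc.comp measurable_fst) (hx.comp measurable_fst) measurable_snd
      · exact measurableSet_linked d (hc.comp measurable_fst) measurable_snd
          (hy.comp measurable_fst)
  simp only [mem_cluster_iff_linkSteps, ofPred_exists]
  exact MeasurableSet.iUnion key

theorem measurableSet_v2vReach (d : ℝ) {c : T → Conf s} (hc : Measurable c) {x : T → ℝ}
    (hx : Measurable x) (k : ℤ) : MeasurableSet {t | v2vReach d s (c t).1 (x t) k} := by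
  have : {t | v2vReach d s (c t).1 (x t) k} = {t | x t ∈ capable (c t).1} ∩
      {t | ∃ y ∈ capable (c t).1, y ∈ cluster d (c t).1 (x t) ∧ |y - k * s| ≤ d} := by
    ext t
    constructor
    · rintro ⟨hxc, y, hy, hyk⟩
      exact ⟨hxc, y, mem_capable_of_mem_cluster hxc hy, hy, hyk⟩
    · rintro ⟨hxc, y, _, hy, hyk⟩
      exact ⟨hxc, y, hy, hyk⟩
  rw [this]
  refine (measurableSet_mem_capable hc hx).inter (measurableSet_exists_capable hc
    (MeasurableSet.inter ?_ ?_))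
  · exact measurableSet_mem_cluster d (hc.comp measurable_fst) (hx.comp measurable_fst)
      measurable_snd
  · have : Measurable fun p : T × ℝ => |p.2 - k * s| := by fun_prop
    exact measurableSet_le this measurable_const

theorem measurableSet_v2iReach (d : ℝ) {c : T → Conf s} (hc : Measurable c) {x : T → ℝ}
    (hx : Measurable x) (k : ℤ) : MeasurableSet {t | v2iReach d s (c t).1 (x t) k} := by
  have : Measurable fun t => |x t - k * s| := (hx.sub measurable_const).abs
  exact (measurableSet_mem_capable hc hx).inter (measurableSet_le this measurable_const)

theorem measurableSet_mem_clusterHeads (d : ℝ) {c : T → Conf s} (hc : Measurable c) {x : T → ℝ}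
    (hx : Measurable x) : MeasurableSet {t | x t ∈ clusterHeads d (c t).1} := by
  have : {t | x t ∈ clusterHeads d (c t).1} = {t | x t ∈ capable (c t).1} ∩
      {t | ∃ y ∈ capable (c t).1, y ∈ cluster d (c t).1 (x t) ∧ y < x t}ᶜ := by
    ext t
    simp only [clusterHeads, mem_ofPred_eq, mem_inter_iff, mem_compl_iff, not_exists, not_and, not_lt]
    exact and_congr_right fun hxc => ⟨fun h y _ hy => h y hy, fun h y hy =>
      h y (mem_capable_of_mem_cluster hxc hy) hy⟩
  rw [this]
  refine (measurableSet_mem_capable hc hx).inter (measurableSet_exists_capable hc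
    (MeasurableSet.inter ?_ ?_)).compl
  · exact measurableSet_mem_cluster d (hc.comp measurable_fst) (hx.comp measurable_fst)
      measurable_snd
  · exact measurableSet_lt measurable_snd (hx.comp measurable_fst)

theorem tsum_indicator_one_eq_encard {α : Type*} (S A : Set α) :
    ∑' x : S, A.indicator (fun _ => (1 : ℝ≥0∞)) (x : α) = ((S ∩ A).encard : ℝ≥0∞) := by
  rw [← ENNReal.tsum_set_one, tsum_subtype S (A.indicator fun _ => (1 : ℝ≥0∞)), indicator_indicator,
    ← tsum_subtype]

theorem measurable_encard_reach {r : T → ℤ → Prop} (hr : ∀ k, MeasurableSet {t | r t k}) :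
    Measurable fun t => ({k | r t k}.encard : ℝ≥0∞) := by
  classical
  have : (fun t => ({k | r t k}.encard : ℝ≥0∞)) =
      fun t => ∑' k, {t | r t k}.indicator (fun _ => (1 : ℝ≥0∞)) t := by
    ext t
    rw [← ENNReal.tsum_set_one, tsum_subtype {k | r t k} fun _ => (1 : ℝ≥0∞)]
    rfl
  rw [this]
  exact Measurable.tsum fun k => measurable_const.indicator (hr k)

theorem measurable_clusterRSUs (d : ℝ) {c : T → Conf s} (hc : Measurable c) {x : T → ℝ}
    (hx : Measurable x) : Measurable fun t => (clusterRSUs d s (c t).1 (x t) : ℝ≥0∞) :=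
  measurable_encard_reach fun k => measurableSet_v2vReach d hc hx k

theorem measurable_encard_cluster (d : ℝ) {c : T → Conf s} (hc : Measurable c) {x : T → ℝ}
    (hx : Measurable x) :
    Measurable fun t => ((capable (c t).1 ∩ cluster d (c t).1 (x t)).encard : ℝ≥0∞) := by
  simp_rw [← tsum_indicator_one_eq_encard]
  exact measurable_tsum_capable hc (G := fun p : T × ℝ =>
    (cluster d (c p.1).1 (x p.1)).indicator (fun _ => (1 : ℝ≥0∞)) p.2)
    (measurable_const.indicator (measurableSet_mem_cluster d (hc.comp measurable_fst)
      (hx.comp measurable_fst) measurable_snd))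

/-- For capable `x` the cluster consists of capable vehicles, so its size is a sum over points of
the configuration. For other `x` the cluster is just `{x}`, which is not visible in that sum. -/
theorem measurableSet_clusterSize (d : ℝ) {c : T → Conf s} (hc : Measurable c) {x : T → ℝ}
    (hx : Measurable x) (n : ℕ) :
    MeasurableSet {t | x t ∈ capable (c t).1 ∧ clusterSize d (c t).1 (x t) = n} := by
  have : {t | x t ∈ capable (c t).1 ∧ clusterSize d (c t).1 (x t) = n} =
      {t | x t ∈ capable (c t).1} ∩
        {t | ((capable (c t).1 ∩ cluster d (c t).1 (x t)).encard : ℝ≥0∞) = n} := by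
    ext t
    refine and_congr_right fun hxc => ?_
    have : capable (c t).1 ∩ cluster d (c t).1 (x t) = cluster d (c t).1 (x t) :=
      inter_eq_right.2 fun y hy => mem_capable_of_mem_cluster hxc hy
    simp only [mem_ofPred_eq, this, clusterSize]
    rw [← ENat.toENNReal_coe, ENat.toENNReal_inj]
  rw [this]
  exact (measurableSet_mem_capable hc hx).inter
    (measurable_encard_cluster d hc hx (measurableSet_singleton _))

theorem measurableSet_lt_clusterRSUs (d : ℝ) {c : T → Conf s} (hc : Measurable c) {x : T → ℝ}
    (hx : Measurable x) (m : ℕ) :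
    MeasurableSet {t | (m : ℕ∞) < clusterRSUs d s (c t).1 (x t)} := by
  have : {t | (m : ℕ∞) < clusterRSUs d s (c t).1 (x t)} =
      {t | (m : ℝ≥0∞) < (clusterRSUs d s (c t).1 (x t) : ℝ≥0∞)} := by
    ext t
    simp only [mem_ofPred_eq]
    rw [← ENat.toENNReal_coe, ENat.toENNReal_lt]
  rw [this]
  exact measurableSet_lt measurable_const (measurable_clusterRSUs d hc hx)

theorem measurableSet_exists_tuple {n : ℕ} {c : T → Conf s} (hc : Measurable c)
    {R : T → (Fin n → ℝ) → Prop} (hR : MeasurableSet {p : T × (Fin n → ℝ) | R p.1 p.2}) :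
    MeasurableSet {t | ∃ v : Fin n → ℝ, (∀ i, v i ∈ capable (c t).1) ∧ R t v} := by
  induction n generalizing T with
  | zero =>
    have : {t | ∃ v : Fin 0 → ℝ, (∀ i, v i ∈ capable (c t).1) ∧ R t v} =
        {t | R t Fin.elim0} := by
      ext t
      constructor
      · rintro ⟨v, _, h⟩
        rwa [Subsingleton.elim v Fin.elim0] at h
      · exact fun h => ⟨Fin.elim0, fun i => i.elim0, h⟩
    rw [this]
    exact (measurable_id.prodMk measurable_const) hR
  | succ n ih =>
    have : {t | ∃ v : Fin (n + 1) → ℝ, (∀ i, v i ∈ capable (c t).1) ∧ R t v} =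
        {t | ∃ x ∈ capable (c t).1, ∃ v : Fin n → ℝ, (∀ i, v i ∈ capable (c t).1) ∧
          R t (Fin.cons x v : Fin (n + 1) → ℝ)} := by
      ext t
      constructor
      · rintro ⟨v, hv, h⟩
        refine ⟨v 0, hv 0, fun i => v i.succ, fun i => hv _, ?_⟩
        convert h using 1
        exact Fin.cons_self_tail v
      · rintro ⟨x, hx, v, hv, h⟩
        exact ⟨_, Fin.cases hx hv, h⟩
    rw [this]
    refine measurableSet_exists_capable hc ?_
    refine ih (c := fun p : T × ℝ => c p.1) (hc.comp measurable_fst)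
      (R := fun p v => R p.1 (Fin.cons p.2 v)) ?_
    have hm : Measurable fun q : (T × ℝ) × (Fin n → ℝ) =>
        (q.1.1, (Fin.cons q.1.2 q.2 : Fin (n + 1) → ℝ)) := by
      refine (measurable_fst.comp measurable_fst).prodMk (measurable_pi_lambda _ fun i => ?_)
      refine Fin.cases ?_ (fun i => ?_) i
      · exact measurable_snd.comp measurable_fst
      · exact (measurable_pi_apply i).comp measurable_snd
    exact hm hR

end Measurability

end Conf

/-! ### Measurability of the rates -/

/-- Replaces a quantifier over finite sets of vehicles by a countable union over `n` and an
`n`-tuple of vehicles, while subsets become subsets of `Fin n`. This form is accessible to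
`Conf.measurableSet_exists_tuple`. -/
theorem exists_finset_iff_tuple {α : Type*} {W : Set α} {Q : Finset α → Finset α → Prop} {i : α} :
    (∃ A : Finset α, (A : Set α) ⊆ W ∧ i ∈ A ∧ ∀ B ⊆ A, Q A B) ↔
      ∃ n, ∃ v : Fin n ↪ α, (∀ a, v a ∈ W) ∧ (∃ a, v a = i) ∧
        ∀ B : Finset (Fin n), Q (Finset.univ.map v) (B.map v) := by
  classical
  constructor
  · rintro ⟨A, hAW, hi, hA⟩
    let e : Fin A.card ≃ A := A.equivFin.symm
    let v : Fin A.card ↪ α := e.toEmbedding.trans (Function.Embedding.subtype _)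
    have hv : Finset.univ.map v = A := by
      ext a
      simp only [Finset.mem_map, Finset.mem_univ, true_and]
      constructor
      · rintro ⟨b, rfl⟩
        exact (e b).2
      · intro ha
        exact ⟨e.symm ⟨a, ha⟩, by simp [v]⟩
    refine ⟨A.card, v, fun a => hAW (e a).2, ⟨e.symm ⟨i, hi⟩, by simp [v]⟩, fun B => ?_⟩
    rw [hv]
    refine hA _ ?_
    conv_rhs => rw [← hv]
    exact Finset.map_subset_map.2 (Finset.subset_univ _)
  · rintro ⟨n, v, hvW, ⟨a, rfl⟩, hB⟩
    refine ⟨Finset.univ.map v, ?_, by simp, fun B hBA => ?_⟩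
    · intro b hb
      obtain ⟨a, _, rfl⟩ := Finset.mem_map.1 (Finset.mem_coe.1 hb)
      exact hvW a
    · have : B = (Finset.univ.filter fun a => v a ∈ B).map v := by
        ext b
        simp only [Finset.mem_map, Finset.mem_filter, Finset.mem_univ, true_and]
        constructor
        · intro hb
          obtain ⟨a, _, rfl⟩ := Finset.mem_map.1 (hBA hb)
          exact ⟨a, hb, rfl⟩
        · rintro ⟨a, ha, rfl⟩
          exact ha
      rw [this]
      exact hB _

namespace Conf

variable {s : ℝ} [hs : Fact (0 < s)] {d : ℝ}

/-- Measurability of the balanced rates in a measurable random block network of vehicles. -/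
theorem measurable_balanced_rate {r : Set (ℝ × Bool) → ℝ → ℤ → Prop} {ρ : ℝ≥0}
    (hcap : ∀ c x k, r c x k → x ∈ capable c)
    (hr : ∀ k, MeasurableSet {p : Conf s × ℝ | r p.1.1 p.2 k})
    (hnet : ∀ c : Conf s, IsBlockNetwork (r c.1) c.vblock c.rblock) :
    Measurable fun p : Conf s × ℝ => maxMinRate (r p.1.1) ρ p.2 := by
  classical
  have hC : MeasurableSet {p : Conf s × ℝ | p.2 ∈ capable p.1.1} :=
    measurableSet_mem_capable measurable_fst measurable_snd
  refine measurable_of_Iic fun t => ?_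
  -- The group of users is sought among all capable vehicles, so the block that guarantees
  -- finiteness no longer appears in the description of the sublevel set.
  have e : (fun p : Conf s × ℝ => maxMinRate (r p.1.1) ρ p.2) ⁻¹' Iic t =
      {p | p.2 ∈ capable p.1.1}ᶜ ∪ ({p | p.2 ∈ capable p.1.1} ∩ ⋃ n, {p : Conf s × ℝ |
        ∃ v : Fin n → ℝ, (∀ a, v a ∈ capable p.1.1) ∧ (Function.Injective v ∧ (∃ a, v a = p.2) ∧
          ∀ B : Finset (Fin n), (ρ : ℝ≥0∞) *
            ({k | (∃ a, r p.1.1 (v a) k) ∧ ∀ b ∈ B, ¬ r p.1.1 (v b) k}.encard : ℝ≥0∞) ≤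
            t * ((n - B.card : ℕ) : ℝ≥0∞))}) := by
    ext ⟨c, x⟩
    obtain ⟨y, hy⟩ := (hnet c).exists_balanced_maxMinRate ρ
    simp only [mem_preimage, mem_Iic, mem_union, mem_compl_iff, mem_inter_iff, mem_iUnion,
      mem_ofPred_eq]
    by_cases hx : x ∈ capable c.1
    · simp only [hx, not_true_eq_false, true_and, false_or]
      rw [hy.rate_le_iff (c.finite_capable_block (c.vblock x)) ⟨hx, rfl⟩
        (fun a ha k hak b hbk => ⟨hcap _ _ _ hbk,
          ((hnet c).compat b k hbk).trans (((hnet c).compat a k hak).symm.trans ha.2)⟩)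
        (W := capable c.1) (fun a ha => ha.1) t, exists_finset_iff_tuple
          (Q := fun A B => (ρ : ℝ≥0∞) *
            ({k | (∃ a ∈ A, r c.1 a k) ∧ ∀ b ∈ B, ¬ r c.1 b k}.encard : ℝ≥0∞) ≤
            t * ((A.card - B.card : ℕ) : ℝ≥0∞))]
      refine exists_congr fun n => ?_
      constructor
      · rintro ⟨v, h1, h2, h3⟩
        exact ⟨v, h1, v.injective, h2, fun B => by simpa using h3 B⟩
      · rintro ⟨v, h1, hv, h2, h3⟩
        exact ⟨⟨v, hv⟩, h1, h2, fun B => by simpa using h3 B⟩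
    · have h0 : maxMinRate (r c.1) ρ x = 0 := hy.rate_eq_zero fun k hk => hx (hcap _ _ _ hk)
      simp [h0, hx]
  rw [e]
  refine hC.compl.union (hC.inter (MeasurableSet.iUnion fun n => ?_))
  refine measurableSet_exists_tuple (T := Conf s × ℝ) measurable_fst (MeasurableSet.inter ?_ (MeasurableSet.inter ?_ ?_))
  · have : {p : (Conf s × ℝ) × (Fin n → ℝ) | Function.Injective p.2} =
        ⋂ i, ⋂ j, ⋂ (_ : i ≠ j), {p | p.2 i = p.2 j}ᶜ := by
      ext p
      simp only [mem_ofPred_eq, mem_iInter, mem_compl_iff]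
      exact ⟨fun h i j hij he => hij (h he), fun h i j he => by_contra fun hij => h i j hij he⟩
    change MeasurableSet {p : (Conf s × ℝ) × (Fin n → ℝ) | Function.Injective p.2}
    rw [this]
    refine MeasurableSet.iInter fun i => MeasurableSet.iInter fun j => MeasurableSet.iInter fun _ => ?_
    exact (measurableSet_eq_fun ((measurable_pi_apply i).comp measurable_snd)
      ((measurable_pi_apply j).comp measurable_snd)).compl
  · change MeasurableSet {p : (Conf s × ℝ) × (Fin n → ℝ) | ∃ a, p.2 a = p.1.2}
    simp only [ofPred_exists]
    exact MeasurableSet.iUnion fun a => measurableSet_eq_fun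
      ((measurable_pi_apply a).comp measurable_snd) (measurable_snd.comp measurable_fst)
  · change MeasurableSet {p : (Conf s × ℝ) × (Fin n → ℝ) | ∀ B : Finset (Fin n), (ρ : ℝ≥0∞) *
      ({k | (∃ a, r p.1.1.1 (p.2 a) k) ∧ ∀ b ∈ B, ¬ r p.1.1.1 (p.2 b) k}.encard : ℝ≥0∞) ≤
            t * ((n - B.card : ℕ) : ℝ≥0∞)}
    have hrv : ∀ a k, MeasurableSet {p : (Conf s × ℝ) × (Fin n → ℝ) | r p.1.1.1 (p.2 a) k} := by
      intro a k
      have hm : Measurable fun p : (Conf s × ℝ) × (Fin n → ℝ) => (p.1.1, p.2 a) :=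
        (measurable_fst.comp measurable_fst).prodMk ((measurable_pi_apply a).comp measurable_snd)
      exact hm (hr k)
    simp only [ofPred_forall]
    refine MeasurableSet.iInter fun B => measurableSet_le (Measurable.const_mul ?_ _) measurable_const
    refine measurable_encard_reach fun k => MeasurableSet.inter ?_ ?_
    · change MeasurableSet {p : (Conf s × ℝ) × (Fin n → ℝ) | ∃ a, r p.1.1.1 (p.2 a) k}
      simp only [ofPred_exists]
      exact MeasurableSet.iUnion fun a => hrv a k
    · change MeasurableSet {p : (Conf s × ℝ) × (Fin n → ℝ) | ∀ b ∈ B, ¬ r p.1.1.1 (p.2 b) k}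
      simp only [ofPred_forall]
      exact MeasurableSet.iInter fun b => MeasurableSet.iInter fun _ => (hrv b k).compl

theorem measurable_rateV2V (hds : d < s / 2) (ρ : ℝ≥0) :
    Measurable fun p : Conf s × ℝ => maxMinRate (v2vReach d s p.1.1) ρ p.2 :=
  measurable_balanced_rate (r := v2vReach d s) (fun _ _ _ h => h.1)
    (fun k => measurableSet_v2vReach d measurable_fst measurable_snd k) (isBlockNetwork_v2v hds)

theorem measurable_rateV2I (hds : d < s / 2) (ρ : ℝ≥0) :
    Measurable fun p : Conf s × ℝ => maxMinRate (v2iReach d s p.1.1) ρ p.2 :=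
  measurable_balanced_rate (r := v2iReach d s) (fun _ _ _ h => h.1)
    (fun k => measurableSet_v2iReach d measurable_fst measurable_snd k) (isBlockNetwork_v2i hds)

end Conf

/-! ### Invariance under shifts by a period -/

theorem IsBalanced.comap_equiv {ι κ ι' κ' : Type*} {reach : ι → κ → Prop} {reach' : ι' → κ' → Prop}
    {ρ : ℝ≥0} {y : ι → κ → ℝ≥0} {x : ι → ℝ≥0} (hb : IsBalanced reach ρ y x) (e : ι' ≃ ι) (f : κ' ≃ κ)
    (h : ∀ i k, reach' i k ↔ reach (e i) (f k)) :
    IsBalanced reach' ρ (fun i k => y (e i) (f k)) fun i => x (e i) where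
  supp i k hik := (h i k).2 (hb.supp _ _ hik)
  full i k hik := by
    rw [← hb.full _ _ ((h i k).1 hik)]
    exact e.tsum_eq fun j => (y j (f k) : ℝ≥0∞)
  fair i j k hik hjk := hb.fair _ _ _ hik ((h j k).1 hjk)
  rate i := by
    rw [← hb.rate (e i)]
    exact f.tsum_eq fun k => (y (e i) k : ℝ≥0∞)

/-- Relabelling users and stations preserves balanced splits, and uniqueness identifies the rates.
This gives the periodicity of the rates. -/
theorem IsBlockNetwork.maxMinRate_comap_equiv {ι κ ι' κ' β β' : Type*} {reach : ι → κ → Prop}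
    {reach' : ι' → κ' → Prop} {bi : ι → β} {bk : κ → β} {bi' : ι' → β'} {bk' : κ' → β'}
    (hn : IsBlockNetwork reach bi bk) (hn' : IsBlockNetwork reach' bi' bk') (ρ : ℝ≥0)
    (e : ι' ≃ ι) (f : κ' ≃ κ) (h : ∀ i k, reach' i k ↔ reach (e i) (f k)) (i : ι') :
    maxMinRate reach' ρ i = maxMinRate reach ρ (e i) := by
  obtain ⟨y, hy⟩ := hn.exists_balanced_maxMinRate ρ
  obtain ⟨y', hy'⟩ := hn'.exists_balanced_maxMinRate ρ
  exact congrFun (hn'.isMaxMinFair_unique (hn'.isMaxMinFair hy')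
    (hn'.isMaxMinFair (hy.comap_equiv e f h))) i

theorem encard_preimage_equiv {α β : Type*} (e : α ≃ β) (S : Set β) : (e ⁻¹' S).encard = S.encard := by
  rw [← e.injective.encard_image, Equiv.image_preimage]

namespace Conf

variable {s d : ℝ} {k : ℤ} {c : Conf s} {x y : ℝ}

theorem linked_shift :
    Linked d (shift k c).1 x y ↔ Linked d c.1 (x + k * s) (y + k * s) := by
  unfold Linked
  rw [mem_capable_shift, mem_capable_shift, add_sub_add_right_eq_sub]
  refine and_congr_right fun _ => and_congr_right fun _ => and_congr_right fun _ => ?_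
  rw [min_add_add_right, max_add_add_right]
  constructor
  · intro h z b hz hm
    refine h (z - k * s) b ?_ ⟨by linarith [hm.1], by linarith [hm.2]⟩
    simpa [mem_shift] using hz
  · intro h z b hz hm
    exact h (z + k * s) b hz ⟨by linarith [hm.1], by linarith [hm.2]⟩

theorem mem_cluster_shift :
    y ∈ cluster d (shift k c).1 x ↔ y + k * s ∈ cluster d c.1 (x + k * s) := by
  constructor
  · exact fun h => Relation.ReflTransGen.lift (fun z => z + k * s) (fun _ _ h => linked_shift.1 h) _ _ h
  · intro h
    have := Relation.ReflTransGen.lift (p := Linked d (shift k c).1) (fun z => z - k * s)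
      (fun a b h => linked_shift.2 (by simpa using h)) _ _ h
    simpa [cluster, Function.onFun] using this

theorem v2vReach_shift {j : ℤ} :
    v2vReach d s (shift k c).1 x j ↔ v2vReach d s c.1 (x + k * s) (j + k) := by
  unfold v2vReach
  rw [mem_capable_shift]
  refine and_congr_right fun _ => ?_
  push_cast
  constructor
  · rintro ⟨y, hy, h⟩
    refine ⟨y + k * s, mem_cluster_shift.1 hy, ?_⟩
    rwa [show y + k * s - (j + k) * s = y - j * s by ring]
  · rintro ⟨y, hy, h⟩
    refine ⟨y - k * s, mem_cluster_shift.2 (by simpa using hy), ?_⟩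
    rwa [show y - k * s - j * s = y - (j + k) * s by ring]

theorem v2iReach_shift {j : ℤ} :
    v2iReach d s (shift k c).1 x j ↔ v2iReach d s c.1 (x + k * s) (j + k) := by
  unfold v2iReach
  rw [mem_capable_shift]
  push_cast
  rw [show x + k * s - (j + k) * s = x - j * s by ring]

theorem mem_clusterHeads_shift :
    x ∈ clusterHeads d (shift k c).1 ↔ x + k * s ∈ clusterHeads d c.1 := by
  refine and_congr Iff.rfl ⟨fun h y hy => ?_, fun h y hy => ?_⟩
  · have := h (y - k * s) (mem_cluster_shift.2 (by simpa using hy))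
    linarith
  · have := h _ (mem_cluster_shift.1 hy)
    linarith

theorem clusterSize_shift :
    clusterSize d (shift k c).1 x = clusterSize d c.1 (x + k * s) := by
  unfold clusterSize
  rw [← encard_preimage_equiv (Equiv.addRight ((k : ℝ) * s)) (cluster d c.1 (x + k * s))]
  congr 1
  ext y
  exact mem_cluster_shift

theorem clusterRSUs_shift :
    clusterRSUs d s (shift k c).1 x = clusterRSUs d s c.1 (x + k * s) := by
  unfold clusterRSUs
  rw [← encard_preimage_equiv (Equiv.addRight k) {j | v2vReach d s c.1 (x + k * s) j}]
  congr 1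
  ext j
  exact v2vReach_shift

theorem fwd_shift {n : ℕ} : fwd d n (shift k c).1 x ↔ fwd d n c.1 (x + k * s) := by
  have hsucc : ∀ {x y}, Succ d (shift k c).1 x y ↔ Succ d c.1 (x + k * s) (y + k * s) := by
    intro x y
    refine and_congr Iff.rfl (and_congr (by simp) (and_congr ?_ ⟨fun h e he hm => ?_, fun h e he hm => ?_⟩))
    · constructor <;> intro h <;> linarith
    · refine h (e.1 - k * s, e.2) ?_ ⟨by linarith [hm.1], by linarith [hm.2]⟩
      simpa [mem_shift] using he
    · exact h (e.1 + k * s, e.2) he ⟨by linarith [hm.1], by linarith [hm.2]⟩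
  induction n generalizing x with
  | zero => rfl
  | succ n ih =>
    constructor
    · rintro ⟨y, hy, h⟩
      exact ⟨y + k * s, hsucc.1 hy, ih.1 h⟩
    · rintro ⟨y, hy, h⟩
      exact ⟨y - k * s, hsucc.2 (by simpa using hy), ih.2 (by simpa using h)⟩

theorem emptyCell_shift {a : ℤ} : EmptyCell s (shift k c).1 a ↔ EmptyCell s c.1 (a + k) := by
  simp only [EmptyCell, eq_empty_iff_forall_notMem, mem_inter_iff, not_and, cellE, cell,
    mem_preimage, mem_Ico]
  push_cast
  constructor
  · intro h e he hm hm'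
    refine h (e.1 - k * s, e.2) (by simpa [mem_shift] using he) ?_ ?_ <;> dsimp only <;> linarith
  · intro h e he hm hm'
    refine h (e.1 + k * s, e.2) he ?_ ?_ <;> dsimp only <;> linarith

theorem block_shift (k : ℤ) (c : Conf s) (a : ℤ) : (shift k c).block a = c.block (a + k) - k := by
  rw [block_eq_iff]
  refine ⟨?_, ?_, fun j h1 h2 => ?_⟩
  · have := c.block_le (a + k)
    omega
  · rw [emptyCell_shift, sub_add_cancel]
    exact c.emptyCell_block _
  · rw [emptyCell_shift]
    exact (block_eq_iff.1 (rfl : c.block (a + k) = c.block (a + k))).2.2 (j + k) (by omega) (by omega)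

section

variable [hs : Fact (0 < s)]

theorem rateV2V_shift (hds : d < s / 2) (ρ : ℝ≥0) (k : ℤ) (c : Conf s) (x : ℝ) :
    maxMinRate (v2vReach d s (shift k c).1) ρ x = maxMinRate (v2vReach d s c.1) ρ (x + k * s) :=
  (isBlockNetwork_v2v hds c).maxMinRate_comap_equiv (isBlockNetwork_v2v hds (shift k c)) ρ
    (Equiv.addRight ((k : ℝ) * s)) (Equiv.addRight k) (fun _ _ => v2vReach_shift) x

theorem rateV2I_shift (hds : d < s / 2) (ρ : ℝ≥0) (k : ℤ) (c : Conf s) (x : ℝ) :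
    maxMinRate (v2iReach d s (shift k c).1) ρ x = maxMinRate (v2iReach d s c.1) ρ (x + k * s) :=
  (isBlockNetwork_v2i hds c).maxMinRate_comap_equiv (isBlockNetwork_v2i hds (shift k c)) ρ
    (Equiv.addRight ((k : ℝ) * s)) (Equiv.addRight k) (fun _ _ => v2iReach_shift) x

end

theorem tsum_capable_shift (k : ℤ) (c : Conf s) (g : ℝ → ℝ≥0∞) :
    ∑' x : capable (shift k c).1, g x = ∑' x : capable c.1, g (x - k * s) := by
  rw [tsum_subtype (capable (shift k c).1), tsum_subtype (capable c.1) fun x => g (x - k * s),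
    ← (Equiv.addRight ((k : ℝ) * s)).tsum_eq
      ((capable c.1).indicator fun x => g (x - k * s))]
  refine tsum_congr fun x => ?_
  by_cases hx : x ∈ capable (shift k c).1
  · have hx' : x + k * s ∈ capable c.1 := hx
    simp [hx, hx']
  · have hx' : x + k * s ∉ capable c.1 := hx
    simp [hx, hx']

end Conf

/-! ### Averages over one period and over blocks -/

/-- A functional of a configuration and a position that does not depend on the choice of the
period. -/
def IsPeriodic {s : ℝ} (G : Conf s × ℝ → ℝ≥0∞) : Prop :=
  ∀ k c x, G (Conf.shift k c, x) = G (c, x + k * s)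

/-- Expected total of `G` over the capable vehicles in one period. -/
def periodSum {s : ℝ} (μ : Measure (Conf s)) (G : Conf s × ℝ → ℝ≥0∞) : ℝ≥0∞ :=
  ∫⁻ c, ∑' x : capable c.1, (cell s 0).indicator (fun x => G (c, x)) x ∂μ

/-- Total of `G` over the capable vehicles in a block. -/
def blockSum {s : ℝ} (G : Conf s × ℝ → ℝ≥0∞) (c : Conf s) (b : ℤ) : ℝ≥0∞ :=
  ∑' x : {x ∈ capable c.1 | c.vblock x = b}, G (c, x)

namespace Conf

variable {s : ℝ}

theorem measurableSet_emptyCell (k : ℤ) : MeasurableSet {c : Conf s | EmptyCell s c.1 k} := by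
  have hl : Local s (cellE s k) := local_of_subset_cellE subset_rfl
  have : {c : Conf s | EmptyCell s c.1 k} = num (cellE s k) ⁻¹' {0} := by
    ext c
    simp only [mem_ofPred_eq, EmptyCell, mem_preimage, mem_singleton_iff, num]
    rw [ncard_eq_zero (c.2.finite_inter hl)]
  rw [this]
  exact measurable_num (measurableSet_cellE s k) hl (measurableSet_singleton 0)

theorem measurable_block (a : ℤ) : Measurable fun c : Conf s => c.block a := by
  refine measurable_to_countable' fun b => ?_
  have : (fun c : Conf s => c.block a) ⁻¹' {b} = {c | b ≤ a ∧ EmptyCell s c.1 b ∧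
      ∀ j, b < j → j ≤ a → ¬ EmptyCell s c.1 j} := by
    ext c
    exact block_eq_iff
  rw [this]
  simp only [ofPred_and, ofPred_forall]
  refine (MeasurableSet.const _).inter ((measurableSet_emptyCell b).inter ?_)
  refine MeasurableSet.iInter fun j => MeasurableSet.iInter fun _ => MeasurableSet.iInter fun _ => ?_
  exact (measurableSet_emptyCell j).compl

end Conf

namespace IsPoissonLaw

variable {s lam γ : ℝ} {μ : Measure (Conf s)} [hs : Fact (0 < s)]

/-- Averages over one period agree with averages over the block that starts at the origin. -/
theorem periodSum_eq (h : IsPoissonLaw lam γ μ) {G : Conf s × ℝ → ℝ≥0∞} (hG : Measurable G)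
    (hp : IsPeriodic G) : periodSum μ G = ∫⁻ c, blockSum G c 0 ∂μ := by
  classical
  -- A mass transport argument: `F b` collects the vehicles of segment `0` whose block is `b`, and
  -- `J a` the vehicles of segment `a` whose block is `0`. Shifting by `b` carries `F b` to `J
  -- (-b)`; summing over all integers gives the two sides.
  let J : ℤ → Conf s → ℝ≥0∞ := fun a c => ∑' x : capable c.1,
    if (x : ℝ) ∈ cell s a ∧ c.block a = 0 then G (c, x) else 0
  let F : ℤ → Conf s → ℝ≥0∞ := fun b c => ∑' x : capable c.1,
    if (x : ℝ) ∈ cell s 0 ∧ c.block 0 = b then G (c, x) else 0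
  have hmeas : ∀ a a' b, Measurable fun c : Conf s => ∑' x : capable c.1,
      if (x : ℝ) ∈ cell s a ∧ c.block a' = b then G (c, x) else 0 := by
    intro a a' b
    refine Conf.measurable_tsum_capable (T := Conf s) measurable_id
      (G := fun p => if p.2 ∈ cell s a ∧ p.1.block a' = b then G p else 0)
      (Measurable.ite ?_ hG measurable_const)
    exact (measurable_snd (measurableSet_cell s a)).inter
      (((Conf.measurable_block a').comp measurable_fst) (measurableSet_singleton b))
  have hJm : ∀ a, Measurable (J a) := fun a => hmeas a a 0
  have hFJ : ∀ b c, F b c = J (-b) (Conf.shift b c) := by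
    intro b c
    simp only [F, J]
    rw [Conf.tsum_capable_shift b c
      (fun x => if x ∈ cell s (-b) ∧ (Conf.shift b c).block (-b) = 0 then G (Conf.shift b c, x) else 0)]
    refine tsum_congr fun x => ?_
    have h1 : (x : ℝ) - b * s ∈ cell s (-b) ↔ (x : ℝ) ∈ cell s 0 := by
      simp only [cell, mem_Ico]
      push_cast
      constructor <;> rintro ⟨h1, h2⟩ <;> constructor <;> linarith
    have h2 : (Conf.shift b c).block (-b) = 0 ↔ c.block 0 = b := by
      rw [Conf.block_shift, neg_add_cancel, sub_eq_zero]
    simp only [h1, h2, hp b c, sub_add_cancel]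
  have e1 : ∀ c : Conf s, ∑' x : capable c.1, (cell s 0).indicator (fun x => G (c, x)) x =
      ∑' b, F b c := by
    intro c
    simp only [F]
    rw [ENNReal.tsum_comm]
    refine tsum_congr fun x => ?_
    rw [tsum_eq_single (c.block 0)]
    · simp [indicator]
    · intro b hb
      simp [hb.symm]
  have e2 : ∀ c : Conf s, blockSum G c 0 = ∑' a, J a c := by
    intro c
    simp only [J]
    rw [ENNReal.tsum_comm, blockSum, tsum_subtype {x ∈ capable c.1 | c.vblock x = 0} fun x => G (c, x),
      tsum_subtype (capable c.1)
        fun x => ∑' a, if x ∈ cell s a ∧ c.block a = 0 then G (c, x) else 0]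
    refine tsum_congr fun x => ?_
    by_cases hx : x ∈ capable c.1
    · rw [indicator_of_mem hx, tsum_eq_single ⌊x / s⌋]
      · have : x ∈ cell s ⌊x / s⌋ := (mem_cell_iff hs.out).2 rfl
        simp [indicator, hx, this, Conf.vblock]
      · intro a ha
        rw [if_neg]
        rintro ⟨hxa, -⟩
        exact ha ((mem_cell_iff hs.out).1 hxa).symm
    · rw [indicator_of_notMem hx, indicator_of_notMem fun hx' => hx hx'.1]
  unfold periodSum
  simp_rw [e1, e2]
  rw [lintegral_tsum fun b => (hmeas 0 0 b).aemeasurable, lintegral_tsum fun a => (hJm a).aemeasurable]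
  calc ∑' b, ∫⁻ c, F b c ∂μ = ∑' b : ℤ, ∫⁻ c, J (-b) c ∂μ := by
        refine tsum_congr fun b => ?_
        simp_rw [hFJ]
        exact h.lintegral_shift b (hJm (-b))
    _ = _ := (Equiv.neg ℤ).tsum_eq fun a => ∫⁻ c, J a c ∂μ

theorem periodSum_le (h : IsPoissonLaw lam γ μ) {G G' : Conf s × ℝ → ℝ≥0∞} (hG : Measurable G)
    (hG' : Measurable G') (hp : IsPeriodic G) (hp' : IsPeriodic G')
    (hle : ∀ c, blockSum G c 0 ≤ blockSum G' c 0) : periodSum μ G ≤ periodSum μ G' := by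
  rw [h.periodSum_eq hG hp, h.periodSum_eq hG' hp']
  exact lintegral_mono hle

theorem periodSum_congr (h : IsPoissonLaw lam γ μ) {G G' : Conf s × ℝ → ℝ≥0∞} (hG : Measurable G)
    (hG' : Measurable G') (hp : IsPeriodic G) (hp' : IsPeriodic G')
    (he : ∀ c, blockSum G c 0 = blockSum G' c 0) : periodSum μ G = periodSum μ G' :=
  le_antisymm (h.periodSum_le hG hG' hp hp' fun c => (he c).le)
    (h.periodSum_le hG' hG hp' hp fun c => (he c).ge)

end IsPoissonLaw

/-! ### Identities on a block -/

namespace Conf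

variable {s d : ℝ}

theorem v2iReach_unique (hds : d < s / 2) {c : Set (ℝ × Bool)} {x : ℝ} {j k : ℤ}
    (hj : v2iReach d s c x j) (hk : v2iReach d s c x k) : j = k := by
  have h1 := abs_le.1 hj.2
  have h2 := abs_le.1 hk.2
  by_contra hne
  rcases lt_or_gt_of_ne hne with h | h
  · have h' : ((j + 1 : ℤ) : ℝ) ≤ k := by exact_mod_cast h
    push_cast at h'
    nlinarith
  · have h' : ((k + 1 : ℤ) : ℝ) ≤ j := by exact_mod_cast h
    push_cast at h'
    nlinarith

theorem blockSum_indicator (A : Set (Conf s × ℝ)) (c : Conf s) (b : ℤ) :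
    blockSum (A.indicator fun _ => 1) c b =
      (({x ∈ capable c.1 | c.vblock x = b} ∩ {x | (c, x) ∈ A}).encard : ℝ≥0∞) := by
  rw [← tsum_indicator_one_eq_encard]
  rfl

variable [hs : Fact (0 < s)]

/-- Passing to the next vehicle matches the vehicles that start a chain with those that continue
one. -/
theorem blockSum_fwd_succ (hds : d < s) (n : ℕ) (c : Conf s) (b : ℤ) :
    blockSum ({p : Conf s × ℝ | fwd d (n + 1) p.1.1 p.2}.indicator fun _ => 1) c b =
      blockSum ({p : Conf s × ℝ | p.2 ∉ clusterHeads d p.1.1 ∧ fwd d n p.1.1 p.2}.indicator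
        fun _ => 1) c b := by
  classical
  rw [blockSum_indicator, blockSum_indicator]
  congr 1
  -- The successor map. It is injective on the vehicles that start a chain, and its image consists
  -- of vehicles with a predecessor in their cluster, that is, those that are not first. The default
  -- value `0` plays no role there.
  let f : ℝ → ℝ := fun x => if h : ∃ y, Succ d c.1 x y then h.choose else 0
  have hf : ∀ {x y}, Succ d c.1 x y → f x = y := by
    intro x y h
    have hx : ∃ y, Succ d c.1 x y := ⟨y, h⟩
    simp only [f, dif_pos hx]
    exact hx.choose_spec.unique h
  have hinj : InjOn f ({x ∈ capable c.1 | c.vblock x = b} ∩ {x | fwd d (n + 1) c.1 x}) := by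
    rintro x ⟨⟨hx, -⟩, y, hxy, -⟩ x' ⟨⟨hx', -⟩, y', hxy', -⟩ he
    rw [hf hxy, hf hxy'] at he
    subst he
    exact hxy.pred_unique hx hx' hxy'
  change ({x ∈ capable c.1 | c.vblock x = b} ∩ {x | fwd d (n + 1) c.1 x}).encard = _
  rw [← hinj.encard_image]
  congr 1
  ext y
  constructor
  · rintro ⟨x, ⟨⟨hx, hxb⟩, y', hxy, hy⟩, rfl⟩
    rw [hf hxy]
    refine ⟨⟨hxy.1, ?_⟩, fun hh => ?_, hy⟩
    · rw [← hxb, vblock_eq_of_mem_cluster hds (hxy.mem_cluster hx)]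
    · exact absurd (hh.2 x (mem_cluster_symm (hxy.mem_cluster hx))) (not_le.2 hxy.2.1)
  · rintro ⟨⟨hy, hyb⟩, hh, hfy⟩
    have : ∃ z ∈ cluster d c.1 y, z < y := by
      by_contra! hcon
      exact hh ⟨hy, hcon⟩
    obtain ⟨z, hz, hzy⟩ := this
    obtain ⟨x, hx, hxy, -⟩ := exists_pred hy hz hzy
    refine ⟨x, ⟨⟨hx, ?_⟩, y, hxy, hfy⟩, hf hxy⟩
    rw [← hyb, vblock_eq_of_mem_cluster hds (hxy.mem_cluster hx)]

/-- Counting the vehicles of the clusters of size `n` through the first vehicles. -/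
theorem encard_eq_mul_encard_heads (hds : d < s) (c : Conf s) (b : ℤ) (n : ℕ) {Q : ℝ → Prop}
    (hQ : ∀ x ∈ capable c.1, ∀ y ∈ cluster d c.1 x, Q x → Q y)
    (hn : ∀ x ∈ capable c.1, Q x → clusterSize d c.1 x = n) :
    (({x ∈ capable c.1 | c.vblock x = b} ∩ {x | Q x}).encard : ℝ≥0∞) =
      n * (({x ∈ capable c.1 | c.vblock x = b} ∩ {x | x ∈ clusterHeads d c.1 ∧ Q x}).encard : ℝ≥0∞) := by
  classical
  set S := {x ∈ capable c.1 | c.vblock x = b} with hS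
  rw [← tsum_indicator_one_eq_encard, ← tsum_indicator_one_eq_encard, ← ENNReal.tsum_mul_left]
  -- Double counting of pairs of a vehicle and the first vehicle of its cluster: each vehicle has
  -- one such partner in the same block, and each first vehicle with `Q` has `n`.
  calc ∑' x : S, {x | Q x}.indicator (fun _ => (1 : ℝ≥0∞)) (x : ℝ)
      = ∑' x : S, ∑' h : S, if (h : ℝ) ∈ clusterHeads d c.1 ∧ (h : ℝ) ∈ cluster d c.1 x ∧ Q x
          then (1 : ℝ≥0∞) else 0 := by
        refine tsum_congr fun x => ?_
        obtain ⟨h, hh, hx⟩ := exists_head hds c x.2.1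
        have hhS : h ∈ S := ⟨hh.1, by rw [← vblock_eq_of_mem_cluster hds hx]; exact x.2.2⟩
        rw [tsum_eq_single (⟨h, hhS⟩ : S)]
        · simp [indicator, hh, hx]
        · rintro ⟨h', hh'S⟩ hne
          refine if_neg fun hcon => hne (Subtype.ext ?_)
          exact head_unique hcon.1 hh hcon.2.1 hx
    _ = ∑' h : S, ∑' x : S, if (h : ℝ) ∈ clusterHeads d c.1 ∧ (h : ℝ) ∈ cluster d c.1 x ∧ Q x
          then (1 : ℝ≥0∞) else 0 := ENNReal.tsum_comm
    _ = _ := by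
        refine tsum_congr fun h => ?_
        by_cases hh : (h : ℝ) ∈ clusterHeads d c.1 ∧ Q h
        · have e : ∀ x : S, (if (h : ℝ) ∈ clusterHeads d c.1 ∧ (h : ℝ) ∈ cluster d c.1 x ∧ Q x
              then (1 : ℝ≥0∞) else 0) = (cluster d c.1 h).indicator (fun _ => (1 : ℝ≥0∞)) (x : ℝ) := by
            intro x
            rw [indicator_apply]
            refine if_congr ⟨fun H => mem_cluster_symm H.2.1, fun H => ⟨hh.1, mem_cluster_symm H, ?_⟩⟩ rfl rfl
            exact hQ h h.2.1 x H hh.2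
          rw [tsum_congr e, tsum_indicator_one_eq_encard, inter_eq_right.2]
          · rw [indicator_of_mem (show (h : ℝ) ∈ {x | x ∈ clusterHeads d c.1 ∧ Q x} from hh), mul_one]
            have := hn h h.2.1 hh.2
            rw [clusterSize] at this
            rw [this, ENat.toENNReal_coe]
          · intro x hx
            refine ⟨mem_capable_of_mem_cluster h.2.1 hx, ?_⟩
            rw [← vblock_eq_of_mem_cluster hds hx]
            exact h.2.2
        · rw [indicator_of_notMem (show (h : ℝ) ∉ {x | x ∈ clusterHeads d c.1 ∧ Q x} from hh), mul_zero]
          refine ENNReal.tsum_eq_zero.2 fun x => if_neg fun H => hh ⟨H.1, ?_⟩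
          exact hQ x x.2.1 h H.2.1 H.2.2

theorem blockSum_eq_sum (g : Conf s × ℝ → ℝ) (hg : ∀ p, 0 ≤ g p) (c : Conf s) (b : ℤ) :
    blockSum (fun p => ENNReal.ofReal (g p)) c b =
      ENNReal.ofReal (∑ x ∈ (finite_capable_block c b).toFinset, g (c, x)) := by
  rw [ENNReal.ofReal_sum_of_nonneg fun x _ => hg (c, x), blockSum,
    tsum_subtype {x ∈ capable c.1 | c.vblock x = b} fun x => ENNReal.ofReal (g (c, x)),
    tsum_eq_sum (s := (finite_capable_block c b).toFinset)]
  · refine Finset.sum_congr rfl fun x hx => ?_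
    rw [Finite.mem_toFinset] at hx
    exact indicator_of_mem hx _
  · intro x hx
    rw [Finite.mem_toFinset] at hx
    exact indicator_of_notMem hx _

/-- Relaying does not increase the total convex cost of the rates on a block. -/
theorem sum_convex_rate_le (hds : d < s / 2) (ρ : ℝ≥0) (c : Conf s) (b : ℤ) {f : ℝ → ℝ}
    (hf : ConvexOn ℝ univ f) :
    ∑ x ∈ (finite_capable_block c b).toFinset, f (maxMinRate (v2vReach d s c.1) ρ x) ≤
      ∑ x ∈ (finite_capable_block c b).toFinset, f (maxMinRate (v2iReach d s c.1) ρ x) := by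
  obtain ⟨y, hy⟩ := (isBlockNetwork_v2v hds c).exists_balanced_maxMinRate ρ
  obtain ⟨y', hy'⟩ := (isBlockNetwork_v2i hds c).exists_balanced_maxMinRate ρ
  -- The V2I split competes in the V2V+V2I network: it uses fewer connections, and it exhausts each
  -- station reached by a cluster because some vehicle of the cluster is itself in range.
  refine (isBlockNetwork_v2v hds c).sum_convex_le hy
    (fun i k h => v2vReach_of_v2iReach (hy'.supp i k h)) ?_ hy'.rate hf b _ ?_ ?_
  · rintro i k ⟨hi, z, hz, hzk⟩
    exact hy'.full z k ⟨mem_capable_of_mem_cluster hi hz, hzk⟩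
  · intro x hx
    rw [Finite.mem_toFinset] at hx
    exact hx.2
  · rintro x hx ⟨k, hk⟩
    rw [Finite.mem_toFinset]
    exact ⟨hk.1, hx⟩

theorem blockSum_convex_rate_le (hds : d < s / 2) (ρ : ℝ≥0) (c : Conf s) (b : ℤ) {f : ℝ → ℝ}
    (hf : ConvexOn ℝ univ f) (h0 : ∀ t, 0 ≤ t → 0 ≤ f t) :
    blockSum (fun p => ENNReal.ofReal (f (maxMinRate (v2vReach d s p.1.1) ρ p.2))) c b ≤
      blockSum (fun p => ENNReal.ofReal (f (maxMinRate (v2iReach d s p.1.1) ρ p.2))) c b := by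
  rw [blockSum_eq_sum _ fun p => h0 _ (NNReal.coe_nonneg _),
    blockSum_eq_sum _ fun p => h0 _ (NNReal.coe_nonneg _)]
  exact ENNReal.ofReal_le_ofReal (sum_convex_rate_le hds ρ c b hf)

/-- Both `t` and `-t` are convex, so the comparison holds in both directions: the two networks
distribute the same total capacity. -/
theorem blockSum_rate_eq (hds : d < s / 2) (ρ : ℝ≥0) (c : Conf s) (b : ℤ) :
    blockSum (fun p => ENNReal.ofReal (maxMinRate (v2vReach d s p.1.1) ρ p.2)) c b =
      blockSum (fun p => ENNReal.ofReal (maxMinRate (v2iReach d s p.1.1) ρ p.2)) c b := by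
  rw [blockSum_eq_sum _ fun p => NNReal.coe_nonneg _, blockSum_eq_sum _ fun p => NNReal.coe_nonneg _]
  congr 1
  refine le_antisymm (sum_convex_rate_le hds ρ c b (convexOn_id convex_univ)) ?_
  have := sum_convex_rate_le hds ρ c b (f := fun t => -t) (concaveOn_id convex_univ).neg
  simpa using this

/-! ### Bounds on the rates -/

theorem exists_balanced_v2v (hds : d < s / 2) (ρ : ℝ≥0) (c : Conf s) :
    ∃ y, IsBalanced (v2vReach d s c.1) ρ y (maxMinRate (v2vReach d s c.1) ρ) :=
  (isBlockNetwork_v2v hds c).exists_balanced_maxMinRate ρ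

theorem exists_balanced_v2i (hds : d < s / 2) (ρ : ℝ≥0) (c : Conf s) :
    ∃ y, IsBalanced (v2iReach d s c.1) ρ y (maxMinRate (v2iReach d s c.1) ρ) :=
  (isBlockNetwork_v2i hds c).exists_balanced_maxMinRate ρ

/-- The vehicles of a cluster share at most the capacity of the stations of the cluster. -/
theorem clusterSize_mul_rate_le (hds : d < s / 2) (ρ : ℝ≥0) (c : Conf s) {x : ℝ}
    (hx : x ∈ capable c.1) :
    (clusterSize d c.1 x : ℝ≥0∞) * maxMinRate (v2vReach d s c.1) ρ x ≤
      ρ * (clusterRSUs d s c.1 x : ℝ≥0∞) := by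
  have hds' : d < s := by have := hs.out; linarith
  obtain ⟨y, hy⟩ := exists_balanced_v2v hds ρ c
  have hfin := finite_cluster hds' c hx
  have h := hy.sum_rate_le hfin.toFinset {k | v2vReach d s c.1 x k} fun i hi k hk => by
    rw [Finite.mem_toFinset] at hi
    exact (v2vReach_of_mem_cluster hx hi k).2 hk
  rw [Finset.sum_congr rfl (g := fun _ => (maxMinRate (v2vReach d s c.1) ρ x : ℝ≥0∞)),
    Finset.sum_const, nsmul_eq_mul] at h
  · rwa [clusterSize, hfin.encard_eq_coe_toFinset_card, ENat.toENNReal_coe]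
  · intro i hi
    rw [Finite.mem_toFinset] at hi
    rw [hy.rate_eq_of_reach (fun k => (v2vReach_of_mem_cluster hx hi k).symm)]

theorem rateV2V_eq_zero_iff (hds : d < s / 2) {ρ : ℝ≥0} (hρ : 0 < ρ) (c : Conf s) (x : ℝ) :
    maxMinRate (v2vReach d s c.1) ρ x = 0 ↔ ¬ ∃ k, v2vReach d s c.1 x k := by
  obtain ⟨y, hy⟩ := exists_balanced_v2v hds ρ c
  refine ⟨fun h ⟨k, hk⟩ => (hy.rate_pos hρ hk).ne' h, fun h => hy.rate_eq_zero fun k hk => h ⟨k, hk⟩⟩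

theorem rateV2I_eq_zero_iff (hds : d < s / 2) {ρ : ℝ≥0} (hρ : 0 < ρ) (c : Conf s) (x : ℝ) :
    maxMinRate (v2iReach d s c.1) ρ x = 0 ↔ ¬ ∃ k, v2iReach d s c.1 x k := by
  obtain ⟨y, hy⟩ := exists_balanced_v2i hds ρ c
  refine ⟨fun h ⟨k, hk⟩ => (hy.rate_pos hρ hk).ne' h, fun h => hy.rate_eq_zero fun k hk => h ⟨k, hk⟩⟩

/-- A cluster of `N` vehicles reaches `M ≤ N` RSUs and shares at most `ρ * M` equally. The bound
makes all moments finite. -/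
theorem rateV2V_le (hds : d < s / 2) (ρ : ℝ≥0) (c : Conf s) (x : ℝ) :
    maxMinRate (v2vReach d s c.1) ρ x ≤ ρ := by
  have hds' : d < s := by have := hs.out; linarith
  obtain ⟨y, hy⟩ := exists_balanced_v2v hds ρ c
  by_cases hx : x ∈ capable c.1
  · have h1 := clusterSize_mul_rate_le hds ρ c hx
    have hfin := finite_cluster hds' c hx
    have h2 : (clusterRSUs d s c.1 x : ℝ≥0∞) ≤ (clusterSize d c.1 x : ℝ≥0∞) :=
      ENat.toENNReal_le.2 (clusterRSUs_le_clusterSize hds)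
    have h3 : (clusterSize d c.1 x : ℝ≥0∞) ≠ 0 := by
      rw [Ne, ENat.toENNReal_eq_zero, clusterSize, encard_eq_zero]
      exact Nonempty.ne_empty ⟨x, mem_cluster_self⟩
    have h4 : (clusterSize d c.1 x : ℝ≥0∞) ≠ ∞ := by
      rw [Ne, ENat.toENNReal_eq_top, clusterSize, encard_eq_top_iff, not_infinite]
      exact hfin
    have h5 := h1.trans (mul_le_mul_right h2 (ρ : ℝ≥0∞))
    rw [mul_comm (ρ : ℝ≥0∞), ENNReal.mul_le_mul_iff_right h3 h4] at h5
    exact_mod_cast h5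
  · rw [hy.rate_eq_zero fun k hk => hx hk.1]
    exact zero_le

/-- In the network without relaying, the vehicles in range of a station share its capacity
equally. -/
theorem rateV2I_eq (hds : d < s / 2) (ρ : ℝ≥0) (c : Conf s) {x : ℝ} {k : ℤ}
    (hx : v2iReach d s c.1 x k) :
    ((capable c.1 ∩ {z | |z - k * s| ≤ d}).encard : ℝ≥0∞) * maxMinRate (v2iReach d s c.1) ρ x = ρ := by
  obtain ⟨y, hy⟩ := exists_balanced_v2i hds ρ c
  have hreach : ∀ z ∈ capable c.1 ∩ {z | |z - k * s| ≤ d}, v2iReach d s c.1 z k := fun z hz => hz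
  have h1 : ∀ z ∈ capable c.1 ∩ {z | |z - k * s| ≤ d},
      maxMinRate (v2iReach d s c.1) ρ z = maxMinRate (v2iReach d s c.1) ρ x := by
    intro z hz
    refine hy.rate_eq_of_reach fun j => ⟨fun hj => ?_, fun hj => ?_⟩
    · rwa [v2iReach_unique hds hj hz]
    · rw [v2iReach_unique hds hj hx]; exact hz
  have h2 : ∀ z, v2iReach d s c.1 z k → (y z k : ℝ≥0∞) = maxMinRate (v2iReach d s c.1) ρ z := by
    intro z hz
    rw [← hy.rate z, tsum_eq_single k]
    intro j hj
    by_contra hne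
    exact hj (v2iReach_unique hds (hy.supp z j (by simpa using hne)) hz)
  have h3 : ∀ z, (y z k : ℝ≥0∞) = (capable c.1 ∩ {z | |z - k * s| ≤ d}).indicator
      (fun _ => (maxMinRate (v2iReach d s c.1) ρ x : ℝ≥0∞)) z := by
    intro z
    by_cases hz : z ∈ capable c.1 ∩ {z | |z - k * s| ≤ d}
    · rw [indicator_of_mem hz, h2 z hz, h1 z hz]
    · rw [indicator_of_notMem hz]
      by_contra hne
      exact hz (hy.supp z k (by simpa using hne))
  have h4 := hy.full x k hx
  rw [tsum_congr h3, ← tsum_subtype (capable c.1 ∩ {z | |z - k * s| ≤ d})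
    fun _ => (maxMinRate (v2iReach d s c.1) ρ x : ℝ≥0∞), ENNReal.tsum_const] at h4
  exact h4

theorem rateV2I_le (hds : d < s / 2) (ρ : ℝ≥0) (c : Conf s) (x : ℝ) :
    maxMinRate (v2iReach d s c.1) ρ x ≤ ρ := by
  by_cases h : ∃ k, v2iReach d s c.1 x k
  · obtain ⟨k, hk⟩ := h
    have h1 := rateV2I_eq hds ρ c hk
    have h2 : (1 : ℝ≥0∞) ≤ ((capable c.1 ∩ {z | |z - k * s| ≤ d}).encard : ℝ≥0∞) := by
      rw [← ENat.toENNReal_one, ENat.toENNReal_le, one_le_encard_iff_nonempty]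
      exact ⟨x, hk⟩
    have h3 := mul_le_mul_left h2 (maxMinRate (v2iReach d s c.1) ρ x : ℝ≥0∞)
    rw [one_mul, h1] at h3
    exact_mod_cast h3
  · obtain ⟨y, hy⟩ := exists_balanced_v2i hds ρ c
    rw [hy.rate_eq_zero fun k hk => h ⟨k, hk⟩]
    exact zero_le

end Conf

/-! ### The capable vehicles of one period -/

/-- The expected number of capable vehicles of one period with a given property. -/
def vehicleMeasure {s : ℝ} [Fact (0 < s)] (μ : Measure (Conf s)) : Measure (Conf s × ℝ) :=
  (μ ⊗ₘ Conf.capPts).restrict (Prod.snd ⁻¹' cell s 0)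

theorem isPeriodic_indicator {s : ℝ} {A : Set (Conf s × ℝ)}
    (h : ∀ k c x, (Conf.shift k c, x) ∈ A ↔ (c, x + k * s) ∈ A) :
    IsPeriodic (A.indicator fun _ => 1) := fun k c x => by
  classical
  rw [indicator_apply, indicator_apply]
  exact if_congr (h k c x) rfl rfl

theorem eq_ofReal_sub_of_add_eq {a : ℝ≥0∞} {x y : ℝ} (hy : 0 ≤ y)
    (h : a + ENNReal.ofReal y = ENNReal.ofReal x) : a = ENNReal.ofReal (x - y) := by
  rw [ENNReal.ofReal_sub x hy]
  exact ENNReal.eq_sub_of_add_eq ENNReal.ofReal_ne_top h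

theorem phi_pos {lam γ d : ℝ} (hlam : 0 < lam) (hγ0 : 0 < γ) (hγ1 : γ ≤ 1) (hd : 0 < d) :
    0 < phi lam γ d := by
  have h1 : 0 < Real.exp (-(lam * d)) := Real.exp_pos _
  have h2 : Real.exp (-(lam * d)) < 1 := by
    rw [Real.exp_lt_one_iff]; have := mul_pos hlam hd; linarith
  unfold phi
  nlinarith

theorem phi_lt_one {lam γ d : ℝ} (hlam : 0 < lam) (hγ0 : 0 < γ) (hd : 0 < d) :
    phi lam γ d < 1 := by
  have h2 : Real.exp (-(lam * d)) < 1 := by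
    rw [Real.exp_lt_one_iff]; have := mul_pos hlam hd; linarith
  unfold phi
  nlinarith

section

variable {s : ℝ} [hs : Fact (0 < s)] {μ : Measure (Conf s)} {d : ℝ}

theorem measurableSet_clusterSize_and_lt (d : ℝ) (n m : ℕ) :
    MeasurableSet {p : Conf s × ℝ | p.2 ∈ capable p.1.1 ∧ clusterSize d p.1.1 p.2 = n ∧
      (m : ℕ∞) < clusterRSUs d s p.1.1 p.2} := by
  have := (Conf.measurableSet_clusterSize (s := s) d measurable_fst measurable_snd n).inter
    (Conf.measurableSet_lt_clusterRSUs (s := s) d (T := Conf s × ℝ) measurable_fst measurable_snd m)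
  convert this using 1
  ext p
  exact and_assoc.symm

/-- A vehicle with a rate above `r` belongs to a cluster that is connected to many stations. -/
theorem vehicleMeasure_lt_rateV2V_le (hds : d < s / 2) {ρ : ℝ≥0} (hρ : 0 < ρ) {r : ℝ} (hr : 0 ≤ r) :
    vehicleMeasure μ {p | r < maxMinRate (v2vReach d s p.1.1) ρ p.2} ≤
      ∑' n : ℕ, vehicleMeasure μ {p | p.2 ∈ capable p.1.1 ∧
        clusterSize d p.1.1 p.2 = (n + 1 : ℕ) ∧
        (⌊r * ((n + 1 : ℕ) : ℝ) / ρ⌋₊ : ℕ∞) < clusterRSUs d s p.1.1 p.2} := by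
  have hds' : d < s := by have := hs.out; linarith
  refine le_trans (measure_mono ?_) (measure_iUnion_le _)
  intro p hp
  simp only [mem_ofPred_eq] at hp
  have hx : p.2 ∈ capable p.1.1 := by
    by_contra hx
    -- A position that is not a capable vehicle reaches nothing and has rate zero, which is not
    -- above `r ≥ 0`.
    rw [(Conf.rateV2V_eq_zero_iff hds hρ p.1 p.2).2 fun ⟨k, hk⟩ => hx hk.1] at hp
    exact absurd hp (not_lt.2 hr)
  have hfin := Conf.finite_cluster hds' p.1 hx
  have h1 := Conf.clusterSize_mul_rate_le hds ρ p.1 hx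
  have hne : (cluster d p.1.1 p.2).ncard ≠ 0 :=
    (ncard_pos hfin).2 ⟨p.2, mem_cluster_self⟩ |>.ne'
  obtain ⟨n, hn⟩ := Nat.exists_eq_succ_of_ne_zero hne
  have hN : clusterSize d p.1.1 p.2 = (n + 1 : ℕ) := by
    rw [clusterSize, ← hfin.cast_ncard_eq, hn]
  refine mem_iUnion.2 ⟨n, hx, hN, ?_⟩
  have hM : clusterRSUs d s p.1.1 p.2 ≤ (n + 1 : ℕ) := hN ▸ clusterRSUs_le_clusterSize hds
  obtain ⟨M, hM⟩ := ENat.ne_top_iff_exists.1 (ne_top_of_le_ne_top (ENat.natCast_ne_top _) hM)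
  rw [hN, ← hM, ENat.toENNReal_coe, ENat.toENNReal_coe] at h1
  rw [← hM, Nat.cast_lt]
  have h2 : ((n + 1 : ℕ) : ℝ) * maxMinRate (v2vReach d s p.1.1) ρ p.2 ≤ ρ * M := by
    exact_mod_cast h1
  rw [Nat.floor_lt (by positivity), div_lt_iff₀ (by exact_mod_cast hρ)]
  refine lt_of_lt_of_le ?_ (h2.trans_eq (mul_comm _ _))
  rw [mul_comm]
  exact mul_lt_mul_of_pos_left hp (by positivity)

variable [IsProbabilityMeasure μ]

theorem lintegral_vehicleMeasure {G : Conf s × ℝ → ℝ≥0∞} (hG : Measurable G) :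
    ∫⁻ p, G p ∂(vehicleMeasure μ) = periodSum μ G := by
  have hm : MeasurableSet (Prod.snd ⁻¹' cell s 0 : Set (Conf s × ℝ)) :=
    measurable_snd (measurableSet_cell s 0)
  rw [vehicleMeasure, ← lintegral_indicator hm, Measure.lintegral_compProd (hG.indicator hm)]
  refine lintegral_congr fun c => ?_
  rw [Conf.lintegral_capPts c fun x => (Prod.snd ⁻¹' cell s 0).indicator G (c, x)]
  rfl

theorem vehicleMeasure_apply {A : Set (Conf s × ℝ)} (hA : MeasurableSet A) :
    vehicleMeasure μ A = periodSum μ (A.indicator fun _ => 1) := by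
  rw [← lintegral_vehicleMeasure (measurable_const.indicator hA)]
  exact (lintegral_indicator_one hA).symm

theorem measurableSet_fwd' (d : ℝ) (n : ℕ) : MeasurableSet {p : Conf s × ℝ | fwd d n p.1.1 p.2} :=
  Conf.measurableSet_fwd d n measurable_fst measurable_snd

theorem measurableSet_heads (d : ℝ) : MeasurableSet {p : Conf s × ℝ | p.2 ∈ clusterHeads d p.1.1} :=
  Conf.measurableSet_mem_clusterHeads d measurable_fst measurable_snd

end

/-! ### Cluster sizes, size-biasing and convex comparison for the vehicles of one period -/

namespace IsPoissonLaw

variable {s : ℝ} [hs : Fact (0 < s)] {μ : Measure (Conf s)} [IsProbabilityMeasure μ] {lam γ d : ℝ}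

theorem vehicleMeasure_fwd (h : IsPoissonLaw lam γ μ) (hlam : 0 < lam) (hγ0 : 0 < γ) (hγ1 : γ ≤ 1)
    (hd : 0 < d) (hds : d < s) (n : ℕ) :
    vehicleMeasure μ {p | fwd d n p.1.1 p.2} =
      ENNReal.ofReal (lam * γ * s * (1 - phi lam γ d) ^ n) := by
  rw [vehicleMeasure_apply (measurableSet_fwd' d n), ← h.lintegral_tsum_fwd hlam hγ0 hγ1 hd hds n]
  refine lintegral_congr fun c => tsum_congr fun x => ?_
  classical
  simp only [indicator_apply, mem_ofPred_eq]
  split_ifs <;> tauto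

theorem vehicleMeasure_univ (h : IsPoissonLaw lam γ μ) (hlam : 0 < lam) (hγ0 : 0 < γ) (hγ1 : γ ≤ 1) :
    vehicleMeasure μ univ = ENNReal.ofReal (lam * γ * s) := by
  have := h.vehicleMeasure_fwd hlam hγ0 hγ1 (half_pos hs.out) (half_lt_self hs.out) 0
  simpa [fwd] using this

/-- By the successor matching, vehicles that are not first and have `n` further vehicles are as
frequent as all vehicles with `n + 1` further ones. Subtracting leaves `q ^ n - q ^ (n + 1) = φ * q
^ n`, with `q = 1 - φ`, times the density. -/
theorem vehicleMeasure_heads_fwd (h : IsPoissonLaw lam γ μ) (hlam : 0 < lam) (hγ0 : 0 < γ)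
    (hγ1 : γ ≤ 1) (hd : 0 < d) (hds : d < s) (n : ℕ) :
    vehicleMeasure μ {p | p.2 ∈ clusterHeads d p.1.1 ∧ fwd d n p.1.1 p.2} =
      ENNReal.ofReal (lam * γ * s * phi lam γ d * (1 - phi lam γ d) ^ n) := by
  have hq : 0 ≤ 1 - phi lam γ d := by have := phi_lt_one hlam hγ0 hd; linarith
  have hF := h.vehicleMeasure_fwd hlam hγ0 hγ1 hd hds
  have hN : vehicleMeasure μ {p | p.2 ∉ clusterHeads d p.1.1 ∧ fwd d n p.1.1 p.2} =
      ENNReal.ofReal (lam * γ * s * (1 - phi lam γ d) ^ (n + 1)) := by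
    have hm : MeasurableSet {p : Conf s × ℝ | p.2 ∉ clusterHeads d p.1.1 ∧ fwd d n p.1.1 p.2} :=
      (measurableSet_heads d).compl.inter (measurableSet_fwd' d n)
    rw [← hF (n + 1), vehicleMeasure_apply hm, vehicleMeasure_apply (measurableSet_fwd' d (n + 1))]
    refine h.periodSum_congr (measurable_const.indicator hm)
      (measurable_const.indicator (measurableSet_fwd' d (n + 1)))
      (isPeriodic_indicator fun k c x => ?_) (isPeriodic_indicator fun k c x => ?_)
      fun c => (Conf.blockSum_fwd_succ hds n c 0).symm
    · exact and_congr (not_congr Conf.mem_clusterHeads_shift) Conf.fwd_shift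
    · exact Conf.fwd_shift
  have e := measure_inter_add_sdiff (μ := vehicleMeasure μ) {p : Conf s × ℝ | fwd d n p.1.1 p.2}
    (measurableSet_heads d)
  rw [hF n, show {p : Conf s × ℝ | fwd d n p.1.1 p.2} \ {p | p.2 ∈ clusterHeads d p.1.1} =
    {p | p.2 ∉ clusterHeads d p.1.1 ∧ fwd d n p.1.1 p.2} from by ext p; exact and_comm, hN,
    inter_comm] at e
  change vehicleMeasure μ ({p | p.2 ∈ clusterHeads d p.1.1} ∩ {p | fwd d n p.1.1 p.2}) = _
  rw [eq_ofReal_sub_of_add_eq (by have := hs.out; positivity) e]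
  congr 1
  ring

theorem vehicleMeasure_heads (h : IsPoissonLaw lam γ μ) (hlam : 0 < lam) (hγ0 : 0 < γ)
    (hγ1 : γ ≤ 1) (hd : 0 < d) (hds : d < s) :
    vehicleMeasure μ {p | p.2 ∈ clusterHeads d p.1.1} =
      ENNReal.ofReal (lam * γ * s * phi lam γ d) := by
  have := h.vehicleMeasure_heads_fwd hlam hγ0 hγ1 hd hds 0
  simpa [fwd] using this

/-- The number of vehicles of a typical cluster is geometrically distributed. -/
theorem vehicleMeasure_heads_clusterSize (h : IsPoissonLaw lam γ μ) (hlam : 0 < lam) (hγ0 : 0 < γ)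
    (hγ1 : γ ≤ 1) (hd : 0 < d) (hds : d < s) (n : ℕ) :
    vehicleMeasure μ {p | p.2 ∈ clusterHeads d p.1.1 ∧ clusterSize d p.1.1 p.2 = (n + 1 : ℕ)} =
      ENNReal.ofReal (lam * γ * s * phi lam γ d ^ 2 * (1 - phi lam γ d) ^ n) := by
  have hq : 0 ≤ 1 - phi lam γ d := by have := phi_lt_one hlam hγ0 hd; linarith
  have hφ := phi_pos hlam hγ0 hγ1 hd
  -- Size exactly `n + 1` means a chain of `n` but not of `n + 1` further vehicles; this second
  -- difference supplies the second factor `φ`.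
  have e := measure_inter_add_sdiff (μ := vehicleMeasure μ)
    {p : Conf s × ℝ | p.2 ∈ clusterHeads d p.1.1 ∧ fwd d n p.1.1 p.2}
    (measurableSet_fwd' d (n + 1))
  have e1 : {p : Conf s × ℝ | p.2 ∈ clusterHeads d p.1.1 ∧ fwd d n p.1.1 p.2} ∩
      {p | fwd d (n + 1) p.1.1 p.2} =
      {p | p.2 ∈ clusterHeads d p.1.1 ∧ fwd d (n + 1) p.1.1 p.2} := by
    ext p
    constructor
    · exact fun hp => ⟨hp.1.1, hp.2⟩
    · refine fun hp => ⟨⟨hp.1, ?_⟩, hp.2⟩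
      have h2 := (fwd_iff_le_encard hp.1.1 (n + 1)).1 hp.2
      exact (fwd_iff_le_encard hp.1.1 n).2 (le_trans (by exact_mod_cast Nat.le_succ _) h2)
  have e2 : {p : Conf s × ℝ | p.2 ∈ clusterHeads d p.1.1 ∧ fwd d n p.1.1 p.2} \
      {p | fwd d (n + 1) p.1.1 p.2} =
      {p | p.2 ∈ clusterHeads d p.1.1 ∧ clusterSize d p.1.1 p.2 = (n + 1 : ℕ)} := by
    ext p
    constructor
    · exact fun hp => ⟨hp.1.1, (clusterSize_eq_iff hp.1.1 n).2 ⟨hp.1.2, hp.2⟩⟩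
    · intro hp
      have := (clusterSize_eq_iff hp.1 n).1 hp.2
      exact ⟨⟨hp.1, this.1⟩, this.2⟩
  rw [e1, e2, h.vehicleMeasure_heads_fwd hlam hγ0 hγ1 hd hds n,
    h.vehicleMeasure_heads_fwd hlam hγ0 hγ1 hd hds (n + 1), add_comm] at e
  rw [eq_ofReal_sub_of_add_eq (by have := hs.out; positivity) e]
  congr 1
  ring

/-- Size-biasing: a cluster with `n` vehicles is seen by each of them. -/
theorem vehicleMeasure_clusterSize_and_lt (h : IsPoissonLaw lam γ μ) (hds : d < s) (n m : ℕ) :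
    vehicleMeasure μ {p | p.2 ∈ capable p.1.1 ∧ clusterSize d p.1.1 p.2 = n ∧
        (m : ℕ∞) < clusterRSUs d s p.1.1 p.2} =
      n * vehicleMeasure μ {p | p.2 ∈ clusterHeads d p.1.1 ∧ clusterSize d p.1.1 p.2 = n ∧
        (m : ℕ∞) < clusterRSUs d s p.1.1 p.2} := by
  have hm1 := measurableSet_clusterSize_and_lt (s := s) d n m
  have hm2 : MeasurableSet {p : Conf s × ℝ | p.2 ∈ clusterHeads d p.1.1 ∧
      clusterSize d p.1.1 p.2 = n ∧ (m : ℕ∞) < clusterRSUs d s p.1.1 p.2} := by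
    convert (measurableSet_heads d).inter hm1 using 1
    ext p
    exact ⟨fun hp => ⟨hp.1, hp.1.1, hp.2⟩, fun hp => ⟨hp.1, hp.2.2⟩⟩
  rw [vehicleMeasure_apply hm1, vehicleMeasure_apply hm2, ← lintegral_vehicleMeasure
    (measurable_const.indicator hm2), ← lintegral_const_mul _ (measurable_const.indicator hm2),
    lintegral_vehicleMeasure ((measurable_const.indicator hm2).const_mul _)]
  refine h.periodSum_congr (measurable_const.indicator hm1)
    ((measurable_const.indicator hm2).const_mul _) (isPeriodic_indicator fun k c x => ?_) ?_ ?_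
  · change _ ∧ _ ∧ _ ↔ _ ∧ _ ∧ _
    dsimp only
    rw [Conf.mem_capable_shift, Conf.clusterSize_shift, Conf.clusterRSUs_shift]
  · intro k c x
    refine congrArg (fun t => (n : ℝ≥0∞) * t) (isPeriodic_indicator (fun k c x => ?_) k c x)
    change _ ∧ _ ∧ _ ↔ _ ∧ _ ∧ _
    dsimp only
    rw [Conf.mem_clusterHeads_shift, Conf.clusterSize_shift, Conf.clusterRSUs_shift]
  · intro c
    have h1 : blockSum (fun p : Conf s × ℝ => (n : ℝ≥0∞) *
        {p : Conf s × ℝ | p.2 ∈ clusterHeads d p.1.1 ∧ clusterSize d p.1.1 p.2 = n ∧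
          (m : ℕ∞) < clusterRSUs d s p.1.1 p.2}.indicator (fun _ => 1) p) c 0 =
        n * blockSum ({p : Conf s × ℝ | p.2 ∈ clusterHeads d p.1.1 ∧ clusterSize d p.1.1 p.2 = n ∧
          (m : ℕ∞) < clusterRSUs d s p.1.1 p.2}.indicator fun _ => 1) c 0 := ENNReal.tsum_mul_left
    rw [h1, Conf.blockSum_indicator, Conf.blockSum_indicator]
    have key := Conf.encard_eq_mul_encard_heads hds c 0 n
      (Q := fun x => clusterSize d c.1 x = n ∧ (m : ℕ∞) < clusterRSUs d s c.1 x) ?_ fun x _ hx => hx.1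
    · change _ = (n : ℝ≥0∞) * (({x ∈ capable c.1 | c.vblock x = 0} ∩ {x | x ∈ clusterHeads d c.1 ∧
        clusterSize d c.1 x = n ∧ (m : ℕ∞) < clusterRSUs d s c.1 x}).encard : ℝ≥0∞)
      rw [← key]
      congr 2
      ext x
      exact ⟨fun hx => ⟨hx.1, hx.2.2⟩, fun hx => ⟨hx.1, hx.1.1, hx.2⟩⟩
    · intro x hx y hy hQ
      have e1 : clusterSize d c.1 y = clusterSize d c.1 x := by
        unfold clusterSize; rw [cluster_eq_of_mem hy]
      have e2 : clusterRSUs d s c.1 y = clusterRSUs d s c.1 x := by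
        unfold clusterRSUs
        congr 1
        ext k
        exact (v2vReach_of_mem_cluster hx hy k).symm
      rwa [e1, e2]

theorem lintegral_convex_rate_le (h : IsPoissonLaw lam γ μ) (hds : d < s / 2) (ρ : ℝ≥0) {f : ℝ → ℝ}
    (hfm : Measurable f) (hf : ConvexOn ℝ univ f) (h0 : ∀ t, 0 ≤ t → 0 ≤ f t) :
    ∫⁻ p, ENNReal.ofReal (f (maxMinRate (v2vReach d s p.1.1) ρ p.2)) ∂(vehicleMeasure μ) ≤
      ∫⁻ p, ENNReal.ofReal (f (maxMinRate (v2iReach d s p.1.1) ρ p.2)) ∂(vehicleMeasure μ) := by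
  have m1 : Measurable fun p : Conf s × ℝ =>
      ENNReal.ofReal (f (maxMinRate (v2vReach d s p.1.1) ρ p.2)) :=
    ENNReal.measurable_ofReal.comp (hfm.comp (Conf.measurable_rateV2V hds ρ).coe_nnreal_real)
  have m2 : Measurable fun p : Conf s × ℝ =>
      ENNReal.ofReal (f (maxMinRate (v2iReach d s p.1.1) ρ p.2)) :=
    ENNReal.measurable_ofReal.comp (hfm.comp (Conf.measurable_rateV2I hds ρ).coe_nnreal_real)
  rw [lintegral_vehicleMeasure m1, lintegral_vehicleMeasure m2]
  refine h.periodSum_le m1 m2 (fun k c x => ?_) (fun k c x => ?_)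
    fun c => Conf.blockSum_convex_rate_le hds ρ c 0 hf h0
  · dsimp only; rw [Conf.rateV2V_shift hds]
  · dsimp only; rw [Conf.rateV2I_shift hds]

theorem lintegral_rate_eq (h : IsPoissonLaw lam γ μ) (hds : d < s / 2) (ρ : ℝ≥0) :
    ∫⁻ p, ENNReal.ofReal (maxMinRate (v2vReach d s p.1.1) ρ p.2) ∂(vehicleMeasure μ) =
      ∫⁻ p, ENNReal.ofReal (maxMinRate (v2iReach d s p.1.1) ρ p.2) ∂(vehicleMeasure μ) := by
  have m1 : Measurable fun p : Conf s × ℝ =>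
      ENNReal.ofReal (maxMinRate (v2vReach d s p.1.1) ρ p.2) :=
    ENNReal.measurable_ofReal.comp (Conf.measurable_rateV2V hds ρ).coe_nnreal_real
  have m2 : Measurable fun p : Conf s × ℝ =>
      ENNReal.ofReal (maxMinRate (v2iReach d s p.1.1) ρ p.2) :=
    ENNReal.measurable_ofReal.comp (Conf.measurable_rateV2I hds ρ).coe_nnreal_real
  rw [lintegral_vehicleMeasure m1, lintegral_vehicleMeasure m2]
  refine h.periodSum_congr m1 m2 (fun k c x => ?_) (fun k c x => ?_)
    fun c => Conf.blockSum_rate_eq hds ρ c 0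
  · dsimp only; rw [Conf.rateV2V_shift hds]
  · dsimp only; rw [Conf.rateV2I_shift hds]

end IsPoissonLaw

/-! ### The incomplete gamma function -/

/-- `Q(a, x)` is the probability that a Poisson variable with mean `x` is less than `a`. -/
theorem regGammaQ_nat {a : ℕ} {x : ℝ} (hx : 0 ≤ x) :
    regGammaQ ((a + 1 : ℕ) : ℝ) x =
      ∑ j ∈ Finset.range (a + 1), Real.exp (-x) * x ^ j / j.factorial := by
  -- The derivative of `-exp (-t) * ∑ t ^ j / j!` telescopes to the integrand divided by `n!`, which
  -- gives an antiderivative vanishing at infinity.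
  have hderiv : ∀ (n : ℕ) (t : ℝ), HasDerivAt (fun t : ℝ => -(Real.exp (-t) *
      ∑ j ∈ Finset.range (n + 1), t ^ j / j.factorial)) (t ^ n * Real.exp (-t) / n.factorial) t := by
    intro n t
    induction n with
    | zero =>
      have h := (hasDerivAt_neg t).exp.neg
      exact (h.congr_deriv (by simp)).congr_of_eventuallyEq (Filter.Eventually.of_forall fun u => by simp)
    | succ n ih =>
      have h1 := (hasDerivAt_neg t).exp
      have h2 := (hasDerivAt_pow (n + 1) t).div_const (((n + 1).factorial : ℕ) : ℝ)
      have h3 := (ih.add (h1.mul h2).neg)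
      refine (h3.congr_deriv ?_).congr_of_eventuallyEq (Filter.Eventually.of_forall fun u => ?_)
      · have : ((n.factorial : ℕ) : ℝ) ≠ 0 := by positivity
        rw [Nat.factorial_succ]
        push_cast
        field_simp
        ring
      · change -(Real.exp (-u) * _) = -(Real.exp (-u) * _) + -(Real.exp (-u) * (u ^ (n + 1) / _))
        rw [Finset.sum_range_succ _ (n + 1)]
        ring
  have hlim : Filter.Tendsto (fun t : ℝ => -(Real.exp (-t) *
      ∑ j ∈ Finset.range (a + 1), t ^ j / j.factorial)) Filter.atTop (nhds 0) := by
    have : Filter.Tendsto (fun t : ℝ => -(∑ j ∈ Finset.range (a + 1),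
        (t ^ j * Real.exp (-t)) / j.factorial)) Filter.atTop
        (nhds (-(∑ j ∈ Finset.range (a + 1), (0 : ℝ) / j.factorial))) :=
      (tendsto_finsetSum _ fun j _ =>
        (Real.tendsto_pow_mul_exp_neg_atTop_nhds_zero j).div_const _).neg
    simp only [zero_div, Finset.sum_const_zero, neg_zero] at this
    refine this.congr fun t => ?_
    rw [Finset.mul_sum]
    congr 1
    exact Finset.sum_congr rfl fun j _ => by ring
  have hint := integral_Ioi_of_hasDerivAt_of_nonneg' (a := x) (fun t _ => hderiv a t)
    (fun t ht => by have : 0 ≤ t := hx.trans (le_of_lt ht); positivity) hlim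
  have hfac : ((a.factorial : ℕ) : ℝ) ≠ 0 := by positivity
  unfold regGammaQ
  have e : ∀ t : ℝ, t ^ (((a + 1 : ℕ) : ℝ) - 1) * Real.exp (-t) = t ^ a * Real.exp (-t) := by
    intro t
    push_cast
    rw [add_sub_cancel_right, Real.rpow_natCast]
  simp_rw [e]
  rw [Nat.cast_succ, Real.Gamma_nat_eq_factorial, ← integral_div, hint, sub_neg_eq_add, zero_add,
    Finset.mul_sum]
  exact Finset.sum_congr rfl fun j _ => by ring

/-! ### The rate without relaying -/

namespace IsPoissonLaw

variable {s : ℝ} [hs : Fact (0 < s)] {μ : Measure (Conf s)} {lam γ d : ℝ}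

/-- Vehicles that receive service from some station can be counted at the station `0`. -/
theorem periodSum_tsum_reach (h : IsPoissonLaw lam γ μ) {A : Set (Conf s × ℝ)} (hA : MeasurableSet A)
    (hp : ∀ k c x, (Conf.shift k c, x) ∈ A ↔ (c, x + k * s) ∈ A) :
    periodSum μ (fun p => ∑' k : ℤ, {p : Conf s × ℝ | v2iReach d s p.1.1 p.2 k ∧ p ∈ A}.indicator
        (fun _ => 1) p) =
      ∫⁻ c, ∑' x : capable c.1, {p : Conf s × ℝ | v2iReach d s p.1.1 p.2 0 ∧ p ∈ A}.indicator
        (fun _ => 1) (c, (x : ℝ)) ∂μ := by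
  classical
  set R : ℤ → Set (Conf s × ℝ) := fun k => {p | v2iReach d s p.1.1 p.2 k ∧ p ∈ A} with hR
  have hRm : ∀ k, MeasurableSet (R k) := fun k =>
    (Conf.measurableSet_v2iReach d measurable_fst measurable_snd k).inter hA
  -- `G j` counts the vehicles of segment `j` served by RSU `0`. A vehicle of segment `0` served by
  -- RSU `k` becomes, seen from that RSU, a vehicle of segment `-k` served by RSU `0`.
  let G : ℤ → Conf s → ℝ≥0∞ := fun j c => ∑' x : capable c.1,
    (R 0 ∩ Prod.snd ⁻¹' cell s j).indicator (fun _ => (1 : ℝ≥0∞)) (c, (x : ℝ))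
  have hGm : ∀ j, Measurable (G j) := fun j => Conf.measurable_tsum_capable measurable_id
    (measurable_const.indicator ((hRm 0).inter (measurable_snd (measurableSet_cell s j))))
  have e1 : ∀ c : Conf s, ∑' x : capable c.1, (cell s 0).indicator
      (fun x => ∑' k : ℤ, (R k).indicator (fun _ => (1 : ℝ≥0∞)) (c, x)) x =
      ∑' k, G (-k) (Conf.shift k c) := by
    intro c
    have : ∀ k, G (-k) (Conf.shift k c) = ∑' x : capable c.1, (cell s 0).indicator
        (fun x => (R k).indicator (fun _ => (1 : ℝ≥0∞)) (c, x)) x := by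
      intro k
      simp only [G]
      rw [Conf.tsum_capable_shift k c fun x =>
        (R 0 ∩ Prod.snd ⁻¹' cell s (-k)).indicator (fun _ => (1 : ℝ≥0∞)) (Conf.shift k c, x)]
      refine tsum_congr fun x => ?_
      have h1 : (x : ℝ) - k * s ∈ cell s (-k) ↔ (x : ℝ) ∈ cell s 0 := by
        simp only [cell, mem_Ico]
        push_cast
        constructor <;> rintro ⟨h1, h2⟩ <;> constructor <;> linarith
      have h2 : (Conf.shift k c, (x : ℝ) - k * s) ∈ R 0 ↔ (c, (x : ℝ)) ∈ R k := by
        simp only [hR, mem_ofPred_eq, hp, Conf.v2iReach_shift, sub_add_cancel, zero_add]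
      simp only [indicator_apply, mem_inter_iff, mem_preimage, h1, h2]
      split_ifs <;> tauto
    simp_rw [this]
    rw [ENNReal.tsum_comm]
    refine tsum_congr fun x => ?_
    by_cases hx : (x : ℝ) ∈ cell s 0
    · simp only [indicator_of_mem hx]
    · simp only [indicator_of_notMem hx, tsum_zero]
  have e2 : ∀ c : Conf s, ∑' x : capable c.1, (R 0).indicator (fun _ => (1 : ℝ≥0∞)) (c, (x : ℝ)) =
      ∑' j, G j c := by
    intro c
    simp only [G]
    rw [ENNReal.tsum_comm]
    refine tsum_congr fun x => ?_
    rw [tsum_eq_single ⌊(x : ℝ) / s⌋]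
    · have : (x : ℝ) ∈ cell s ⌊(x : ℝ) / s⌋ := (mem_cell_iff hs.out).2 rfl
      simp [indicator_apply, this]
    · intro j hj
      refine indicator_of_notMem (fun hx => hj ?_) _
      exact ((mem_cell_iff hs.out).1 hx.2).symm
  rw [periodSum, lintegral_congr e1, lintegral_congr e2,
    lintegral_tsum fun j => (hGm j).aemeasurable,
    lintegral_tsum (f := fun k c => G (-k) (Conf.shift k c)) fun k => ((hGm (-k)).comp (Conf.measurable_shift k)).aemeasurable,
    ← (Equiv.neg ℤ).tsum_eq fun j => ∫⁻ c, G j c ∂μ]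
  exact tsum_congr fun k => h.lintegral_shift k (hGm (-k))

/-- If `n` vehicles are in range of RSU `0`, each gets `ρ / n`, so all `n` of them or none have a
rate above `r`. With `n` Poisson of mean `x = 2 * γ * lam * d`, the expected count is `∑ n * P(n)`
over `n < ⌈ρ / r⌉`, which equals `x` times a Poisson distribution function. -/
theorem vehicleMeasure_lt_rateV2I [IsProbabilityMeasure μ] (h : IsPoissonLaw lam γ μ) (hlam : 0 < lam) (hγ0 : 0 < γ)
    (hd : 0 < d) (hds : d < s / 2) {ρ : ℝ≥0} (hρ : 0 < ρ) {r : ℝ} (hr : 0 < r) (hrρ : r < ρ) :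
    vehicleMeasure μ {p | r < maxMinRate (v2iReach d s p.1.1) ρ p.2} =
      ENNReal.ofReal (2 * γ * lam * d *
        regGammaQ ((⌈(ρ : ℝ) / r⌉₊ : ℝ) - 1) (2 * γ * lam * d)) := by
  classical
  have hs0 := hs.out
  set A : Set (Conf s × ℝ) := {p | r < maxMinRate (v2iReach d s p.1.1) ρ p.2} with hAdef
  have hA : MeasurableSet A :=
    measurableSet_lt measurable_const (Conf.measurable_rateV2I hds ρ).coe_nnreal_real
  have hp : ∀ k c x, (Conf.shift k c, x) ∈ A ↔ (c, x + k * s) ∈ A := by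
    intro k c x
    simp only [hAdef, mem_ofPred_eq, Conf.rateV2I_shift hds]
  have e1 : A.indicator (fun _ => (1 : ℝ≥0∞)) = fun p => ∑' k : ℤ,
      {p : Conf s × ℝ | v2iReach d s p.1.1 p.2 k ∧ p ∈ A}.indicator (fun _ => 1) p := by
    ext p
    by_cases hpA : p ∈ A
    · have : ∃ k, v2iReach d s p.1.1 p.2 k := by
        by_contra hcon
        have := (Conf.rateV2I_eq_zero_iff hds hρ p.1 p.2).2 hcon
        simp only [hAdef, mem_ofPred_eq, this, NNReal.coe_zero] at hpA
        exact absurd hpA (not_lt.2 hr.le)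
      obtain ⟨k, hk⟩ := this
      rw [tsum_eq_single k, indicator_of_mem hpA, indicator_of_mem]
      · exact ⟨hk, hpA⟩
      · intro j hj
        exact indicator_of_notMem (fun hj' => hj (Conf.v2iReach_unique hds hj'.1 hk)) _
    · rw [indicator_of_notMem hpA, ENNReal.tsum_eq_zero.2]
      exact fun k => indicator_of_notMem (fun hk => hpA hk.2) _
  rw [vehicleMeasure_apply hA, e1, h.periodSum_tsum_reach hA hp]
  set D : Set (ℝ × Bool) := Icc (-d) d ×ˢ {true} with hD
  have hDm : MeasurableSet D := measurableSet_Icc.prod (measurableSet_singleton _)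
  have hDl : Local s D := by
    refine ⟨-1, fun e he => ?_⟩
    have h1 := he.1.1
    have h2 := he.1.2
    simp only [mem_union, cellE, cell, mem_preimage, mem_Ico]
    push_cast
    by_cases h0 : e.1 < 0
    · left; constructor <;> linarith
    · right; constructor <;> linarith
  -- As `r < ρ`, the ceiling is at least `2`, so the subtraction is exact. One unit is lost through
  -- the index shift of the Poisson weights, the other because `Q (a + 1, x)` sums the weights `0`
  -- to `a`.
  set a := ⌈(ρ : ℝ) / r⌉₊ - 2 with ha
  have ha2 : ⌈(ρ : ℝ) / r⌉₊ = a + 2 := by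
    have : 1 < ⌈(ρ : ℝ) / r⌉₊ := by
      rw [Nat.lt_ceil, Nat.cast_one, lt_div_iff₀ hr, one_mul]
      exact hrρ
    omega
  have e2 : ∀ c : Conf s, ∑' x : capable c.1,
      {p : Conf s × ℝ | v2iReach d s p.1.1 p.2 0 ∧ p ∈ A}.indicator (fun _ => (1 : ℝ≥0∞)) (c, (x : ℝ)) =
      ∑ n ∈ Finset.range (a + 2), {c : Conf s | Conf.num D c = n}.indicator (fun _ => (n : ℝ≥0∞)) c := by
    intro c
    set W := capable c.1 ∩ {z | |z - ((0 : ℤ) : ℝ) * s| ≤ d} with hW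
    have hWn : (W.encard : ℝ≥0∞) = (Conf.num D c : ℝ≥0∞) := by
      have : W = capable c.1 ∩ Icc (-d) d := by
        ext z
        simp [hW, abs_le]
      rw [this, Conf.encard_capable_inter, Conf.encard_inter_local c hDl]
    have hmem : ∀ x, v2iReach d s c.1 x 0 → ((c, x) ∈ A ↔ Conf.num D c < a + 2) := by
      intro x hx
      have h1 := Conf.rateV2I_eq hds ρ c hx
      rw [← hW, hWn] at h1
      have h2 : (Conf.num D c : ℝ) * maxMinRate (v2iReach d s c.1) ρ x = ρ := by exact_mod_cast h1
      have h3 : 0 < (Conf.num D c : ℝ) := by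
        rcases (Nat.cast_nonneg (α := ℝ) (Conf.num D c)).eq_or_lt with h0 | h0
        · rw [← h0, zero_mul] at h2
          exact absurd (by exact_mod_cast h2.symm) hρ.ne'
        · exact h0
      rw [← ha2, Nat.lt_ceil, lt_div_iff₀ hr, ← h2, mul_lt_mul_iff_right₀ h3]
      rfl
    have h1 : ∑' x : capable c.1, {p : Conf s × ℝ | v2iReach d s p.1.1 p.2 0 ∧ p ∈ A}.indicator
        (fun _ => (1 : ℝ≥0∞)) (c, (x : ℝ)) =
        ((capable c.1 ∩ {x | v2iReach d s c.1 x 0 ∧ (c, x) ∈ A}).encard : ℝ≥0∞) := by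
      rw [← Conf.tsum_indicator_one_eq_encard]
      rfl
    rw [h1]
    by_cases hn : Conf.num D c < a + 2
    · have : capable c.1 ∩ {x | v2iReach d s c.1 x 0 ∧ (c, x) ∈ A} = W := by
        ext x
        refine ⟨fun hx => hx.2.1, fun hx => ⟨hx.1, hx, (hmem x hx).2 hn⟩⟩
      rw [this, hWn, Finset.sum_eq_single_of_mem _ (Finset.mem_range.2 hn)]
      · simp
      · intro n _ hne
        exact indicator_of_notMem (fun h => hne h.symm) _
    · have : capable c.1 ∩ {x | v2iReach d s c.1 x 0 ∧ (c, x) ∈ A} = ∅ :=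
        eq_empty_iff_forall_notMem.2 fun x hx => hn ((hmem x hx.2.1).1 hx.2.2)
      rw [this, encard_empty, ENat.toENNReal_zero, Finset.sum_eq_zero]
      intro n hn'
      refine indicator_of_notMem (fun h => hn ?_) _
      rw [h]
      exact Finset.mem_range.1 hn'
  simp_rw [e2]
  have hmn : ∀ n : ℕ, MeasurableSet {c : Conf s | Conf.num D c = n} := fun n =>
    Conf.measurable_num hDm hDl (measurableSet_singleton n)
  rw [lintegral_finsetSum _ fun n _ => measurable_const.indicator (hmn n)]
  have hΛ : (vehicleIntensity lam γ D).toNNReal = (2 * γ * lam * d).toNNReal := by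
    rw [hD, vehicleIntensity_capable, Real.volume_Icc, ← ENNReal.ofReal_mul hlam.le,
      ← ENNReal.ofReal_mul (by positivity), ENNReal.ofReal,
      ENNReal.toNNReal_coe]
    congr 1
    ring
  have hΛ0 : 0 ≤ 2 * γ * lam * d := by positivity
  simp_rw [fun n : ℕ => lintegral_indicator_const (μ := μ) (hmn n) (n : ℝ≥0∞),
    h.prob_num_single hDm hDl, hΛ]
  rw [Finset.sum_range_succ', Nat.cast_zero, zero_mul, add_zero]
  simp_rw [poissonMeasure_singleton_succ]
  rw [← Finset.mul_sum, ha2]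
  rw [show ((a + 2 : ℕ) : ℝ) - 1 = ((a + 1 : ℕ) : ℝ) by push_cast; ring, regGammaQ_nat hΛ0,
    ENNReal.ofReal_mul hΛ0, ENNReal.ofReal_sum_of_nonneg fun j _ => by positivity]
  refine congrArg₂ _ rfl (Finset.sum_congr rfl fun j _ => ?_)
  rw [poissonMeasure_singleton, Real.coe_toNNReal _ hΛ0]

end IsPoissonLaw

/-! ### Regular versions of the Poisson process of vehicles -/

section Regular

variable {Ω : Type*} [MeasurableSpace Ω] {P : Measure Ω} [IsProbabilityMeasure P]
  {V : Ω → Set (ℝ × Bool)} {lam γ s : ℝ}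

/-- The Poisson weights of the finite counts already add up to one. -/
theorem IsPoissonPP.ae_finite (hV : IsPoissonPP P V (vehicleIntensity lam γ)) {B : Set (ℝ × Bool)}
    (hB : MeasurableSet B) (hfin : vehicleIntensity lam γ B ≠ ∞) : ∀ᵐ ω ∂P, (V ω ∩ B).Finite := by
  have hm := hV.measurable_count B hB
  have h1 : P (⋃ n : ℕ, (fun ω => (V ω ∩ B).encard) ⁻¹' {(n : ℕ∞)}) = 1 := by
    rw [measure_iUnion]
    · calc ∑' n : ℕ, P ((fun ω => (V ω ∩ B).encard) ⁻¹' {(n : ℕ∞)})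
          = ∑' n : ℕ, poissonMeasure (vehicleIntensity lam γ B).toNNReal {n} :=
            tsum_congr fun n => hV.law_count B hB hfin n
        _ = poissonMeasure (vehicleIntensity lam γ B).toNNReal univ := by
            rw [← Measure.tsum_indicator_apply_singleton _ univ MeasurableSet.univ]
            simp
        _ = 1 := measure_univ
    · intro i j hij
      refine disjoint_left.2 fun ω hi hj => hij ?_
      exact ENat.natCast_inj.1 ((mem_singleton_iff.1 hi).symm.trans (mem_singleton_iff.1 hj))
    · exact fun n => hm (measurableSet_singleton _)
  have h2 := (prob_compl_eq_zero_iff (MeasurableSet.iUnion fun n : ℕ =>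
    hm (measurableSet_singleton (n : ℕ∞)))).2 h1
  refine measure_mono_null (fun ω hω => ?_) h2
  intro hcon
  obtain ⟨n, hn⟩ := mem_iUnion.1 hcon
  exact hω (finite_of_encard_eq_coe hn)

/-- Disjoint segments are nonempty independently with a common probability `q < 1`; that the first
`m` of them are all nonempty has probability `q ^ m`, for every `m`. -/
theorem IsPoissonPP.ae_exists_emptyCell (hV : IsPoissonPP P V (vehicleIntensity lam γ)) (hs : 0 < s)
    {e : ℕ → ℤ} (he : Function.Injective e) : ∀ᵐ ω ∂P, ∃ n, EmptyCell s (V ω) (e n) := by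
  have hcell : ∀ k : ℤ, vehicleIntensity lam γ (cellE s k) = vehicleIntensity lam γ (cellE s 0) := by
    intro k
    rw [← vehicleIntensity_preimage_sub lam γ (k * s) (measurableSet_cellE s 0)]
    congr 1
    ext x
    simp only [cellE, cell, mem_preimage, mem_Ico]
    push_cast
    constructor <;> rintro ⟨h1, h2⟩ <;> constructor <;> linarith
  have hp : ∀ k : ℤ, P ((fun ω => (V ω ∩ cellE s k).encard) ⁻¹' {0}ᶜ) =
      1 - poissonMeasure (vehicleIntensity lam γ (cellE s 0)).toNNReal {0} := by
    intro k
    have hm := hV.measurable_count (cellE s k) (measurableSet_cellE s k)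
    rw [preimage_compl, prob_compl_eq_one_sub (hm (measurableSet_singleton _))]
    have := hV.law_count (cellE s k) (measurableSet_cellE s k)
      (vehicleIntensity_cellE_lt_top s lam γ k).ne 0
    rw [hcell] at this
    rw [← this]
    rfl
  set q := 1 - poissonMeasure (vehicleIntensity lam γ (cellE s 0)).toNNReal {0} with hq
  have hq1 : q < 1 := by
    refine ENNReal.sub_lt_self ENNReal.one_ne_top one_ne_zero ?_
    rw [poissonMeasure_singleton]
    simp [Real.exp_pos]
  have hbound : ∀ m : ℕ, P {ω | ¬ ∃ n, EmptyCell s (V ω) (e n)} ≤ q ^ m := by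
    intro m
    have hind := hV.indep_count m (fun i => cellE s (e i)) (fun i => measurableSet_cellE s _)
      fun i j hij => pairwise_disjoint_cellE hs (he.ne (Fin.val_injective.ne hij))
    have := hind.measure_inter_preimage_eq_mul Finset.univ (sets := fun _ => {0}ᶜ)
      fun i _ => MeasurableSet.of_discrete
    simp_rw [hp] at this
    rw [Finset.prod_const, Finset.card_univ, Fintype.card_fin] at this
    rw [← this]
    refine measure_mono fun ω hω => ?_
    simp only [mem_iInter]
    intro i _ hcon
    exact hω ⟨i, encard_eq_zero.1 hcon⟩
  exact le_antisymm (ge_of_tendsto' (ENNReal.tendsto_pow_atTop_nhds_zero_of_lt_one hq1) hbound)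
    (zero_le)

theorem IsPoissonPP.ae_good (hV : IsPoissonPP P V (vehicleIntensity lam γ)) (hs : 0 < s) :
    ∀ᵐ ω ∂P, Good s (V ω) := by
  have h1 : ∀ᵐ ω ∂P, ∀ k, (V ω ∩ cellE s k).Finite := ae_all_iff.2 fun k =>
    hV.ae_finite (measurableSet_cellE s k) (vehicleIntensity_cellE_lt_top s lam γ k).ne
  have h2 : ∀ᵐ ω ∂P, ∀ k : ℤ, ∃ n : ℕ, EmptyCell s (V ω) (k + n) := ae_all_iff.2 fun k =>
    hV.ae_exists_emptyCell hs fun a b hab => by simpa using hab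
  have h3 : ∀ᵐ ω ∂P, ∀ k : ℤ, ∃ n : ℕ, EmptyCell s (V ω) (k - n) := ae_all_iff.2 fun k =>
    hV.ae_exists_emptyCell hs fun a b hab => by simpa using hab
  filter_upwards [h1, h2, h3] with ω h1 h2 h3
  refine ⟨h1, fun k => ?_, fun k => ?_⟩
  · obtain ⟨n, hn⟩ := h2 k
    exact ⟨k + n, by omega, hn⟩
  · obtain ⟨n, hn⟩ := h3 k
    exact ⟨k - n, by omega, hn⟩

/-- A Poisson process of vehicles agrees almost surely with a random element of the space of
regular configurations. -/
theorem IsPoissonPP.exists_conf (hV : IsPoissonPP P V (vehicleIntensity lam γ)) (hs : 0 < s) :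
    ∃ C : Ω → Conf s, Measurable C ∧ (∀ᵐ ω ∂P, (C ω).1 = V ω) ∧ IsPoissonLaw lam γ (P.map C) := by
  classical
  -- The exceptional set need not be measurable, so it is enlarged to a measurable null set, on
  -- which the configuration is replaced by the empty one.
  set N := toMeasurable P {ω | ¬ Good s (V ω)} with hN
  have hNm : MeasurableSet N := measurableSet_toMeasurable _ _
  have hN0 : P N = 0 := by rw [hN, measure_toMeasurable]; exact hV.ae_good hs
  have hgood : ∀ ω ∉ N, Good s (V ω) := fun ω hω => by
    by_contra hcon
    exact hω (subset_toMeasurable _ _ hcon)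
  let C : Ω → Conf s := fun ω => if h : ω ∈ N then ⟨∅, good_empty s⟩ else ⟨V ω, hgood ω h⟩
  have hC : ∀ ω ∉ N, (C ω).1 = V ω := fun ω hω => by simp only [C, dif_neg hω]
  have hCae : ∀ᵐ ω ∂P, (C ω).1 = V ω := by
    have : ∀ᵐ ω ∂P, ω ∉ N := measure_eq_zero_iff_ae_notMem.1 hN0
    filter_upwards [this] with ω hω using hC ω hω
  have hCm : Measurable C := by
    refine Conf.measurable_iff.2 fun B hB hl => ?_
    have : (fun ω => Conf.num B (C ω)) =
        fun ω => if ω ∈ N then 0 else ((V ω ∩ B).encard).toNat := by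
      ext ω
      by_cases hω : ω ∈ N
      · simp [C, hω, Conf.num]
      · simp only [hω, if_false, Conf.num, hC ω hω]
        rfl
    rw [this]
    exact Measurable.ite hNm measurable_const
      ((measurable_of_countable ENat.toNat).comp (hV.measurable_count B hB))
  refine ⟨C, hCm, hCae, Measure.isProbabilityMeasure_map hCm.aemeasurable, ?_⟩
  intro ι _ D hDm hDl hDd a
  have hm : MeasurableSet {c : Conf s | ∀ i, Conf.num (D i) c = a i} := by
    simp only [ofPred_forall]
    exact MeasurableSet.iInter fun i =>
      Conf.measurable_num (hDm i) (hDl i) (measurableSet_singleton (a i))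
  rw [Measure.map_apply hCm hm]
  let e := Fintype.equivFin ι
  have hind := hV.indep_count _ (fun i => D (e.symm i)) (fun i => hDm _)
    fun i j hij => hDd (e.symm.injective.ne hij)
  have h1 := hind.measure_inter_preimage_eq_mul Finset.univ (sets := fun i => {(a (e.symm i) : ℕ∞)})
    fun i _ => MeasurableSet.of_discrete
  have h2 : P (C ⁻¹' {c : Conf s | ∀ i, Conf.num (D i) c = a i}) =
      P (⋂ i ∈ Finset.univ, (fun ω => (V ω ∩ D (e.symm i)).encard) ⁻¹' {(a (e.symm i) : ℕ∞)}) := by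
    refine measure_congr ?_
    filter_upwards [hCae] with ω hω
    refine propext ?_
    change (∀ i, Conf.num (D i) (C ω) = a i) ↔ ω ∈ ⋂ i ∈ Finset.univ, _
    simp only [mem_iInter, Finset.mem_univ, forall_const, mem_preimage, mem_singleton_iff]
    rw [← e.symm.forall_congr_right (q := fun i => Conf.num (D i) (C ω) = a i)]
    refine forall_congr' fun i => ?_
    rw [← hω, ← ((C ω).2.finite_inter (hDl _)).cast_ncard_eq, Nat.cast_inj, Conf.num]
  rw [h2, h1]
  refine Fintype.prod_equiv e.symm _ _ fun i => ?_
  exact hV.law_count _ (hDm _) (vehicleIntensity_lt_top lam γ (hDl _)).ne _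

end Regular

/-! ### Typical points of regular configurations -/

section TypicalConf

variable {Ω : Type*} [MeasurableSpace Ω] {P : Measure Ω} {s : ℝ}
  {C : Ω → Conf s} {A : Set (Conf s × ℝ)} {S : Ω → Set ℝ}

theorem sum_dirac_apply (hA : ∀ ω, S ω = {x | x ∈ capable (C ω).1 ∧ (C ω, x) ∈ A}) (ω : Ω)
    {U : Set (Ω × ℝ)} (hU : MeasurableSet U) :
    (Measure.sum fun x : ↥(S ω ∩ Ico 0 s) => Measure.dirac (ω, (x : ℝ))) U =
      ∑' x : capable (C ω).1, {p : Ω × ℝ | p.2 ∈ cell s 0 ∧ (C p.1, p.2) ∈ A ∧ p ∈ U}.indicator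
        (fun _ => (1 : ℝ≥0∞)) (ω, (x : ℝ)) := by
  classical
  rw [Measure.sum_apply _ hU]
  simp_rw [Measure.dirac_apply' _ hU]
  rw [tsum_subtype (S ω ∩ Ico 0 s) fun x => U.indicator (1 : Ω × ℝ → ℝ≥0∞) (ω, x),
    tsum_subtype (capable (C ω).1) fun x => {p : Ω × ℝ | p.2 ∈ cell s 0 ∧ (C p.1, p.2) ∈ A ∧
      p ∈ U}.indicator (fun _ => (1 : ℝ≥0∞)) (ω, x)]
  refine tsum_congr fun x => ?_
  have : Ico 0 s = cell s 0 := by simp [cell]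
  rw [this, hA ω]
  simp only [indicator_apply, mem_inter_iff, mem_ofPred_eq, Pi.one_apply]
  split_ifs <;> tauto

variable [hs : Fact (0 < s)]

theorem measurable_sum_dirac (hC : Measurable C) (hAm : MeasurableSet A)
    (hA : ∀ ω, S ω = {x | x ∈ capable (C ω).1 ∧ (C ω, x) ∈ A}) :
    Measurable fun ω => Measure.sum fun x : ↥(S ω ∩ Ico 0 s) => Measure.dirac (ω, (x : ℝ)) := by
  refine Measure.measurable_of_measurable_coe _ fun U hU => ?_
  simp_rw [sum_dirac_apply hA _ hU]
  refine Conf.measurable_tsum_capable hC (measurable_const.indicator ?_)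
  exact (measurable_snd (measurableSet_cell s 0)).inter
    ((((hC.comp measurable_fst).prodMk measurable_snd) hAm).inter hU)

theorem bind_sum_dirac_map [IsProbabilityMeasure P] (hC : Measurable C) (hAm : MeasurableSet A)
    (hA : ∀ ω, S ω = {x | x ∈ capable (C ω).1 ∧ (C ω, x) ∈ A}) :
    (P.bind fun ω => Measure.sum fun x : ↥(S ω ∩ Ico 0 s) => Measure.dirac (ω, (x : ℝ))).map
      (Prod.map C id) = (vehicleMeasure (P.map C)).restrict A := by
  have := Measure.isProbabilityMeasure_map (μ := P) hC.aemeasurable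
  have hΦ : Measurable (Prod.map C id : Ω × ℝ → Conf s × ℝ) := hC.prodMap measurable_id
  ext W hW
  rw [Measure.map_apply hΦ hW, Measure.bind_apply (hΦ hW) (measurable_sum_dirac hC hAm hA).aemeasurable,
    Measure.restrict_apply hW, vehicleMeasure_apply (hW.inter hAm), periodSum, lintegral_map ?_ hC]
  · refine lintegral_congr fun ω => ?_
    rw [sum_dirac_apply hA ω (hΦ hW)]
    refine tsum_congr fun x => ?_
    classical
    simp only [indicator_apply, mem_inter_iff, mem_ofPred_eq, mem_preimage, Prod.map_apply, id]
    split_ifs <;> tauto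
  · refine Conf.measurable_tsum_capable measurable_id (G := (Prod.snd ⁻¹' cell s 0).indicator
      ((W ∩ A).indicator fun _ => 1)) ?_
    exact (measurable_const.indicator (hW.inter hAm)).indicator
      (measurable_snd (measurableSet_cell s 0))

/-- The law of the configuration seen from a typical point. -/
theorem typical_map [IsProbabilityMeasure P] (hC : Measurable C) (hAm : MeasurableSet A)
    (hA : ∀ᵐ ω ∂P, S ω = {x | x ∈ capable (C ω).1 ∧ (C ω, x) ∈ A}) :
    (typical P s S).map (Prod.map C id) =
      ((vehicleMeasure (P.map C)) A)⁻¹ • (vehicleMeasure (P.map C)).restrict A := by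
  have hΦ : Measurable (Prod.map C id : Ω × ℝ → Conf s × ℝ) := hC.prodMap measurable_id
  have e := bind_sum_dirac_map (P := P) (S := fun ω => {x | x ∈ capable (C ω).1 ∧ (C ω, x) ∈ A}) hC hAm
    fun _ => rfl
  -- The points of `V` itself need not depend measurably on `ω`. An almost sure modification leaves
  -- `bind` unchanged and makes the kernel measurable.
  have e' : (P.bind fun ω => Measure.sum fun x : ↥(S ω ∩ Ico 0 s) => Measure.dirac (ω, (x : ℝ))) =
      P.bind fun ω => Measure.sum fun x : ↥({x | x ∈ capable (C ω).1 ∧ (C ω, x) ∈ A} ∩ Ico 0 s) =>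
        Measure.dirac (ω, (x : ℝ)) := by
    refine Measure.bind_congr_right ?_
    filter_upwards [hA] with ω hω
    rw [hω]
  rw [typical, e']
  rw [Measure.map_smul, e, ← Measure.restrict_apply_univ A, ← e, Measure.map_apply hΦ MeasurableSet.univ,
    preimage_univ]

/-- Properties that hold almost surely also hold from the point of view of a typical point. -/
theorem ae_typical (hC : Measurable C) (hAm : MeasurableSet A)
    (hA : ∀ᵐ ω ∂P, S ω = {x | x ∈ capable (C ω).1 ∧ (C ω, x) ∈ A}) {Q : Ω → Prop}
    (hQ : ∀ᵐ ω ∂P, Q ω) : ∀ᵐ p ∂(typical P s S), Q p.1 := by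
  have e' : (P.bind fun ω => Measure.sum fun x : ↥(S ω ∩ Ico 0 s) => Measure.dirac (ω, (x : ℝ))) =
      P.bind fun ω => Measure.sum fun x : ↥({x | x ∈ capable (C ω).1 ∧ (C ω, x) ∈ A} ∩ Ico 0 s) =>
        Measure.dirac (ω, (x : ℝ)) := by
    refine Measure.bind_congr_right ?_
    filter_upwards [hA] with ω hω
    rw [hω]
  rw [typical]
  refine Measure.ae_smul_measure ?_ _
  rw [e']
  set N := toMeasurable P {ω | ¬ Q ω} with hN
  have hNm : MeasurableSet (Prod.fst ⁻¹' N : Set (Ω × ℝ)) :=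
    measurable_fst (measurableSet_toMeasurable _ _)
  have hN0 : P N = 0 := by rw [hN, measure_toMeasurable]; exact hQ
  refine measure_mono_null (t := Prod.fst ⁻¹' N) (fun p hp => subset_toMeasurable _ _ hp) ?_
  rw [Measure.bind_apply hNm (measurable_sum_dirac hC hAm fun _ => rfl).aemeasurable]
  refine (lintegral_congr_ae ?_).trans lintegral_zero
  have : ∀ᵐ ω ∂P, ω ∉ N := measure_eq_zero_iff_ae_notMem.1 hN0
  filter_upwards [this] with ω hω
  rw [Measure.sum_apply _ hNm]
  refine ENNReal.tsum_eq_zero.2 fun x => ?_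
  rw [Measure.dirac_apply' _ hNm]
  exact indicator_of_notMem (show (ω, (x : ℝ)) ∉ Prod.fst ⁻¹' N from hω) _

end TypicalConf

/-! ### The law of the rates of a typical vehicle -/

/-- The law of a regular configuration seen from a typical capable vehicle. -/
def palm {s : ℝ} [Fact (0 < s)] (μ : Measure (Conf s)) : Measure (Conf s × ℝ) :=
  (vehicleMeasure μ univ)⁻¹ • vehicleMeasure μ

/-- The square is not increasing on the whole line; its truncation is increasing and convex and
agrees with the square on rates. -/
theorem convexOn_max_zero_sq : ConvexOn ℝ univ fun t : ℝ => max t 0 ^ 2 :=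
  ((convexOn_id convex_univ).sup (convexOn_const (0 : ℝ) convex_univ)).pow
    (fun _ _ => le_max_right _ _) 2

theorem monotone_max_zero_sq : Monotone fun t : ℝ => max t 0 ^ 2 := fun a _ hab =>
  pow_le_pow_left₀ (le_max_right a 0) (max_le_max_right 0 hab) 2

section

variable {s : ℝ} [hs : Fact (0 < s)] {d : ℝ}

theorem measurable_rateV2V_real (hds : d < s / 2) (ρ : ℝ≥0) :
    Measurable fun p : Conf s × ℝ => (maxMinRate (v2vReach d s p.1.1) ρ p.2 : ℝ) :=
  (Conf.measurable_rateV2V hds ρ).coe_nnreal_real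

theorem measurable_rateV2I_real (hds : d < s / 2) (ρ : ℝ≥0) :
    Measurable fun p : Conf s × ℝ => (maxMinRate (v2iReach d s p.1.1) ρ p.2 : ℝ) :=
  (Conf.measurable_rateV2I hds ρ).coe_nnreal_real

end

namespace IsPoissonLaw

variable {s : ℝ} [hs : Fact (0 < s)] {μ : Measure (Conf s)} {lam γ d : ℝ}

theorem isProbabilityMeasure_palm [IsProbabilityMeasure μ] (h : IsPoissonLaw lam γ μ) (hlam : 0 < lam) (hγ0 : 0 < γ)
    (hγ1 : γ ≤ 1) : IsProbabilityMeasure (palm μ) := by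
  have hs0 := hs.out
  refine ⟨?_⟩
  rw [palm, Measure.smul_apply, smul_eq_mul]
  refine ENNReal.inv_mul_cancel ?_ ?_ <;> rw [h.vehicleMeasure_univ hlam hγ0 hγ1]
  · rw [Ne, ENNReal.ofReal_eq_zero, not_le]
    positivity
  · exact ENNReal.ofReal_ne_top

theorem palm_apply [IsProbabilityMeasure μ] (h : IsPoissonLaw lam γ μ) (hlam : 0 < lam) (hγ0 : 0 < γ) (hγ1 : γ ≤ 1)
    (A : Set (Conf s × ℝ)) :
    (palm μ) A = (ENNReal.ofReal (lam * γ * s))⁻¹ * vehicleMeasure μ A := by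
  rw [palm, Measure.smul_apply, smul_eq_mul, h.vehicleMeasure_univ hlam hγ0 hγ1]

theorem integral_rate_eq [IsProbabilityMeasure μ] (h : IsPoissonLaw lam γ μ) (hds : d < s / 2) (ρ : ℝ≥0) :
    ∫ p, (maxMinRate (v2vReach d s p.1.1) ρ p.2 : ℝ) ∂(palm μ) =
      ∫ p, (maxMinRate (v2iReach d s p.1.1) ρ p.2 : ℝ) ∂(palm μ) := by
  rw [integral_eq_lintegral_of_nonneg_ae
      (Filter.Eventually.of_forall fun p => NNReal.coe_nonneg _)
      (measurable_rateV2V_real hds ρ).aestronglyMeasurable,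
    integral_eq_lintegral_of_nonneg_ae
      (Filter.Eventually.of_forall fun p => NNReal.coe_nonneg _)
      (measurable_rateV2I_real hds ρ).aestronglyMeasurable, palm, lintegral_smul_measure,
    lintegral_smul_measure, h.lintegral_rate_eq hds ρ]

variable [IsProbabilityMeasure (palm μ)]

theorem integrable_of_mem_Icc {X : Conf s × ℝ → ℝ} (hX : Measurable X) {r : ℝ}
    (h0 : ∀ p, 0 ≤ X p) (h1 : ∀ p, X p ≤ r) : Integrable X (palm μ) := by
  refine Integrable.of_bound hX.aestronglyMeasurable r (Filter.Eventually.of_forall fun p => ?_)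
  rw [Real.norm_of_nonneg (h0 p)]
  exact h1 p

/-- Subtracting `f 0` makes `f` nonnegative on rates, so the comparison of nonnegative integrals
applies. The rates lie between `0` and `ρ`, which ensures integrability. -/
theorem integral_monotone_convex_le [IsProbabilityMeasure μ] (h : IsPoissonLaw lam γ μ) (hds : d < s / 2) (ρ : ℝ≥0)
    {f : ℝ → ℝ} (hm : Monotone f) (hf : ConvexOn ℝ univ f) :
    ∫ p, f (maxMinRate (v2vReach d s p.1.1) ρ p.2) ∂(palm μ) ≤
      ∫ p, f (maxMinRate (v2iReach d s p.1.1) ρ p.2) ∂(palm μ) := by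
  let g : ℝ → ℝ := fun t => f t - f 0
  have hgm : Measurable g := hm.measurable.sub_const _
  have hg0 : ∀ t, 0 ≤ t → 0 ≤ g t := fun t ht => sub_nonneg.2 (hm ht)
  have hgc : ConvexOn ℝ univ g := hf.sub (concaveOn_const _ convex_univ)
  have key : ∀ {X : Conf s × ℝ → ℝ≥0}, Measurable (fun p => (X p : ℝ)) → (∀ p, X p ≤ ρ) →
      ∫ p, f (X p) ∂(palm μ) = (∫⁻ p, ENNReal.ofReal (g (X p)) ∂(palm μ)).toReal + f 0 ∧
        ∫⁻ p, ENNReal.ofReal (g (X p)) ∂(palm μ) ≠ ∞ := by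
    intro X hX hXρ
    have hi : Integrable (fun p => g (X p)) (palm μ) := integrable_of_mem_Icc (hgm.comp hX)
      (fun p => hg0 _ (NNReal.coe_nonneg _)) (r := g ρ)
      fun p => sub_le_sub_right (hm (by exact_mod_cast hXρ p)) _
    have e : (fun p => f (X p)) = fun p => g (X p) + f 0 := by
      ext p; simp [g]
    refine ⟨?_, ?_⟩
    · rw [e, integral_add hi (integrable_const _), integral_eq_lintegral_of_nonneg_ae
        (Filter.Eventually.of_forall fun p => hg0 _ (NNReal.coe_nonneg _)) hi.aestronglyMeasurable]
      simp
    · have := hi.2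
      rw [HasFiniteIntegral] at this
      refine ne_of_lt (lt_of_le_of_lt (lintegral_mono fun p => ?_) this)
      rw [Real.enorm_eq_ofReal_abs]
      exact ENNReal.ofReal_le_ofReal (le_abs_self _)
  obtain ⟨e1, -⟩ := key (measurable_rateV2V_real hds ρ) fun p => Conf.rateV2V_le hds ρ p.1 p.2
  obtain ⟨e2, n2⟩ := key (measurable_rateV2I_real hds ρ) fun p => Conf.rateV2I_le hds ρ p.1 p.2
  rw [e1, e2]
  refine add_le_add_left (ENNReal.toReal_mono n2 ?_) _
  rw [palm, lintegral_smul_measure, lintegral_smul_measure]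
  exact mul_le_mul_right (h.lintegral_convex_rate_le hds ρ hgm hgc hg0) _

theorem memLp_rateV2V (hds : d < s / 2) (ρ : ℝ≥0) :
    MemLp (fun p => (maxMinRate (v2vReach d s p.1.1) ρ p.2 : ℝ)) 2 (palm μ) := by
  refine MemLp.of_bound (measurable_rateV2V_real hds ρ).aestronglyMeasurable ρ
    (Filter.Eventually.of_forall fun p => ?_)
  rw [Real.norm_of_nonneg (NNReal.coe_nonneg _)]
  exact_mod_cast Conf.rateV2V_le hds ρ p.1 p.2

theorem memLp_rateV2I (hds : d < s / 2) (ρ : ℝ≥0) :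
    MemLp (fun p => (maxMinRate (v2iReach d s p.1.1) ρ p.2 : ℝ)) 2 (palm μ) := by
  refine MemLp.of_bound (measurable_rateV2I_real hds ρ).aestronglyMeasurable ρ
    (Filter.Eventually.of_forall fun p => ?_)
  rw [Real.norm_of_nonneg (NNReal.coe_nonneg _)]
  exact_mod_cast Conf.rateV2I_le hds ρ p.1 p.2

theorem variance_rate_le [IsProbabilityMeasure μ] (h : IsPoissonLaw lam γ μ) (hds : d < s / 2) (ρ : ℝ≥0) :
    variance (fun p => (maxMinRate (v2vReach d s p.1.1) ρ p.2 : ℝ)) (palm μ) ≤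
      variance (fun p => (maxMinRate (v2iReach d s p.1.1) ρ p.2 : ℝ)) (palm μ) := by
  rw [variance_eq_sub (memLp_rateV2V hds ρ), variance_eq_sub (memLp_rateV2I hds ρ),
    h.integral_rate_eq hds ρ]
  refine sub_le_sub_right ?_ _
  have := h.integral_monotone_convex_le hds ρ monotone_max_zero_sq convexOn_max_zero_sq
  simpa only [max_eq_left (NNReal.coe_nonneg _), Pi.pow_apply] using this

/-- The bound on the distribution of the rate with relaying, in terms of the size and the number of
stations of a typical cluster. -/
theorem palm_real_rateV2V_le [IsProbabilityMeasure μ] (h : IsPoissonLaw lam γ μ) (hlam : 0 < lam) (hγ0 : 0 < γ)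
    (hγ1 : γ ≤ 1) (hd : 0 < d) (hds : d < s / 2) {ρ : ℝ≥0} (hρ : 0 < ρ) {r : ℝ} (hr : 0 ≤ r) :
    1 - phi lam γ d ^ 2 * ∑' n : ℕ, ((n + 1 : ℕ) : ℝ) * (1 - phi lam γ d) ^ n *
        ((vehicleMeasure μ).real {p | p.2 ∈ clusterHeads d p.1.1 ∧
            clusterSize d p.1.1 p.2 = (n + 1 : ℕ) ∧
            (⌊r * ((n + 1 : ℕ) : ℝ) / ρ⌋₊ : ℕ∞) < clusterRSUs d s p.1.1 p.2} /
          (vehicleMeasure μ).real {p | p.2 ∈ clusterHeads d p.1.1 ∧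
            clusterSize d p.1.1 p.2 = (n + 1 : ℕ)}) ≤
      (palm μ).real {p | maxMinRate (v2vReach d s p.1.1) ρ p.2 ≤ r} := by
  have hs0 := hs.out
  have hds' : d < s := by linarith
  have hφ := phi_pos hlam hγ0 hγ1 hd
  have hq : 0 < 1 - phi lam γ d := by have := phi_lt_one hlam hγ0 hd; linarith
  have hq1 : 1 - phi lam γ d < 1 := by linarith
  set q := 1 - phi lam γ d with hqdef
  set φ := phi lam γ d
  set Λ := lam * γ * s with hΛ
  have hΛ0 : 0 < Λ := by positivity
  set T : ℕ → Set (Conf s × ℝ) := fun n => {p | p.2 ∈ clusterHeads d p.1.1 ∧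
    clusterSize d p.1.1 p.2 = (n + 1 : ℕ) ∧
    (⌊r * ((n + 1 : ℕ) : ℝ) / ρ⌋₊ : ℕ∞) < clusterRSUs d s p.1.1 p.2} with hT
  set N : ℕ → Set (Conf s × ℝ) := fun n => {p | p.2 ∈ clusterHeads d p.1.1 ∧
    clusterSize d p.1.1 p.2 = (n + 1 : ℕ)} with hN
  have hNm : ∀ n, vehicleMeasure μ (N n) = ENNReal.ofReal (Λ * φ ^ 2 * q ^ n) := fun n =>
    h.vehicleMeasure_heads_clusterSize hlam hγ0 hγ1 hd hds' n
  have hNr : ∀ n, (vehicleMeasure μ).real (N n) = Λ * φ ^ 2 * q ^ n := fun n => by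
    rw [measureReal_def, hNm, ENNReal.toReal_ofReal (by positivity)]
  have hTN : ∀ n, vehicleMeasure μ (T n) ≤ vehicleMeasure μ (N n) := fun n =>
    measure_mono fun p hp => ⟨hp.1, hp.2.1⟩
  have hTfin : ∀ n, vehicleMeasure μ (T n) ≠ ∞ := fun n =>
    ne_top_of_le_ne_top (by rw [hNm]; exact ENNReal.ofReal_ne_top) (hTN n)
  set t : ℕ → ℝ := fun n => (vehicleMeasure μ).real (T n) / (vehicleMeasure μ).real (N n) with ht
  have ht0 : ∀ n, 0 ≤ t n := fun n => by positivity
  have ht1 : ∀ n, t n ≤ 1 := fun n =>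
    div_le_one_of_le₀ (ENNReal.toReal_mono (by rw [hNm]; exact ENNReal.ofReal_ne_top) (hTN n))
      measureReal_nonneg
  -- The conditional tail times the geometric weight restores the unconditional measure; the weight
  -- is positive, so no division by zero is hidden in `t n`.
  have hTt : ∀ n, vehicleMeasure μ (T n) = ENNReal.ofReal (Λ * (φ ^ 2 * (q ^ n * t n))) := by
    intro n
    have : Λ * (φ ^ 2 * (q ^ n * t n)) = (vehicleMeasure μ).real (T n) := by
      rw [ht]
      dsimp only
      rw [hNr]
      field_simp
    rw [this, measureReal_def, ENNReal.ofReal_toReal (hTfin n)]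
  set a : ℕ → ℝ := fun n => ((n + 1 : ℕ) : ℝ) * q ^ n * t n with ha
  have ha0 : ∀ n, 0 ≤ a n := fun n => mul_nonneg (by positivity) (ht0 n)
  -- Domination by `(n + 1) * q ^ n`. Without summability the real series would take the default
  -- value `0` and could not represent the union bound.
  have hsum : Summable a := by
    have h1 : Summable fun n : ℕ => (n : ℝ) ^ 1 * q ^ n :=
      summable_pow_mul_geometric_of_norm_lt_one 1 (by rwa [Real.norm_of_nonneg hq.le])
    have h2 : Summable fun n : ℕ => q ^ n := summable_geometric_of_lt_one hq.le hq1
    refine Summable.of_nonneg_of_le ha0 (fun n => ?_) (h1.add h2)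
    calc a n ≤ ((n + 1 : ℕ) : ℝ) * q ^ n * 1 := mul_le_mul_of_nonneg_left (ht1 n) (by positivity)
      _ = _ := by push_cast; ring
  have hle : palm μ {p | r < maxMinRate (v2vReach d s p.1.1) ρ p.2} ≤
      ENNReal.ofReal (φ ^ 2 * ∑' n, a n) := by
    rw [h.palm_apply hlam hγ0 hγ1]
    calc (ENNReal.ofReal Λ)⁻¹ * vehicleMeasure μ {p | r < maxMinRate (v2vReach d s p.1.1) ρ p.2}
        ≤ (ENNReal.ofReal Λ)⁻¹ * ENNReal.ofReal (Λ * (φ ^ 2 * ∑' n, a n)) := by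
          refine mul_le_mul_right ((vehicleMeasure_lt_rateV2V_le hds hρ hr).trans_eq ?_) _
          rw [← tsum_mul_left, ← tsum_mul_left, ENNReal.ofReal_tsum_of_nonneg
            (fun n => mul_nonneg hΛ0.le (mul_nonneg (by positivity) (ha0 n)))
            ((hsum.mul_left _).mul_left _)]
          refine tsum_congr fun n => ?_
          rw [h.vehicleMeasure_clusterSize_and_lt hds' (n + 1), hTt, ← ENNReal.ofReal_natCast,
            ← ENNReal.ofReal_mul (by positivity)]
          congr 1
          rw [ha]
          ring
      _ = ENNReal.ofReal (φ ^ 2 * ∑' n, a n) := by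
          rw [ENNReal.ofReal_mul hΛ0.le, ← mul_assoc, ENNReal.inv_mul_cancel, one_mul]
          · rwa [Ne, ENNReal.ofReal_eq_zero, not_le]
          · exact ENNReal.ofReal_ne_top
  have hm : MeasurableSet {p : Conf s × ℝ | r < maxMinRate (v2vReach d s p.1.1) ρ p.2} :=
    measurableSet_lt measurable_const (measurable_rateV2V_real hds ρ)
  have hcompl : {p : Conf s × ℝ | maxMinRate (v2vReach d s p.1.1) ρ p.2 ≤ r} =
      {p : Conf s × ℝ | r < maxMinRate (v2vReach d s p.1.1) ρ p.2}ᶜ := by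
    ext p; simp
  rw [hcompl, probReal_compl_eq_one_sub hm]
  refine sub_le_sub_left ?_ _
  rw [measureReal_def]
  refine ENNReal.toReal_le_of_le_ofReal (mul_nonneg (by positivity) (tsum_nonneg ha0)) hle

theorem palm_real_rateV2V_eq_zero (hds : d < s / 2) {ρ : ℝ≥0} (hρ : 0 < ρ) :
    (palm μ).real {p | (maxMinRate (v2vReach d s p.1.1) ρ p.2 : ℝ) = 0} =
      1 - (palm μ).real {p | ∃ k, v2vReach d s p.1.1 p.2 k} := by
  have hm : MeasurableSet {p : Conf s × ℝ | ∃ k, v2vReach d s p.1.1 p.2 k} := by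
    rw [ofPred_exists]
    exact MeasurableSet.iUnion fun k =>
      Conf.measurableSet_v2vReach d measurable_fst measurable_snd k
  rw [← probReal_compl_eq_one_sub hm]
  congr 1
  ext p
  simpa using Conf.rateV2V_eq_zero_iff hds hρ p.1 p.2

theorem palm_real_rateV2I_eq_zero (hds : d < s / 2) {ρ : ℝ≥0} (hρ : 0 < ρ) :
    (palm μ).real {p | (maxMinRate (v2iReach d s p.1.1) ρ p.2 : ℝ) = 0} =
      1 - (palm μ).real {p | ∃ k, v2iReach d s p.1.1 p.2 k} := by
  have hm : MeasurableSet {p : Conf s × ℝ | ∃ k, v2iReach d s p.1.1 p.2 k} := by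
    rw [ofPred_exists]
    exact MeasurableSet.iUnion fun k =>
      Conf.measurableSet_v2iReach d measurable_fst measurable_snd k
  rw [← probReal_compl_eq_one_sub hm]
  congr 1
  ext p
  simpa using Conf.rateV2I_eq_zero_iff hds hρ p.1 p.2

theorem palm_real_rateV2I_le [IsProbabilityMeasure μ] (h : IsPoissonLaw lam γ μ) (hlam : 0 < lam) (hγ0 : 0 < γ)
    (hγ1 : γ ≤ 1) (hd : 0 < d) (hds : d < s / 2) {ρ : ℝ≥0} (hρ : 0 < ρ) {r : ℝ} (hr : 0 < r)
    (hrρ : r < ρ) :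
    (palm μ).real {p | maxMinRate (v2iReach d s p.1.1) ρ p.2 ≤ r} =
      1 - 2 * d / s * regGammaQ ((⌈(ρ : ℝ) / r⌉₊ : ℝ) - 1) (2 * γ * lam * d) := by
  have hs0 := hs.out
  have hm : MeasurableSet {p : Conf s × ℝ | r < maxMinRate (v2iReach d s p.1.1) ρ p.2} :=
    measurableSet_lt measurable_const (measurable_rateV2I_real hds ρ)
  have hcompl : {p : Conf s × ℝ | maxMinRate (v2iReach d s p.1.1) ρ p.2 ≤ r} =
      {p : Conf s × ℝ | r < maxMinRate (v2iReach d s p.1.1) ρ p.2}ᶜ := by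
    ext p; simp
  have hQ : 0 ≤ regGammaQ ((⌈(ρ : ℝ) / r⌉₊ : ℝ) - 1) (2 * γ * lam * d) := by
    have h1 : 1 < ⌈(ρ : ℝ) / r⌉₊ := by
      rw [Nat.lt_ceil, Nat.cast_one, lt_div_iff₀ hr, one_mul]
      exact hrρ
    obtain ⟨a, ha⟩ := Nat.exists_eq_add_of_lt h1
    rw [ha, show ((1 + a + 1 : ℕ) : ℝ) - 1 = ((a + 1 : ℕ) : ℝ) by push_cast; ring,
      regGammaQ_nat (by positivity)]
    exact Finset.sum_nonneg fun j _ => by positivity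
  rw [hcompl, probReal_compl_eq_one_sub hm, measureReal_def, h.palm_apply hlam hγ0 hγ1,
    h.vehicleMeasure_lt_rateV2I hlam hγ0 hd hds hρ hr hrρ, ENNReal.toReal_mul, ENNReal.toReal_inv,
    ENNReal.toReal_ofReal (by positivity), ENNReal.toReal_ofReal (by positivity)]
  congr 1
  field_simp

end IsPoissonLaw

/-! ### Transfer to the road -/

section Transfer

variable {Ω : Type*} [MeasurableSpace Ω] {P : Measure Ω} {s d : ℝ}
  [hs : Fact (0 < s)] {C : Ω → Conf s} {V : Ω → Set (ℝ × Bool)}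

theorem ae_typicalVehicle (hC : Measurable C) (hCV : ∀ᵐ ω ∂P, (C ω).1 = V ω) :
    ∀ᵐ p ∂(typicalVehicle P s V), (C p.1).1 = V p.1 := by
  refine ae_typical (S := fun ω => capable (V ω)) (Q := fun ω => (C ω).1 = V ω) hC
    MeasurableSet.univ ?_ hCV
  filter_upwards [hCV] with ω hω
  rw [hω]
  simp

theorem typicalVehicle_map [IsProbabilityMeasure P] (hC : Measurable C) (hCV : ∀ᵐ ω ∂P, (C ω).1 = V ω) :
    (typicalVehicle P s V).map (Prod.map C id) = palm (P.map C) := by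
  rw [typicalVehicle, typical_map hC MeasurableSet.univ, Measure.restrict_univ, palm]
  filter_upwards [hCV] with ω hω
  rw [hω]
  simp

/-- Transfers probabilities to the space of regular configurations. The event `U` on the road need
only agree almost surely with the measurable event `W`. -/
theorem typicalVehicle_real [IsProbabilityMeasure P] (hC : Measurable C) (hCV : ∀ᵐ ω ∂P, (C ω).1 = V ω) {U : Set (Ω × ℝ)}
    {W : Set (Conf s × ℝ)} (hW : MeasurableSet W)
    (hUW : ∀ p : Ω × ℝ, (C p.1).1 = V p.1 → (p ∈ U ↔ (C p.1, p.2) ∈ W)) :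
    (typicalVehicle P s V).real U = (palm (P.map C)).real W := by
  have hΦ : Measurable (Prod.map C id : Ω × ℝ → Conf s × ℝ) := hC.prodMap measurable_id
  rw [measureReal_def, measureReal_def, ← typicalVehicle_map hC hCV, Measure.map_apply hΦ hW]
  congr 1
  refine measure_congr ?_
  filter_upwards [ae_typicalVehicle hC hCV] with p hp
  exact propext (hUW p hp)

theorem typicalCluster_real [IsProbabilityMeasure P] (hC : Measurable C) (hCV : ∀ᵐ ω ∂P, (C ω).1 = V ω) {U : Set (Ω × ℝ)}
    {W : Set (Conf s × ℝ)} (hW : MeasurableSet W)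
    (hUW : ∀ p : Ω × ℝ, (C p.1).1 = V p.1 → p.2 ∈ clusterHeads d (V p.1) →
      (p ∈ U ↔ (C p.1, p.2) ∈ W)) (hWh : ∀ p ∈ W, p.2 ∈ clusterHeads d p.1.1) :
    (typicalCluster P d s V).real U =
      ((vehicleMeasure (P.map C)).real {p | p.2 ∈ clusterHeads d p.1.1})⁻¹ *
        (vehicleMeasure (P.map C)).real W := by
  have hΦ : Measurable (Prod.map C id : Ω × ℝ → Conf s × ℝ) := hC.prodMap measurable_id
  have hA : ∀ᵐ ω ∂P, clusterHeads d (V ω) = {x | x ∈ capable (C ω).1 ∧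
      (C ω, x) ∈ {p : Conf s × ℝ | p.2 ∈ clusterHeads d p.1.1}} := by
    filter_upwards [hCV] with ω hω
    rw [← hω]
    ext x
    exact ⟨fun hx => ⟨hx.1, hx⟩, fun hx => hx.2⟩
  have hm := typical_map hC (measurableSet_heads d) hA
  have hheads : ∀ᵐ p ∂(typicalCluster P d s V), p.2 ∈ clusterHeads d (C p.1).1 := by
    refine ae_of_ae_map (f := Prod.map C id) hΦ.aemeasurable
      (p := fun q : Conf s × ℝ => q.2 ∈ clusterHeads d q.1.1) ?_
    rw [typicalCluster, hm]
    exact Measure.ae_smul_measure (ae_restrict_mem (measurableSet_heads d)) _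
  have e : (typicalCluster P d s V) U = (typicalCluster P d s V) (Prod.map C id ⁻¹' W) := by
    refine measure_congr ?_
    filter_upwards [ae_typical hC (measurableSet_heads d) hA hCV, hheads] with p hp hph
    rw [hp] at hph
    exact propext (hUW p hp hph)
  rw [measureReal_def, e, ← Measure.map_apply hΦ hW, typicalCluster, hm, Measure.smul_apply,
    Measure.restrict_apply hW, smul_eq_mul, ENNReal.toReal_mul, ENNReal.toReal_inv]
  rw [inter_eq_left.2 (show W ⊆ {p | p.2 ∈ clusterHeads d p.1.1} from hWh)]
  rfl

/-- The normalisation of the typical cluster law cancels in the quotient, leaving expected numbers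
of first vehicles in one period. -/
theorem condTailM_eq [IsProbabilityMeasure P] (hC : Measurable C) (hCV : ∀ᵐ ω ∂P, (C ω).1 = V ω)
    (h0 : (vehicleMeasure (P.map C)).real {p | p.2 ∈ clusterHeads d p.1.1} ≠ 0) (m n : ℕ) :
    condTailM P d s V m n =
      (vehicleMeasure (P.map C)).real {p | p.2 ∈ clusterHeads d p.1.1 ∧
          clusterSize d p.1.1 p.2 = n ∧ (m : ℕ∞) < clusterRSUs d s p.1.1 p.2} /
        (vehicleMeasure (P.map C)).real {p | p.2 ∈ clusterHeads d p.1.1 ∧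
          clusterSize d p.1.1 p.2 = n} := by
  have m1 : MeasurableSet {p : Conf s × ℝ | p.2 ∈ clusterHeads d p.1.1 ∧
      clusterSize d p.1.1 p.2 = n} := by
    convert (measurableSet_heads d).inter
      (Conf.measurableSet_clusterSize (s := s) d measurable_fst measurable_snd n) using 1
    ext p
    exact ⟨fun hp => ⟨hp.1, hp.1.1, hp.2⟩, fun hp => ⟨hp.1, hp.2.2⟩⟩
  have m2 : MeasurableSet {p : Conf s × ℝ | p.2 ∈ clusterHeads d p.1.1 ∧
      clusterSize d p.1.1 p.2 = n ∧ (m : ℕ∞) < clusterRSUs d s p.1.1 p.2} := by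
    convert m1.inter (Conf.measurableSet_lt_clusterRSUs (s := s) d (T := Conf s × ℝ)
      measurable_fst measurable_snd m) using 1
    ext p
    exact and_assoc.symm
  rw [condTailM, typicalCluster_real hC hCV m2 (d := d) ?_ fun p hp => hp.1,
    typicalCluster_real hC hCV m1 (d := d) ?_ fun p hp => hp.1]
  · exact mul_div_mul_left _ _ (inv_ne_zero h0)
  · intro p hp hph
    rw [← hp] at hph
    simp only [mem_ofPred_eq, ← hp, hph, true_and]
  · intro p hp hph
    rw [← hp] at hph
    simp only [mem_ofPred_eq, ← hp, hph, true_and]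

theorem rateV2V_ae_eq (hC : Measurable C) (hCV : ∀ᵐ ω ∂P, (C ω).1 = V ω) (d : ℝ) (ρ : ℝ≥0) :
    rateV2V d s ρ V =ᵐ[typicalVehicle P s V]
      (fun p : Conf s × ℝ => (maxMinRate (v2vReach d s p.1.1) ρ p.2 : ℝ)) ∘ Prod.map C id := by
  filter_upwards [ae_typicalVehicle hC hCV] with p hp
  simp only [rateV2V, Function.comp_apply, Prod.map_fst, Prod.map_snd, hp, id]

theorem rateV2I_ae_eq (hC : Measurable C) (hCV : ∀ᵐ ω ∂P, (C ω).1 = V ω) (d : ℝ) (ρ : ℝ≥0) :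
    rateV2I d s ρ V =ᵐ[typicalVehicle P s V]
      (fun p : Conf s × ℝ => (maxMinRate (v2iReach d s p.1.1) ρ p.2 : ℝ)) ∘ Prod.map C id := by
  filter_upwards [ae_typicalVehicle hC hCV] with p hp
  simp only [rateV2I, Function.comp_apply, Prod.map_fst, Prod.map_snd, hp, id]

end Transfer

end V2V

end

/-! ### Assembly of the statements for the road -/

theorem theorem2 {Ω : Type*} [MeasurableSpace Ω] (P : Measure Ω) [IsProbabilityMeasure P]
    (lam γ d lamr : ℝ) (ρ : ℝ≥0)
    (hlam : 0 < lam) (hγ0 : 0 < γ) (hγ1 : γ ≤ 1) (hd : 0 < d) (hlamr : 0 < lamr)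
    (hrange : d < lamr⁻¹ / 2) (hρ : 0 < ρ)
    (V : Ω → Set (ℝ × Bool))
    (hV : V2V.IsPoissonPP P V (V2V.vehicleIntensity lam γ)) :
    -- the shared rates are well defined
    (∀ᵐ ω ∂P, (∃! x, V2V.IsMaxMinFair (V2V.v2vReach d lamr⁻¹ (V ω)) ρ x) ∧
      ∃! x, V2V.IsMaxMinFair (V2V.v2iReach d lamr⁻¹ (V ω)) ρ x) ∧
    MemLp (V2V.rateV2V d lamr⁻¹ ρ V) 2 (V2V.typicalVehicle P lamr⁻¹ V) ∧
    MemLp (V2V.rateV2I d lamr⁻¹ ρ V) 2 (V2V.typicalVehicle P lamr⁻¹ V) ∧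
    -- the V2V+V2I network
    (∀ r : ℝ, 0 ≤ r →
      1 - V2V.phi lam γ d ^ 2 *
          ∑' n : ℕ, ((n + 1 : ℕ) : ℝ) * (1 - V2V.phi lam γ d) ^ n *
            V2V.condTailM P d lamr⁻¹ V ⌊r * ((n + 1 : ℕ) : ℝ) / (ρ : ℝ)⌋₊ (n + 1) ≤
        (V2V.typicalVehicle P lamr⁻¹ V).real {p | V2V.rateV2V d lamr⁻¹ ρ V p ≤ r}) ∧
    (V2V.typicalVehicle P lamr⁻¹ V).real {p | V2V.rateV2V d lamr⁻¹ ρ V p = 0} =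
      1 - V2V.coverageV2V P d lamr⁻¹ V ∧
    -- the V2I network
    (∀ r : ℝ, 0 < r → r < ρ →
      (V2V.typicalVehicle P lamr⁻¹ V).real {p | V2V.rateV2I d lamr⁻¹ ρ V p ≤ r} =
        1 - 2 * d / lamr⁻¹ *
          V2V.regGammaQ ((⌈(ρ : ℝ) / r⌉₊ : ℝ) - 1) (2 * γ * lam * d)) ∧
    (∀ r : ℝ, (ρ : ℝ) ≤ r →
      (V2V.typicalVehicle P lamr⁻¹ V).real {p | V2V.rateV2I d lamr⁻¹ ρ V p ≤ r} = 1) ∧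
    (V2V.typicalVehicle P lamr⁻¹ V).real {p | V2V.rateV2I d lamr⁻¹ ρ V p = 0} =
      1 - V2V.coverageV2I P d lamr⁻¹ V ∧
    -- comparison of the two networks
    V2V.IcxLE (V2V.typicalVehicle P lamr⁻¹ V)
      (V2V.rateV2V d lamr⁻¹ ρ V) (V2V.rateV2I d lamr⁻¹ ρ V) ∧
    variance (V2V.rateV2V d lamr⁻¹ ρ V) (V2V.typicalVehicle P lamr⁻¹ V) ≤
      variance (V2V.rateV2I d lamr⁻¹ ρ V) (V2V.typicalVehicle P lamr⁻¹ V) := by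
  have hs : Fact (0 < lamr⁻¹) := ⟨inv_pos.2 hlamr⟩
  -- The regular version `C` has measurable rates; each claim is proved under its Palm law and
  -- pulled back along `Prod.map C id`.
  obtain ⟨C, hC, hCV, hμ⟩ := hV.exists_conf hs.out
  have hμp := hμ.isProbabilityMeasure
  have hpalm := hμ.isProbabilityMeasure_palm hlam hγ0 hγ1
  have hds : d < lamr⁻¹ := by have := hs.out; linarith
  have hΦ : Measurable (Prod.map C id : Ω × ℝ → V2V.Conf lamr⁻¹ × ℝ) := hC.prodMap measurable_id
  have hmap := V2V.typicalVehicle_map hC hCV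
  have hX := V2V.rateV2V_ae_eq hC hCV d ρ
  have hY := V2V.rateV2I_ae_eq hC hCV d ρ
  have hXm := V2V.measurable_rateV2V_real (s := lamr⁻¹) hrange ρ
  have hYm := V2V.measurable_rateV2I_real (s := lamr⁻¹) hrange ρ
  refine ⟨?_, ?_, ?_, ?_, ?_, ?_, ?_, ?_, ?_, ?_⟩
  · filter_upwards [hCV] with ω hω
    rw [← hω]
    exact ⟨(V2V.Conf.isBlockNetwork_v2v hrange (C ω)).existsUnique_isMaxMinFair ρ,
      (V2V.Conf.isBlockNetwork_v2i hrange (C ω)).existsUnique_isMaxMinFair ρ⟩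
  · refine (memLp_congr_ae hX).2 ((memLp_map_measure_iff ?_ hΦ.aemeasurable).1 ?_)
    · exact hXm.aestronglyMeasurable
    · rw [hmap]
      exact V2V.IsPoissonLaw.memLp_rateV2V hrange ρ
  · refine (memLp_congr_ae hY).2 ((memLp_map_measure_iff ?_ hΦ.aemeasurable).1 ?_)
    · exact hYm.aestronglyMeasurable
    · rw [hmap]
      exact V2V.IsPoissonLaw.memLp_rateV2I hrange ρ
  · intro r hr
    have hheads : (V2V.vehicleMeasure (P.map C)).real {p | p.2 ∈ V2V.clusterHeads d p.1.1} ≠ 0 := by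
      have hφ := V2V.phi_pos hlam hγ0 hγ1 hd
      have hs0 := hs.out
      rw [measureReal_def, hμ.vehicleMeasure_heads hlam hγ0 hγ1 hd hds,
        ENNReal.toReal_ofReal (by positivity)]
      positivity
    rw [V2V.typicalVehicle_real hC hCV (measurableSet_le hXm (measurable_const (a := r))) fun p hp => by
      simp only [mem_ofPred_eq, V2V.rateV2V, hp]]
    simp_rw [V2V.condTailM_eq hC hCV hheads]
    exact hμ.palm_real_rateV2V_le hlam hγ0 hγ1 hd hrange hρ hr
  · rw [V2V.coverageV2V, V2V.typicalVehicle_real hC hCV (measurableSet_eq_fun hXm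
      (measurable_const (a := (0 : ℝ)))) fun p hp => by simp only [mem_ofPred_eq, V2V.rateV2V, hp],
      V2V.IsPoissonLaw.palm_real_rateV2V_eq_zero hrange hρ]
    congr 1
    refine (V2V.typicalVehicle_real hC hCV ?_ fun p hp => by simp only [mem_ofPred_eq, hp]).symm
    rw [ofPred_exists]
    exact MeasurableSet.iUnion fun k =>
      V2V.Conf.measurableSet_v2vReach d measurable_fst measurable_snd k
  · intro r hr hrρ
    rw [V2V.typicalVehicle_real hC hCV (measurableSet_le hYm (measurable_const (a := r))) fun p hp => by
      simp only [mem_ofPred_eq, V2V.rateV2I, hp]]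
    exact hμ.palm_real_rateV2I_le hlam hγ0 hγ1 hd hrange hρ hr hrρ
  · intro r hr
    rw [V2V.typicalVehicle_real hC hCV MeasurableSet.univ fun p hp => ?_, probReal_univ]
    simp only [mem_ofPred_eq, V2V.rateV2I, ← hp, mem_univ, iff_true]
    exact le_trans (by exact_mod_cast V2V.Conf.rateV2I_le hrange ρ (C p.1) p.2) hr
  · rw [V2V.coverageV2I, V2V.typicalVehicle_real hC hCV (measurableSet_eq_fun hYm
      (measurable_const (a := (0 : ℝ)))) fun p hp => by simp only [mem_ofPred_eq, V2V.rateV2I, hp],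
      V2V.IsPoissonLaw.palm_real_rateV2I_eq_zero hrange hρ]
    congr 1
    refine (V2V.typicalVehicle_real hC hCV ?_ fun p hp => by simp only [mem_ofPred_eq, hp]).symm
    rw [ofPred_exists]
    exact MeasurableSet.iUnion fun k =>
      V2V.Conf.measurableSet_v2iReach d measurable_fst measurable_snd k
  · intro f hm hf _ _
    have key := hμ.integral_monotone_convex_le hrange ρ hm hf
    have hfX : Measurable fun p : V2V.Conf lamr⁻¹ × ℝ =>
        f (V2V.maxMinRate (V2V.v2vReach d lamr⁻¹ p.1.1) ρ p.2) := hm.measurable.comp hXm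
    have hfY : Measurable fun p : V2V.Conf lamr⁻¹ × ℝ =>
        f (V2V.maxMinRate (V2V.v2iReach d lamr⁻¹ p.1.1) ρ p.2) := hm.measurable.comp hYm
    rw [← hmap, integral_map hΦ.aemeasurable hfX.aestronglyMeasurable,
      integral_map hΦ.aemeasurable hfY.aestronglyMeasurable] at key
    exact (integral_congr_ae (hX.fun_comp f)).trans_le
      (key.trans_eq (integral_congr_ae (hY.fun_comp f)).symm)
  · have key := hμ.variance_rate_le hrange ρ
    rwa [← hmap, variance_map hXm.aemeasurable hΦ.aemeasurable,
      variance_map hYm.aemeasurable hΦ.aemeasurable, ← variance_congr hX, ← variance_congr hY] at key
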